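/- Setting. Let $M$ be a closed oriented PL 4-manifold with a finite triangulation whose vertices are linearly ordered (simplices are oriented by this order unless stated otherwise; pentachora = 4-simplices, oriented consistently with $M$), and let $\omega\in Z^2(M,\mathbb C)$ be a simplicial 2-cocycle with $\omega_s\neq 0$ on every 2-face $s$. A permitted choice of signs is a choice of square roots $K_t$, one for each tetrahedron $t$, for which there are square roots $q_s$, $q_s^2=\omega_s$, with $K_{ijkl}=q_{ijk}q_{ijl}q_{ikl}q_{jkl}$ for $i<j<k<l$. Edge operators. For each tetrahedron $t=ijkl$, $i<j<k<l$, there are linear functionals $\beta_t,\gamma_t$ on 2-cocycles, unique up to $(\beta_t,\gamma_t)\mapsto(\lambda\beta_t,\lambda^{-1}\gamma_t)$, with $$\beta_t(c)\gamma_t(c')+\beta_t(c')\gamma_t(c)=\frac{c_{jkl}c'_{jkl}}{\omega_{jkl}}-\frac{c_{ikl}c'_{ikl}}{\omega_{ikl}}+\frac{c_{ijl}c'_{ijl}}{\omega_{ijl}}-\frac{c_{ijk}c'_{ijk}}{\omega_{ijk}},$$ $$\beta_t(c)\gamma_t(c')-\beta_t(c')\gamma_t(c)=\frac1{K_t}\det\begin{pmatrix}c_{jkl}&c_{ikl}&c_{ijl}\\c'_{jkl}&c'_{ikl}&c'_{ijl}\\\omega_{jkl}&\omega_{ikl}&\omega_{ijl}\end{pmatrix}.$$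 $\gamma_t$ changes sign with the orientation of $t$; for an edge $b$ put $\beta_{bt}=\beta_t(\delta b)$. For a pentachoron $u$ let $F=F^{(u)}$ be the skew-symmetric $5\times5$ matrix, indexed by the tetrahedra of $u$, with $\sum_{t\subset u}\beta_t(c)F_{tt'}=\gamma^{(u)}_{t'}(c)$ for all $c$ and all $t'\subset u$, where in $\gamma^{(u)}_{t'}$ the orientation of $t'$ is induced from $u$; equivalently, all operators $\sum_{t\subset u}(\beta_t(c)\partial_t+\gamma_t^{(u)}(c)\vartheta_t)$ annihilate the Grassmann exponential $\mathcal W_u=\exp(-\frac12\sum_{t,t'\subset u}\vartheta_tF_{tt'}\vartheta_{t'})$. Put $\eta_u=\sqrt{\mathrm H_u}$, $$\mathrm H_u=\frac{\beta_{bt}\,q_{\{ijk\}}q_{\{ijl\}}q_{\{ijm\}}q_{\{klm\}}}{F_{iklm,ijkm}F_{jklm,ijlm}-F_{iklm,ijlm}F_{jklm,ijkm}},$$ for any edge $b=ij$, $i<j$, and tetrahedron $t=ijkl$ of $u$ such that the order $ijklm$ gives the orientation of $u$ and the denominator is nonzero (braces mean increasing order of the vertices). The quantity $I$. Consider the complex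 $$0\to\mathbb C\xrightarrow{f_1}Z^2(M,\mathbb C)\xrightarrow{f_2}\mathbb C^{N_3}\xrightarrow{f_3}\mathbb C^{N_3}\xrightarrow{f_4}Z^2(M,\mathbb C)^*\xrightarrow{f_5}\mathbb C\to0,$$ where $N_3$ is the number of tetrahedra, $f_1(1)=\omega$, $f_2(c)=(\beta_t(c))_t$, $f_3=-\frac12\sum_uF^{(u)}$, $f_4=f_2^{\mathrm T}$, $f_5=f_1^{\mathrm T}$, with any fixed basis of $Z^2(M,\mathbb C)$. It is assumed that the matrices $F^{(u)}$ exist and that the complex is acyclic. Let $$\tau=\frac{\operatorname{minor}f_1\cdot\operatorname{minor}f_3\cdot\operatorname{minor}f_5}{\operatorname{minor}f_2\cdot\operatorname{minor}f_4}$$ be its torsion, calculated with nonzero minors chosen symmetrically (the same basis element of $Z^2(M,\mathbb C)$ is used in $\operatorname{minor}f_1$ and $\operatorname{minor}f_5$, and the remaining ones in $\operatorname{minor}f_2$ and $\operatorname{minor}f_4$; the latter two use the same set of tetrahedra, and $\operatorname{minor}f_3$ uses the remaining tetrahedra both for rows and columns). Put $$I=\prod_{\text{2-faces }s}q_s^{-1}\prod_{\text{pentachora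 }u}\eta_u\cdot\sqrt\tau ,$$ which, because of the square roots, is considered up to a sign. Conjecture. For the 5-simplex with vertices $1,\dots,6$, every nowhere vanishing 2-cocycle on it and all square roots $q_s$ for which the quantities $F^{(u)}$ and $\mathrm H_u$ exist, one has, up to a sign, $$\frac{\eta_{12345}\,\eta_{12346}\,\eta_{12356}}{q_{123}}\iiint\mathcal W_{12345}\widetilde{\mathcal W}_{12346}\mathcal W_{12356}\,\mathrm d\vartheta_{1234}\,\mathrm d\vartheta_{1235}\,\mathrm d\vartheta_{1236}=\frac{\eta_{12456}\,\eta_{13456}\,\eta_{23456}}{q_{456}}\iiint\mathcal W_{12456}\widetilde{\mathcal W}_{13456}\mathcal W_{23456}\,\mathrm d\vartheta_{1456}\,\mathrm d\vartheta_{2456}\,\mathrm d\vartheta_{3456}$$ (Berezin integrals; a tilde means that the orientation of the pentachoron is opposite to the one given by the order of its vertices). Lemma 7.1. Assume the Conjecture. Then, for given $M$ and $\omega$, the quantity $I$ is, up to a sign, the same for all permitted choices of signs of the $K_t$ (and for all $q_s$ agreeing with them) for which it is defined. -/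

import Mathlib

open Finset

noncomputable section

namespace PLFermion

/-! ## Triangulated four-dimensional manifolds

All vertices are natural numbers, so that the vertices of every complex are ordered. Every simplex
is a finite set of vertices; unless stated otherwise it is oriented by the increasing order of its
vertices. -/

/-- The link of `σ` in `X`. -/
def link (X : PreAbstractSimplicialComplex ℕ) (σ : Finset ℕ) : PreAbstractSimplicialComplex ℕ where
  faces := {τ | τ.Nonempty ∧ Disjoint τ σ ∧ τ ∪ σ ∈ X.faces}
  isRelLowerSet_faces := by
    rintro τ ⟨h1, h2, h3⟩
    refine ⟨h1, fun ρ hρ hne => ⟨hne, Disjoint.mono_left hρ h2, ?_⟩⟩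
    exact (X.isRelLowerSet_faces h3).2 (Finset.union_subset_union_left hρ)
      (hne.mono Finset.subset_union_left)

/-- The boundary of the simplex with vertex set `A`. -/
def simplexBoundary (A : Finset ℕ) : PreAbstractSimplicialComplex ℕ where
  faces := {τ | τ.Nonempty ∧ τ ⊂ A}
  isRelLowerSet_faces := by
    rintro τ ⟨h1, h2⟩
    exact ⟨h1, fun ρ hρ hne => ⟨hne, lt_of_le_of_lt hρ h2⟩⟩

/-- `Y` is obtained from `X` by starring a simplex `σ` of `X` at a new vertex `a`: the open star of
`σ` is replaced by `a * ∂σ * link σ`. -/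
def IsStarring (X Y : PreAbstractSimplicialComplex ℕ) : Prop :=
  ∃ σ ∈ X.faces, ∃ a : ℕ, {a} ∉ X.faces ∧ ∀ τ : Finset ℕ,
    τ ∈ Y.faces ↔ (τ ∈ X.faces ∧ ¬ σ ⊆ τ) ∨
      ∃ ρ : Finset ℕ, ρ ∪ σ ∈ X.faces ∧ ¬ σ ⊆ ρ ∧ τ = insert a ρ

/-- `X` triangulates the PL sphere of dimension `d`: it is stellar equivalent to the boundary of a
`(d+1)`-simplex. The sphere of dimension `-1` is the empty complex. -/
def IsPLSphere (d : ℤ) (X : PreAbstractSimplicialComplex ℕ) : Prop :=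
  ∃ A : Finset ℕ, A.Nonempty ∧ (A.card : ℤ) = d + 2 ∧
    Relation.EqvGen IsStarring (simplexBoundary A) X

/-- A finite simplicial complex. -/
structure FinComplex extends PreAbstractSimplicialComplex ℕ where
  finite_faces : faces.Finite

/-- The simplices of dimension `d`: vertices, edges, 2-faces, tetrahedra and pentachora for
`d = 0, …, 4`. -/
def FinComplex.simplices (X : FinComplex) (d : ℕ) : Finset (Finset ℕ) :=
  X.finite_faces.toFinset.filter fun s => s.card = d + 1

/-- The sign `(-1) ^ p`, where `p` is the position of the vertex `v` in `s` (counted from zero).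
For `v ∈ s` it is the incidence number of `s` and its face `s.erase v`. -/
def sgn (s : Finset ℕ) (v : ℕ) : ℤ := (-1) ^ (s.filter (· < v)).card

/-- A triangulation, with ordered vertices, of a closed oriented PL 4-manifold: the link of every
simplex `σ` is a PL sphere of dimension `3 - dim σ`, and the pentachora carry orientations `±1`
(relative to the order of their vertices) that induce opposite orientations on every common
tetrahedron. -/
structure Triangulation extends FinComplex where
  link_sphere : ∀ σ ∈ faces, IsPLSphere (4 - (σ.card : ℤ)) (link toPreAbstractSimplicialComplex σ)
  orient : Finset ℕ → ℤ
  orient_eq : ∀ u ∈ toFinComplex.simplices 4, orient u = 1 ∨ orient u = -1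
  coherent : ∀ u ∈ toFinComplex.simplices 4, ∀ u' ∈ toFinComplex.simplices 4, u ≠ u' →
    ∀ v ∈ u, ∀ v' ∈ u', u.erase v = u'.erase v' →
      orient u * sgn u v = -(orient u' * sgn u' v')

/-! ## Cocycles -/

/-- The space `Z²(X, ℂ)` of simplicial 2-cocycles. A cochain is extended by zero to sets that are
not 2-faces of `X`. -/
def cocycles (X : FinComplex) : Submodule ℂ (Finset ℕ → ℂ) where
  carrier := {c | (∀ s ∉ X.simplices 2, c s = 0) ∧
    ∀ t ∈ X.simplices 3, ∑ v ∈ t, (sgn t v : ℂ) * c (t.erase v) = 0}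
  add_mem' := by
    rintro a b ⟨ha, ha'⟩ ⟨hb, hb'⟩
    refine ⟨fun s hs => by simp [ha s hs, hb s hs], fun t ht => ?_⟩
    simp only [Pi.add_apply, mul_add, Finset.sum_add_distrib, ha' t ht, hb' t ht, add_zero]
  zero_mem' := by
    refine ⟨fun s _ => rfl, fun t _ => by simp⟩
  smul_mem' := by
    rintro r a ⟨ha, ha'⟩
    refine ⟨fun s hs => by simp [ha s hs], fun t ht => ?_⟩
    have h : ∑ v ∈ t, (sgn t v : ℂ) * (r • a) (t.erase v)
        = r * ∑ v ∈ t, (sgn t v : ℂ) * a (t.erase v) := by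
      rw [Finset.mul_sum]
      refine Finset.sum_congr rfl fun v _ => ?_
      simp only [Pi.smul_apply, smul_eq_mul]
      ring
    rw [h, ha' t ht, mul_zero]

theorem sgn_mul_sgn_erase {t : Finset ℕ} {v w : ℕ} (hv : v ∈ t) (h : v < w) :
    sgn t v * sgn (t.erase v) w = -(sgn t w * sgn (t.erase w) v) := by
  have h1 : (t.erase w).filter (· < v) = t.filter (· < v) := by
    ext x; simp only [mem_filter, mem_erase]; constructor
    · rintro ⟨⟨_, a⟩, b⟩; exact ⟨a, b⟩
    · rintro ⟨a, b⟩; exact ⟨⟨by omega, a⟩, b⟩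
  have h2 : t.filter (· < w) = insert v ((t.erase v).filter (· < w)) := by
    ext x; simp only [mem_filter, mem_erase, mem_insert]; constructor
    · rintro ⟨a, b⟩
      by_cases hx : x = v
      · exact Or.inl hx
      · exact Or.inr ⟨⟨hx, a⟩, b⟩
    · rintro (rfl | ⟨⟨_, a⟩, b⟩)
      · exact ⟨hv, h⟩
      · exact ⟨a, b⟩
  have h3 : v ∉ (t.erase v).filter (· < w) := by simp
  unfold sgn
  rw [h1, h2, Finset.card_insert_of_notMem h3, pow_succ]
  ring

theorem coboundary_aux (t : Finset ℕ) (x : Finset ℕ → ℂ) :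
    ∑ v ∈ t, (sgn t v : ℂ) * ∑ w ∈ t.erase v, (sgn (t.erase v) w : ℂ) * x ((t.erase v).erase w)
      = 0 := by
  set f : ℕ → ℕ → ℂ := fun v w =>
    if v = w then 0 else (sgn t v : ℂ) * ((sgn (t.erase v) w : ℂ) * x ((t.erase v).erase w))
    with hf
  have e1 : ∑ v ∈ t, (sgn t v : ℂ) *
      ∑ w ∈ t.erase v, (sgn (t.erase v) w : ℂ) * x ((t.erase v).erase w)
      = ∑ v ∈ t, ∑ w ∈ t, f v w := by
    refine Finset.sum_congr rfl fun v hv => ?_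
    rw [← Finset.add_sum_erase t _ hv, Finset.mul_sum]
    simp only [hf, if_true, zero_add]
    refine Finset.sum_congr rfl fun w hw => ?_
    rw [if_neg (Finset.ne_of_mem_erase hw).symm]
  have anti : ∀ v ∈ t, ∀ w ∈ t, f v w = -f w v := by
    intro v hv w hw
    simp only [hf]
    rcases lt_trichotomy v w with h | h | h
    · have := congrArg (Int.cast : ℤ → ℂ) (sgn_mul_sgn_erase hv h)
      push_cast at this
      rw [if_neg h.ne, if_neg h.ne', ← mul_assoc, this, Finset.erase_right_comm]
      ring
    · simp [h]
    · have := congrArg (Int.cast : ℤ → ℂ) (sgn_mul_sgn_erase hw h)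
      push_cast at this
      rw [if_neg h.ne, if_neg h.ne', ← mul_assoc ((sgn t w : ℤ) : ℂ), this,
        Finset.erase_right_comm]
      ring
  have e2 : ∑ v ∈ t, ∑ w ∈ t, f v w = -∑ v ∈ t, ∑ w ∈ t, f v w := by
    conv_lhs => rw [Finset.sum_comm]
    rw [← Finset.sum_neg_distrib]
    refine Finset.sum_congr rfl fun w hw => ?_
    rw [← Finset.sum_neg_distrib]
    exact Finset.sum_congr rfl fun v hv => anti v hv w hw
  rw [e1]
  exact self_eq_neg.mp e2

/-- The coboundary of the 1-cochain `x`. -/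
def coboundary (X : FinComplex) (x : Finset ℕ → ℂ) : cocycles X :=
  ⟨fun s => if s ∈ X.simplices 2 then ∑ v ∈ s, (sgn s v : ℂ) * x (s.erase v) else 0, by
    refine ⟨fun s hs => by simp [hs], fun t ht => ?_⟩
    refine Eq.trans ?_ (coboundary_aux t x)
    refine Finset.sum_congr rfl fun v hv => ?_
    have : t.erase v ∈ X.simplices 2 := by
      simp only [FinComplex.simplices, mem_filter, Set.Finite.mem_toFinset] at ht ⊢
      have hc : (t.erase v).card = 2 + 1 := by rw [Finset.card_erase_of_mem hv, ht.2]
      exact ⟨(X.isRelLowerSet_faces ht.1).2 (Finset.erase_subset v t)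
        (Finset.card_pos.mp (by omega)), hc⟩
    simp only [if_pos this]⟩

/-- `δb` for the edge `b` (oriented by the order of its vertices): the coboundary of the 1-cochain
that is `1` on `b` and `0` on all other edges. -/
def edgeCocycle (X : FinComplex) (b : Finset ℕ) : cocycles X := coboundary X (Pi.single b 1)

/-! ## Square roots, edge operators, pentachoron matrices -/

/-- `K` is a permitted choice of the square roots `K_t` of the products `∏_{s ⊂ t} ω_s`, and `q` is
a choice of the square roots `q_s = √ω_s` of the values on the 2-faces that agrees with it:
`K_{ijkl} = q_{ijk} q_{ijl} q_{ikl} q_{jkl}` for every tetrahedron `ijkl` with `i < j < k < l`. -/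
structure IsRootChoice (X : FinComplex) (ω : cocycles X) (K q : Finset ℕ → ℂ) : Prop where
  sq : ∀ s ∈ X.simplices 2, q s ^ 2 = ω.1 s
  agree : ∀ t ∈ X.simplices 3, K t = ∏ v ∈ t, q (t.erase v)

/-- The operators `β_t(c) ∂_t + γ_t(c) ϑ_t` are the components, in the tetrahedra `t`, of the
operators `d_c` that belong to the 2-cocycles `c` (edge operators are the case `c = δb`); `γ_t` is
written here for the orientation of `t` given by the order of its vertices, and changes its sign
together with that orientation. They are fixed, up to a rescaling of `ϑ_t`, by their normalized
scalar products `⟨d_c, d_c'⟩_t = [d_c, d_c']₊` (in particular `⟨d_{ik}, d_{jk}⟩_t = 1 / ω_{ijk}`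
for `t = ijkl`, and `d_ω = 0`), and by the choice of the square root `K_t` of the discriminant,
which distinguishes the two isotropic directions `∂_t` and `ϑ_t`. -/
structure IsEdgeOperators (X : FinComplex) (ω : cocycles X) (K : Finset ℕ → ℂ)
    (β γ : Finset ℕ → cocycles X →ₗ[ℂ] ℂ) : Prop where
  scalar_product : ∀ t ∈ X.simplices 3, ∀ c c' : cocycles X,
    β t c * γ t c' + β t c' * γ t c =
      ∑ v ∈ t, (sgn t v : ℂ) * (c.1 (t.erase v) * c'.1 (t.erase v) / ω.1 (t.erase v))
  branch : ∀ i j k l : ℕ, i < j → j < k → k < l → {i, j, k, l} ∈ X.simplices 3 →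
    ∀ c c' : cocycles X,
    β {i, j, k, l} c * γ {i, j, k, l} c' - β {i, j, k, l} c' * γ {i, j, k, l} c =
      Matrix.det !![c.1 {j, k, l}, c.1 {i, k, l}, c.1 {i, j, l};
                    c'.1 {j, k, l}, c'.1 {i, k, l}, c'.1 {i, j, l};
                    ω.1 {j, k, l}, ω.1 {i, k, l}, ω.1 {i, j, l}]
        / K {i, j, k, l}

/-- `F` is the skew-symmetric matrix of the pentachoron `u` with orientation `ε`, rows and columns
being numbered by the tetrahedra of `u`: the operators
`d_c = ∑_{t ⊂ u} (β_t(c) ∂_t + γ_t^{(u)}(c) ϑ_t)`, with `γ_t^{(u)}` taken for the orientation of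
`t` induced from `u`, annihilate `exp (-½ ∑ ϑ_t F_{tt'} ϑ_{t'})`. -/
structure IsPentachoronMatrix (X : FinComplex) (β γ : Finset ℕ → cocycles X →ₗ[ℂ] ℂ)
    (ε : ℤ) (u : Finset ℕ) (F : Finset ℕ → Finset ℕ → ℂ) : Prop where
  skew : ∀ v ∈ u, ∀ w ∈ u, F (u.erase v) (u.erase w) = -F (u.erase w) (u.erase v)
  annihilates : ∀ c : cocycles X, ∀ w ∈ u,
    ∑ v ∈ u, β (u.erase v) c * F (u.erase v) (u.erase w)
      = (ε : ℂ) * (sgn u w : ℂ) * γ (u.erase w) c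

/-- The orientation of a pentachoron given by the order `v 0, …, v 4` of its vertices, relative to
the increasing order. -/
def tupleSign (v : Fin 5 → ℕ) : ℤ :=
  ∏ a : Fin 5, ∏ b ∈ Finset.Ioi a, if v a < v b then 1 else -1

/-- `H` is the quantity `H_u` of the pentachoron `u` with orientation `ε`, calculated from an edge
`b = ij`, `i < j`, and a tetrahedron `t = ijkl`, where `u = ijklm` has the given orientation:
`H_u = β_{bt} q_{ijk} q_{ijl} q_{ijm} q_{klm}
  / (F_{iklm,ijkm} F_{jklm,ijlm} - F_{iklm,ijlm} F_{jklm,ijkm})`. -/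
def IsPentachoronFactor (X : FinComplex) (q : Finset ℕ → ℂ)
    (β : Finset ℕ → cocycles X →ₗ[ℂ] ℂ) (ε : ℤ) (u : Finset ℕ)
    (F : Finset ℕ → Finset ℕ → ℂ) (H : ℂ) : Prop :=
  ∃ i j k l m : ℕ, Function.Injective ![i, j, k, l, m] ∧ u = {i, j, k, l, m} ∧
    i < j ∧ tupleSign ![i, j, k, l, m] = ε ∧
    F {i, k, l, m} {i, j, k, m} * F {j, k, l, m} {i, j, l, m}
      - F {i, k, l, m} {i, j, l, m} * F {j, k, l, m} {i, j, k, m} ≠ 0 ∧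
    H = β {i, j, k, l} (edgeCocycle X {i, j}) *
        (q {i, j, k} * q {i, j, l} * q {i, j, m} * q {k, l, m}) /
        (F {i, k, l, m} {i, j, k, m} * F {j, k, l, m} {i, j, l, m}
          - F {i, k, l, m} {i, j, l, m} * F {j, k, l, m} {i, j, k, m})

/-- All the quantities attached to the tetrahedra and pentachora of `X`, for given `ω`, roots `K`, `q`
and orientations `o` of the pentachora: edge operators, matrices `F u` and factors `η_u = √H_u`. -/
structure IsLocalData (X : FinComplex) (ω : cocycles X) (K q : Finset ℕ → ℂ) (o : Finset ℕ → ℤ)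
    (β γ : Finset ℕ → cocycles X →ₗ[ℂ] ℂ) (F : Finset ℕ → Finset ℕ → Finset ℕ → ℂ)
    (η : Finset ℕ → ℂ) : Prop where
  edge_operators : IsEdgeOperators X ω K β γ
  matrix : ∀ u ∈ X.simplices 4, IsPentachoronMatrix X β γ (o u) u (F u)
  factor : ∀ u ∈ X.simplices 4, IsPentachoronFactor X q β (o u) u (F u) (η u ^ 2)

/-! ## Grassmann algebra and the conjectured relation -/

/-- The Grassmann algebra over `ℂ` with a generator for each tetrahedron. -/
abbrev Grassmann : Type := ExteriorAlgebra ℂ (Finset ℕ →₀ ℂ)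

/-- The generator `ϑ_t`. -/
def theta (t : Finset ℕ) : Grassmann := ExteriorAlgebra.ι ℂ (Finsupp.single t 1)

/-- The Berezin integral `∫ f dϑ_t`, that is, the right derivative: it sends `f₀ + f₁ ϑ_t` to `f₁`
if `f₀` and `f₁` do not contain `ϑ_t`. -/
def berezin (t : Finset ℕ) (f : Grassmann) : Grassmann :=
  CliffordAlgebra.contractRight f (Finsupp.lapply t)

/-- The Grassmann–Gaussian weight `exp (-½ ∑ ϑ_t F_{tt'} ϑ_{t'})` of the pentachoron `u`, the sum
being over tetrahedra `t, t' ⊂ u`. -/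
def weight (u : Finset ℕ) (F : Finset ℕ → Finset ℕ → ℂ) : Grassmann :=
  IsNilpotent.exp ((-(1 / 2) : ℂ) • ∑ v ∈ u, ∑ w ∈ u,
    F (u.erase v) (u.erase w) • (theta (u.erase v) * theta (u.erase w)))

/-- The 5-simplex with vertices `1, …, 6`. -/
def fiveSimplex : FinComplex where
  faces := {s | s.Nonempty ∧ s ⊆ ({1, 2, 3, 4, 5, 6} : Finset ℕ)}
  isRelLowerSet_faces := by
    rintro s ⟨h1, h2⟩
    exact ⟨h1, fun r hr hne => ⟨hne, hr.trans h2⟩⟩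
  finite_faces := by
    refine Set.Finite.subset (Finset.finite_toSet (({1, 2, 3, 4, 5, 6} : Finset ℕ).powerset)) ?_
    rintro s ⟨_, h2⟩
    exact Finset.mem_coe.mpr (Finset.mem_powerset.mpr h2)

/-- Orientations of the six pentachora in the two sides of the move 3–3:
`12345`, `~12346`, `12356` and `12456`, `~13456`, `23456`, the tilde marking the reversed
orientation. -/
def orient33 (u : Finset ℕ) : ℤ :=
  if u = {1, 2, 3, 4, 6} ∨ u = {1, 3, 4, 5, 6} then -1 else 1

/-- The Conjecture: the Grassmann-algebraic relation for the move 3–3 (up to a sign) holds with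
`η_u = √H_u`, for all nowhere vanishing cocycles and all square roots for which the quantities in
it are defined. -/
def Conjecture33 : Prop :=
  ∀ (ω : cocycles fiveSimplex) (K q : Finset ℕ → ℂ)
    (β γ : Finset ℕ → cocycles fiveSimplex →ₗ[ℂ] ℂ)
    (F : Finset ℕ → Finset ℕ → Finset ℕ → ℂ) (η : Finset ℕ → ℂ),
    (∀ s ∈ fiveSimplex.simplices 2, ω.1 s ≠ 0) →
    IsRootChoice fiveSimplex ω K q →
    IsLocalData fiveSimplex ω K q orient33 β γ F η →
    let W : Finset ℕ → Grassmann := fun u => weight u (F u)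
    let lhs : Grassmann :=
      (η {1, 2, 3, 4, 5} * η {1, 2, 3, 4, 6} * η {1, 2, 3, 5, 6} / q {1, 2, 3}) •
        berezin {1, 2, 3, 6} (berezin {1, 2, 3, 5} (berezin {1, 2, 3, 4}
          (W {1, 2, 3, 4, 5} * W {1, 2, 3, 4, 6} * W {1, 2, 3, 5, 6})))
    let rhs : Grassmann :=
      (η {1, 2, 4, 5, 6} * η {1, 3, 4, 5, 6} * η {2, 3, 4, 5, 6} / q {4, 5, 6}) •
        berezin {3, 4, 5, 6} (berezin {2, 4, 5, 6} (berezin {1, 4, 5, 6}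
          (W {1, 2, 4, 5, 6} * W {1, 3, 4, 5, 6} * W {2, 3, 4, 5, 6})))
    lhs = rhs ∨ lhs = -rhs

/-! ## The exotic chain complex, its torsion, and the quantity `I`

`0 → ℂ → Z²(M, ℂ) → ℂ^{N₃} → ℂ^{N₃} → Z²(M, ℂ)* → ℂ → 0`, with maps `f₁, …, f₅`, written as
matrices with respect to a basis `b` of `Z²(M, ℂ)`. -/

section Complex

variable {X : FinComplex} {ι : Type} (b : Module.Basis ι ℂ (cocycles X))

/-- `f₁` sends `1` to the cocycle `ω`. -/
def f₁ (ω : cocycles X) : Matrix ι Unit ℂ := Matrix.of fun i _ => b.repr ω i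

/-- `f₂` sends a cocycle `c` to the coefficients of the `∂_t` in the global operator `D_c`. -/
def f₂ (β : Finset ℕ → cocycles X →ₗ[ℂ] ℂ) : Matrix (X.simplices 3) ι ℂ :=
  Matrix.of fun t i => β t (b i)

/-- `f₃` is the matrix of the quadratic form in the product `exp (Θᵀ f₃ Θ)` of the weights of all
pentachora. -/
def f₃ (F : Finset ℕ → Finset ℕ → Finset ℕ → ℂ) : Matrix (X.simplices 3) (X.simplices 3) ℂ :=
  Matrix.of fun t t' =>
    -(1 / 2) * ∑ u ∈ (X.simplices 4).filter (fun u => t.1 ⊆ u ∧ t'.1 ⊆ u), F u t t'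

/-- By the symmetry of the complex, `f₄` is dual to `f₂`. -/
def f₄ (β : Finset ℕ → cocycles X →ₗ[ℂ] ℂ) : Matrix ι (X.simplices 3) ℂ := (f₂ b β).transpose

/-- By the symmetry of the complex, `f₅` is dual to `f₁`. -/
def f₅ (ω : cocycles X) : Matrix Unit ι ℂ := (f₁ b ω).transpose

variable [Fintype ι] [DecidableEq ι]

/-- The complex is acyclic, i.e. exact in all its terms. -/
structure IsAcyclic (ω : cocycles X) (β : Finset ℕ → cocycles X →ₗ[ℂ] ℂ)
    (F : Finset ℕ → Finset ℕ → Finset ℕ → ℂ) : Prop where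
  injective : Function.Injective (f₁ b ω).mulVecLin
  exact₂ : Function.Exact (f₁ b ω).mulVecLin (f₂ b β).mulVecLin
  exact₃ : Function.Exact (f₂ b β).mulVecLin (f₃ (X := X) F).mulVecLin
  exact₄ : Function.Exact (f₃ (X := X) F).mulVecLin (f₄ b β).mulVecLin
  exact₅ : Function.Exact (f₄ b β).mulVecLin (f₅ b ω).mulVecLin
  surjective : Function.Surjective (f₅ b ω).mulVecLin

/-- `τ = minor f₁ · minor f₃ · minor f₅ / (minor f₂ · minor f₄)` is the torsion of the complex,
calculated with nonzero minors chosen symmetrically: `r` is the row used in `minor f₁` and the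
column used in `minor f₅`; the rows of `minor f₂` and the columns of `minor f₄` are the tetrahedra
`e i` for `i ≠ r`; and `minor f₃` has the remaining tetrahedra as its rows and columns (so that it
is the determinant of a skew-symmetric matrix, and thus the square of a Pfaffian). -/
def IsTorsion (ω : cocycles X) (β : Finset ℕ → cocycles X →ₗ[ℂ] ℂ)
    (F : Finset ℕ → Finset ℕ → Finset ℕ → ℂ) (τ : ℂ) : Prop :=
  ∃ (r : ι) (e : {i : ι // i ≠ r} ↪ X.simplices 3),
    let minor₁ : ℂ := f₁ b ω r ()
    let minor₂ : ℂ := ((f₂ b β).submatrix e Subtype.val).det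
    let minor₃ : ℂ := by
      classical
      exact ((f₃ (X := X) F).submatrix
        (Subtype.val : {t : X.simplices 3 // t ∉ Set.range e} → X.simplices 3)
        (Subtype.val : {t : X.simplices 3 // t ∉ Set.range e} → X.simplices 3)).det
    let minor₄ : ℂ := ((f₄ b β).submatrix Subtype.val e).det
    let minor₅ : ℂ := f₅ b ω () r
    minor₁ ≠ 0 ∧ minor₂ ≠ 0 ∧ minor₃ ≠ 0 ∧ minor₄ ≠ 0 ∧ minor₅ ≠ 0 ∧
      τ = minor₁ * minor₃ * minor₅ / (minor₂ * minor₄)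

end Complex

/-- `I` is a value of `∏_s q_s⁻¹ · ∏_u η_u · √τ` (product over all 2-faces `s` and all pentachora
`u`), calculated for the triangulated manifold `M`, the cocycle `ω` and the permitted choice `K` of
square roots, when the complex is acyclic. Here `q` are any roots `q_s` that agree with `K`, and
the square roots `η_u = √H_u` and `√τ` are arbitrary, so `I` can only be determined up to its
sign. -/
def IsValueOfI (M : Triangulation) {ι : Type} [Fintype ι] [DecidableEq ι]
    (b : Module.Basis ι ℂ (cocycles M.toFinComplex)) (ω : cocycles M.toFinComplex)
    (K : Finset ℕ → ℂ) (I : ℂ) : Prop :=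
  ∃ (q : Finset ℕ → ℂ) (β γ : Finset ℕ → cocycles M.toFinComplex →ₗ[ℂ] ℂ)
    (F : Finset ℕ → Finset ℕ → Finset ℕ → ℂ) (η : Finset ℕ → ℂ) (rootτ : ℂ),
    IsRootChoice M.toFinComplex ω K q ∧
    IsLocalData M.toFinComplex ω K q M.orient β γ F η ∧
    IsAcyclic b ω β F ∧
    IsTorsion b ω β F (rootτ ^ 2) ∧
    I = (∏ s ∈ M.simplices 2, (q s)⁻¹) * (∏ u ∈ M.simplices 4, η u) * rootτ

end PLFermion

end

/-! Only the square of `I` matters, and `q_s ^ 2 = ω_s` is independent of the choices, so the claim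
is that the product of all `H_u`, multiplied by `τ`, is unchanged when the signs of the roots
change.

In one tetrahedron the scalar product and the antisymmetric form determine the product of `β_t(c)`
and `γ_t(c')`. Passing from `K_t` to `K'_t = ±K_t` therefore acts on the pair `(β_t, γ_t)` by an
orthogonal transformation of a hyperbolic plane: a rescaling for the sign plus, a rescaled exchange
of `β_t` and `γ_t` for the sign minus. Its determinant is `K'_t / K_t`
(`IsEdgeOperators.exists_gauge`). In a pentachoron `u` the matrix `F` expresses all `γ` through the
`β`, so the new five components `β'` are a linear image of the old ones under a 5×5 matrix `G_u`
(`gaugeMatrix`).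

Local side. Up to the orientation sign, `H_u` is the product of all ten roots `q_s`, `s ⊂ u`, and of
a determinant of `β`-values on five edges divided by one value of `ω`
(`IsPentachoronFactor.eq_edgeDet`). This quotient does not depend on the order of the vertices
(`edgeDet_div_eq`), so `H_u` acquires the factor `det G_u` and the ratio of the products of roots
(`IsPentachoronFactor.gauge`). Every 2-face lies in as many pentachora as tetrahedra, hence the
ratios of roots multiply up to `S = ∏ K'_t / K_t` over all tetrahedra.

Global side. A function on flags (a tetrahedron in a pentachoron) gives `β`-components separately in
every pentachoron, and `γ`-components through the matrices `F`. Its discrepancies across the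
tetrahedra form a linear operator. A change of roots multiplies this operator by the tetrahedron
transformations on one side, of determinant `S`, and by the inverse of the direct sum of the `G_u`
on the other. In the coordinates "difference, sum" of the two flags of a tetrahedron it is block
triangular with blocks `1` and `f₃`. Bordering it by coordinate vectors gives the minors of `f₃`,
while its left and right null vectors coming from cocycles give the minors of `f₂` and `f₄`.
Comparing bordered determinants (`det_border_conj`, `minor_gauge`) yields `τ' · ∏ det G_u = S · τ`.

Together, the product of `H_u` acquires `S · ∏ det G_u`, and its product with `τ` acquires `S ^ 2 =
1` (`prod_factor_mul_torsion_eq`). -/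

namespace PLFermion

/-! ## Cochains evaluated on simplices with ordered vertices -/

/-- The sign of the pair `a`, `b`: it is `1` if `a < b` and `-1` otherwise. -/
noncomputable def pairSign (a b : ℕ) : ℂ := if a < b then 1 else -1

theorem pairSign_of_lt {a b : ℕ} (h : a < b) : pairSign a b = 1 := if_pos h

theorem pairSign_of_gt {a b : ℕ} (h : b < a) : pairSign a b = -1 := if_neg h.not_gt

theorem pairSign_swap {a b : ℕ} (h : a ≠ b) : pairSign b a = -pairSign a b := by
  rcases h.lt_or_gt with h | h
  · rw [pairSign_of_lt h, pairSign_of_gt h]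
  · rw [pairSign_of_lt h, pairSign_of_gt h, neg_neg]

theorem pairSign_sq (a b : ℕ) : pairSign a b ^ 2 = 1 := by
  unfold pairSign; split_ifs <;> norm_num

theorem pairSign_ne_zero (a b : ℕ) : pairSign a b ≠ 0 := by
  unfold pairSign; split_ifs <;> norm_num

/-- The value of the 2-cochain `c` on the 2-face `abd`, oriented by this order of its vertices. -/
noncomputable def orientedValue (c : Finset ℕ → ℂ) (a b d : ℕ) : ℂ :=
  pairSign a b * pairSign a d * pairSign b d * c {a, b, d}

/-- The coboundary of the edge `ab`, oriented from `a` to `b`. -/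
noncomputable def orientedEdge (X : FinComplex) (a b : ℕ) : cocycles X := pairSign a b • edgeCocycle X {a, b}

theorem orientedValue_swap₁₂ (c : Finset ℕ → ℂ) {a b : ℕ} (d : ℕ) (h : a ≠ b) :
    orientedValue c b a d = -orientedValue c a b d := by
  unfold orientedValue
  rw [pairSign_swap h, Finset.insert_comm b a]
  ring

theorem orientedValue_swap₂₃ (c : Finset ℕ → ℂ) (a : ℕ) {b d : ℕ} (h : b ≠ d) :
    orientedValue c a d b = -orientedValue c a b d := by
  unfold orientedValue
  rw [pairSign_swap h, Finset.pair_comm d b]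
  ring

theorem orientedEdge_swap (X : FinComplex) {a b : ℕ} (h : a ≠ b) :
    orientedEdge X b a = -orientedEdge X a b := by
  unfold orientedEdge
  rw [pairSign_swap h, Finset.pair_comm b a]
  exact neg_smul (pairSign a b) (edgeCocycle X {a, b})

/-- A property of triples of distinct numbers that is stable under adjacent transpositions holds if
it holds for increasing triples. -/
theorem forall_triple_of_increasing {P : ℕ → ℕ → ℕ → Prop}
    (h0 : ∀ a b c, a < b → b < c → P a b c)
    (h1 : ∀ a b c, a ≠ b → P a b c → P b a c)
    (h2 : ∀ a b c, b ≠ c → P a b c → P a c b) :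
    ∀ a b c, a ≠ b → a ≠ c → b ≠ c → P a b c := by
  have B : ∀ a b c, a < b → a ≠ c → b ≠ c → P a b c := by
    intro a b c hab hac hbc
    rcases hbc.lt_or_gt with h | h
    · exact h0 _ _ _ hab h
    rcases hac.lt_or_gt with h' | h'
    · exact h2 _ _ _ h.ne (h0 _ _ _ h' h)
    · exact h2 _ _ _ h.ne (h1 _ _ _ h'.ne (h0 _ _ _ h' hab))
  intro a b c hab hac hbc
  rcases hab.lt_or_gt with h | h
  · exact B _ _ _ h hac hbc
  · exact h1 _ _ _ h.ne (B _ _ _ h hbc hac)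

/-- A property of quadruples of distinct numbers that is stable under adjacent transpositions holds
if it holds for increasing quadruples. -/
theorem forall_quadruple_of_increasing {P : ℕ → ℕ → ℕ → ℕ → Prop}
    (h0 : ∀ a b c d, a < b → b < c → c < d → P a b c d)
    (h1 : ∀ a b c d, a ≠ b → P a b c d → P b a c d)
    (h2 : ∀ a b c d, b ≠ c → P a b c d → P a c b d)
    (h3 : ∀ a b c d, c ≠ d → P a b c d → P a b d c) :
    ∀ a b c d, a ≠ b → a ≠ c → a ≠ d → b ≠ c → b ≠ d → c ≠ d → P a b c d := by
  -- Insertion sort: the last entry is moved to the left into the increasing triple; the triples are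
  -- sorted afterwards.
  have A : ∀ a b c d, a < b → b < c → a ≠ d → b ≠ d → c ≠ d → P a b c d := by
    intro a b c d hab hbc had hbd hcd
    rcases hcd.lt_or_gt with h | h
    · exact h0 _ _ _ _ hab hbc h
    rcases hbd.lt_or_gt with h' | h'
    · exact h3 _ _ _ _ h.ne (h0 _ _ _ _ hab h' h)
    rcases had.lt_or_gt with h'' | h''
    · exact h3 _ _ _ _ h.ne (h2 _ _ _ _ h'.ne (h0 _ _ _ _ h'' h' hbc))
    · exact h3 _ _ _ _ h.ne (h2 _ _ _ _ h'.ne (h1 _ _ _ _ h''.ne (h0 _ _ _ _ h'' hab hbc)))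
  intro a b c d hab hac had hbc hbd hcd
  refine forall_triple_of_increasing (P := fun a b c => a ≠ d → b ≠ d → c ≠ d → P a b c d)
    (fun a b c h h' => A a b c d h h') ?_ ?_ a b c hab hac hbc had hbd hcd
  · exact fun a b c h H x y z => h1 _ _ _ _ h (H y x z)
  · exact fun a b c h H x y z => h2 _ _ _ _ h (H x z y)

/-- A property of quintuples of distinct numbers that is stable under adjacent transpositions holds
if it holds for increasing quintuples. -/
theorem forall_quintuple_of_increasing {P : ℕ → ℕ → ℕ → ℕ → ℕ → Prop}
    (h0 : ∀ a b c d e, a < b → b < c → c < d → d < e → P a b c d e)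
    (h1 : ∀ a b c d e, [a, b, c, d, e].Nodup → P a b c d e → P b a c d e)
    (h2 : ∀ a b c d e, [a, b, c, d, e].Nodup → P a b c d e → P a c b d e)
    (h3 : ∀ a b c d e, [a, b, c, d, e].Nodup → P a b c d e → P a b d c e)
    (h4 : ∀ a b c d e, [a, b, c, d, e].Nodup → P a b c d e → P a b c e d) :
    ∀ a b c d e, [a, b, c, d, e].Nodup → P a b c d e := by
  have A : ∀ a b c d e, a < b → b < c → c < d → a ≠ e → b ≠ e → c ≠ e → d ≠ e → P a b c d e := by
    intro a b c d e hab hbc hcd hae hbe hce hde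
    have key : ∀ x y z w v : ℕ, x < y → y < z → z < w → w < v → [x, y, z, w, v].Nodup := by
      intro x y z w v h h' h'' h'''
      simp only [List.nodup_cons, List.mem_cons, List.not_mem_nil, or_false, not_or,
        not_false_eq_true, List.nodup_nil, and_true]
      omega
    have nd : ∀ x y z w v : ℕ, x ≠ y → x ≠ z → x ≠ w → x ≠ v → y ≠ z → y ≠ w → y ≠ v → z ≠ w →
        z ≠ v → w ≠ v → [x, y, z, w, v].Nodup := by
      intros
      simp only [List.nodup_cons, List.mem_cons, List.not_mem_nil, or_false, not_or,
        not_false_eq_true, List.nodup_nil, and_true]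
      omega
    rcases hde.lt_or_gt with h | h
    · exact h0 _ _ _ _ _ hab hbc hcd h
    refine h4 _ _ _ _ _ (by apply nd <;> omega) ?_
    rcases hce.lt_or_gt with h' | h'
    · exact h0 _ _ _ _ _ hab hbc h' h
    refine h3 _ _ _ _ _ (by apply nd <;> omega) ?_
    rcases hbe.lt_or_gt with h'' | h''
    · exact h0 _ _ _ _ _ hab h'' h' hcd
    refine h2 _ _ _ _ _ (by apply nd <;> omega) ?_
    rcases hae.lt_or_gt with h''' | h'''
    · exact h0 _ _ _ _ _ h''' h'' hbc hcd
    · exact h1 _ _ _ _ _ (by apply nd <;> omega) (h0 _ _ _ _ _ h''' hab hbc hcd)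
  intro a b c d e hnd
  have nd : ∀ x y z w : ℕ, [x, y, z, w, e].Nodup ↔ (x ≠ y ∧ x ≠ z ∧ x ≠ w ∧ y ≠ z ∧ y ≠ w ∧ z ≠ w) ∧
      x ≠ e ∧ y ≠ e ∧ z ≠ e ∧ w ≠ e := by
    intros
    simp only [List.nodup_cons, List.mem_cons, List.not_mem_nil, or_false, not_or,
      not_false_eq_true, List.nodup_nil, and_true]
    tauto
  have h := (nd _ _ _ _).1 hnd
  refine forall_quadruple_of_increasing (P := fun a b c d => [a, b, c, d, e].Nodup → P a b c d e)
    ?_ ?_ ?_ ?_ a b c d h.1.1 h.1.2.1 h.1.2.2.1 h.1.2.2.2.1 h.1.2.2.2.2.1 h.1.2.2.2.2.2 hnd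
  · intro a b c d h1 h2 h3 h
    have := (nd _ _ _ _).1 h
    exact A _ _ _ _ _ h1 h2 h3 this.2.1 this.2.2.1 this.2.2.2.1 this.2.2.2.2
  · intro a b c d _ H h
    have h' : [a, b, c, d, e].Nodup := by rw [nd] at h ⊢; tauto
    exact h1 _ _ _ _ _ h' (H h')
  · intro a b c d _ H h
    have h' : [a, b, c, d, e].Nodup := by rw [nd] at h ⊢; tauto
    exact h2 _ _ _ _ _ h' (H h')
  · intro a b c d _ H h
    have h' : [a, b, c, d, e].Nodup := by rw [nd] at h ⊢; tauto
    exact h3 _ _ _ _ _ h' (H h')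

/-! ## Faces of triangles, tetrahedra and pentachora -/

/-- Each vertex of `s` below `v` contributes `-1` and each one above contributes `1`. In this form
incidence numbers can be computed for vertices listed in any order. -/
theorem sgn_eq_prod_pairSign (s : Finset ℕ) (v : ℕ) :
    (sgn s v : ℂ) = ∏ w ∈ s.erase v, pairSign v w := by
  have h : (s.filter (· < v)) = (s.erase v).filter (· < v) := by
    ext x; simp only [mem_filter, mem_erase]
    exact ⟨fun h => ⟨⟨h.2.ne, h.1⟩, h.2⟩, fun h => ⟨h.1.2, h.2⟩⟩
  unfold sgn
  rw [h]
  push_cast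
  rw [← Finset.prod_const, Finset.prod_filter]
  refine Finset.prod_congr rfl fun w hw => ?_
  rcases (Finset.ne_of_mem_erase hw).lt_or_gt with h | h
  · rw [if_pos h, pairSign_of_gt h]
  · rw [if_neg h.not_gt, pairSign_of_lt h]

theorem sgn_sq (s : Finset ℕ) (v : ℕ) : (sgn s v : ℂ) * (sgn s v : ℂ) = 1 := by
  have : sgn s v * sgn s v = 1 := by
    unfold sgn
    rw [← mul_pow]; norm_num
  exact_mod_cast this

theorem erase_triple {a b d : ℕ} (hab : a ≠ b) (had : a ≠ d) (hbd : b ≠ d) :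
    ({a, b, d} : Finset ℕ).erase a = {b, d} ∧ ({a, b, d} : Finset ℕ).erase b = {a, d} ∧
      ({a, b, d} : Finset ℕ).erase d = {a, b} := by
  refine ⟨?_, ?_, ?_⟩ <;> ext x <;> simp only [mem_erase, mem_insert, mem_singleton] <;> omega

theorem erase_quadruple {a b d e : ℕ} (hab : a ≠ b) (had : a ≠ d) (hae : a ≠ e) (hbd : b ≠ d)
    (hbe : b ≠ e) (hde : d ≠ e) :
    ({a, b, d, e} : Finset ℕ).erase a = {b, d, e} ∧ ({a, b, d, e} : Finset ℕ).erase b = {a, d, e} ∧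
      ({a, b, d, e} : Finset ℕ).erase d = {a, b, e} ∧
      ({a, b, d, e} : Finset ℕ).erase e = {a, b, d} := by
  refine ⟨?_, ?_, ?_, ?_⟩ <;> ext x <;> simp only [mem_erase, mem_insert, mem_singleton] <;> omega

theorem nodup_five_iff {a b c d e : ℕ} : [a, b, c, d, e].Nodup ↔
    (a ≠ b ∧ a ≠ c ∧ a ≠ d ∧ a ≠ e) ∧ (b ≠ c ∧ b ≠ d ∧ b ≠ e) ∧ (c ≠ d ∧ c ≠ e) ∧ d ≠ e := by
  simp only [List.nodup_cons, List.mem_cons, List.not_mem_nil, or_false, not_or,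
    not_false_eq_true, List.nodup_nil, and_true]

theorem nodup_four_iff {a b c d : ℕ} : [a, b, c, d].Nodup ↔
    (a ≠ b ∧ a ≠ c ∧ a ≠ d) ∧ (b ≠ c ∧ b ≠ d) ∧ c ≠ d := by
  simp only [List.nodup_cons, List.mem_cons, List.not_mem_nil, or_false, not_or,
    not_false_eq_true, List.nodup_nil, and_true]

theorem erase_quintuple {i j k l m : ℕ} (h : [i, j, k, l, m].Nodup) :
    ({i, j, k, l, m} : Finset ℕ).erase i = {j, k, l, m} ∧
      ({i, j, k, l, m} : Finset ℕ).erase j = {i, k, l, m} ∧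
      ({i, j, k, l, m} : Finset ℕ).erase k = {i, j, l, m} ∧
      ({i, j, k, l, m} : Finset ℕ).erase l = {i, j, k, m} ∧
      ({i, j, k, l, m} : Finset ℕ).erase m = {i, j, k, l} := by
  rw [nodup_five_iff] at h
  refine ⟨?_, ?_, ?_, ?_, ?_⟩ <;> ext x <;> simp only [mem_erase, mem_insert, mem_singleton] <;>
    omega

theorem sum_quadruple {a b d e : ℕ} (hab : a ≠ b) (had : a ≠ d) (hae : a ≠ e) (hbd : b ≠ d)
    (hbe : b ≠ e) (hde : d ≠ e) (f : ℕ → ℂ) :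
    ∑ v ∈ {a, b, d, e}, f v = f a + f b + f d + f e := by
  rw [Finset.sum_insert (by simp; omega), Finset.sum_insert (by simp; omega),
    Finset.sum_insert (by simp; omega), Finset.sum_singleton]
  ring

theorem prod_quadruple {a b d e : ℕ} (hab : a ≠ b) (had : a ≠ d) (hae : a ≠ e) (hbd : b ≠ d)
    (hbe : b ≠ e) (hde : d ≠ e) (f : ℕ → ℂ) :
    ∏ v ∈ {a, b, d, e}, f v = f a * f b * f d * f e := by
  rw [Finset.prod_insert (by simp; omega), Finset.prod_insert (by simp; omega),
    Finset.prod_insert (by simp; omega), Finset.prod_singleton]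
  ring

theorem sgn_quadruple {a b d e : ℕ} (hab : a < b) (hbd : b < d) (hde : d < e) :
    (sgn {a, b, d, e} a : ℂ) = 1 ∧ (sgn {a, b, d, e} b : ℂ) = -1 ∧ (sgn {a, b, d, e} d : ℂ) = 1 ∧
      (sgn {a, b, d, e} e : ℂ) = -1 := by
  obtain ⟨h1, h2, h3, h4⟩ := erase_quadruple (by omega : a ≠ b) (by omega : a ≠ d)
    (by omega : a ≠ e) (by omega : b ≠ d) (by omega : b ≠ e) (by omega : d ≠ e)
  simp only [sgn_eq_prod_pairSign, h1, h2, h3, h4]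
  have n1 : a ∉ ({d, e} : Finset ℕ) := by simp; omega
  have n2 : a ∉ ({b, e} : Finset ℕ) := by simp; omega
  have n3 : a ∉ ({b, d} : Finset ℕ) := by simp; omega
  have n4 : b ∉ ({d, e} : Finset ℕ) := by simp; omega
  simp only [Finset.prod_insert n1, Finset.prod_insert n2, Finset.prod_insert n3,
    Finset.prod_insert n4, Finset.prod_pair (by omega : d ≠ e), Finset.prod_pair (by omega : b ≠ e),
    Finset.prod_pair (by omega : b ≠ d)]
  rw [pairSign_of_lt hab, pairSign_of_lt hbd, pairSign_of_lt hde, pairSign_of_lt (hab.trans hbd),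
    pairSign_of_lt (hbd.trans hde), pairSign_of_lt (hab.trans (hbd.trans hde)),
    pairSign_of_gt hab, pairSign_of_gt hbd, pairSign_of_gt hde, pairSign_of_gt (hab.trans hbd),
    pairSign_of_gt (hbd.trans hde), pairSign_of_gt (hab.trans (hbd.trans hde))]
  norm_num

/-- The alternating sum over the faces of a tetrahedron. -/
theorem sum_sgn_quadruple {a b d e : ℕ} (hab : a < b) (hbd : b < d) (hde : d < e)
    (f : Finset ℕ → ℂ) :
    ∑ v ∈ {a, b, d, e}, (sgn {a, b, d, e} v : ℂ) * f (({a, b, d, e} : Finset ℕ).erase v)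
      = f {b, d, e} - f {a, d, e} + f {a, b, e} - f {a, b, d} := by
  obtain ⟨h1, h2, h3, h4⟩ := erase_quadruple (by omega : a ≠ b) (by omega : a ≠ d)
    (by omega : a ≠ e) (by omega : b ≠ d) (by omega : b ≠ e) (by omega : d ≠ e)
  obtain ⟨s1, s2, s3, s4⟩ := sgn_quadruple hab hbd hde
  rw [sum_quadruple (by omega) (by omega) (by omega) (by omega) (by omega) (by omega),
    h1, h2, h3, h4, s1, s2, s3, s4]
  ring

theorem orientedValue_of_lt (c : Finset ℕ → ℂ) {a b d : ℕ} (hab : a < b) (hbd : b < d) :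
    orientedValue c a b d = c {a, b, d} := by
  unfold orientedValue
  rw [pairSign_of_lt hab, pairSign_of_lt hbd, pairSign_of_lt (hab.trans hbd)]
  ring

theorem mem_simplices {X : FinComplex} {d : ℕ} {s : Finset ℕ} :
    s ∈ X.simplices d ↔ s ∈ X.faces ∧ s.card = d + 1 := by
  simp [FinComplex.simplices]

theorem mem_simplices_of_subset {X : FinComplex} {d d' : ℕ} {s t : Finset ℕ}
    (ht : t ∈ X.simplices d) (hst : s ⊆ t) (hs : s.card = d' + 1) : s ∈ X.simplices d' := by
  rw [mem_simplices] at ht ⊢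
  exact ⟨(X.isRelLowerSet_faces ht.1).2 hst (Finset.card_pos.mp (by omega)), hs⟩

theorem card_triple {a b d : ℕ} (hab : a ≠ b) (had : a ≠ d) (hbd : b ≠ d) :
    ({a, b, d} : Finset ℕ).card = 3 := by
  rw [Finset.card_insert_of_notMem (by simp; omega), Finset.card_pair hbd]

theorem card_quadruple {a b d e : ℕ} (hab : a ≠ b) (had : a ≠ d) (hae : a ≠ e) (hbd : b ≠ d)
    (hbe : b ≠ e) (hde : d ≠ e) : ({a, b, d, e} : Finset ℕ).card = 4 := by
  rw [Finset.card_insert_of_notMem (by simp; omega), card_triple hbd hbe hde]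

/-! ## Oriented forms of the defining relations in a tetrahedron -/

/-- The sign of the order `a, b, d, e` of the vertices of a tetrahedron. -/
noncomputable def quadSign (a b d e : ℕ) : ℂ :=
  pairSign a b * pairSign a d * pairSign a e * pairSign b d * pairSign b e * pairSign d e

theorem quadSign_sq (a b d e : ℕ) : quadSign a b d e ^ 2 = 1 := by
  unfold quadSign; simp only [mul_pow, pairSign_sq, mul_one]

theorem quadSign_swap₁₂ {a b : ℕ} (d e : ℕ) (h : a ≠ b) :
    quadSign b a d e = -quadSign a b d e := by
  unfold quadSign; rw [pairSign_swap h]; ring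

theorem quadSign_swap₂₃ (a : ℕ) {b d : ℕ} (e : ℕ) (h : b ≠ d) :
    quadSign a d b e = -quadSign a b d e := by
  unfold quadSign; rw [pairSign_swap h]; ring

theorem quadSign_swap₃₄ (a b : ℕ) {d e : ℕ} (h : d ≠ e) :
    quadSign a b e d = -quadSign a b d e := by
  unfold quadSign; rw [pairSign_swap h]; ring

theorem quad_perm₁₂ (a b d e : ℕ) : ({b, a, d, e} : Finset ℕ) = {a, b, d, e} :=
  Finset.insert_comm _ _ _

theorem quad_perm₂₃ (a b d e : ℕ) : ({a, d, b, e} : Finset ℕ) = {a, b, d, e} := by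
  rw [Finset.insert_comm d b]

theorem quad_perm₃₄ (a b d e : ℕ) : ({a, b, e, d} : Finset ℕ) = {a, b, d, e} := by
  rw [Finset.pair_comm e d]

variable {X : FinComplex}

/-- An adjacent transposition of the vertices changes the sign of the whole alternating sum, so the
increasing order, where this is the definition of a cocycle, suffices. -/
theorem orientedValue_cocycle (c : cocycles X) :
    ∀ a b d e : ℕ, a ≠ b → a ≠ d → a ≠ e → b ≠ d → b ≠ e → d ≠ e → {a, b, d, e} ∈ X.simplices 3 →
    orientedValue c.1 b d e - orientedValue c.1 a d e + orientedValue c.1 a b e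
      - orientedValue c.1 a b d = 0 := by
  refine forall_quadruple_of_increasing ?_ ?_ ?_ ?_
  · intro a b d e hab hbd hde ht
    have := c.2.2 _ ht
    rw [sum_sgn_quadruple hab hbd hde] at this
    rwa [orientedValue_of_lt _ hbd hde, orientedValue_of_lt _ (hab.trans hbd) hde,
      orientedValue_of_lt _ hab (hbd.trans hde), orientedValue_of_lt _ hab hbd]
  · intro a b d e h H ht
    rw [quad_perm₁₂] at ht
    have := H ht
    rw [orientedValue_swap₁₂ _ e h, orientedValue_swap₁₂ _ d h]
    linear_combination -this
  · intro a b d e h H ht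
    rw [quad_perm₂₃] at ht
    have := H ht
    rw [orientedValue_swap₁₂ _ e h, orientedValue_swap₂₃ _ a h]
    linear_combination -this
  · intro a b d e h H ht
    rw [quad_perm₃₄] at ht
    have := H ht
    rw [orientedValue_swap₂₃ _ b h, orientedValue_swap₂₃ _ a h]
    linear_combination -this

variable {ω : cocycles X} {K q : Finset ℕ → ℂ} {β γ : Finset ℕ → cocycles X →ₗ[ℂ] ℂ}

/-- Every summand is of odd degree in oriented values, so the bracket changes its sign under a
transposition, and `quadSign` compensates. -/
theorem IsEdgeOperators.oriented_scalar_product (hE : IsEdgeOperators X ω K β γ)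
    (c c' : cocycles X) :
    ∀ a b d e : ℕ, a ≠ b → a ≠ d → a ≠ e → b ≠ d → b ≠ e → d ≠ e → {a, b, d, e} ∈ X.simplices 3 →
    β {a, b, d, e} c * γ {a, b, d, e} c' + β {a, b, d, e} c' * γ {a, b, d, e} c =
      quadSign a b d e *
        (orientedValue c.1 b d e * orientedValue c'.1 b d e / orientedValue ω.1 b d e
        - orientedValue c.1 a d e * orientedValue c'.1 a d e / orientedValue ω.1 a d e
        + orientedValue c.1 a b e * orientedValue c'.1 a b e / orientedValue ω.1 a b e
        - orientedValue c.1 a b d * orientedValue c'.1 a b d / orientedValue ω.1 a b d) := by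
  refine forall_quadruple_of_increasing ?_ ?_ ?_ ?_
  · intro a b d e hab hbd hde ht
    have := hE.scalar_product _ ht c c'
    rw [sum_sgn_quadruple hab hbd hde (fun s => c.1 s * c'.1 s / ω.1 s)] at this
    simp only [orientedValue_of_lt _ hbd hde, orientedValue_of_lt _ (hab.trans hbd) hde,
      orientedValue_of_lt _ hab (hbd.trans hde), orientedValue_of_lt _ hab hbd]
    rw [this]
    unfold quadSign
    rw [pairSign_of_lt hab, pairSign_of_lt hbd, pairSign_of_lt hde, pairSign_of_lt (hab.trans hbd),
      pairSign_of_lt (hbd.trans hde), pairSign_of_lt (hab.trans (hbd.trans hde))]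
    ring
  · intro a b d e h H ht
    rw [quad_perm₁₂] at ht ⊢
    rw [H ht, quadSign_swap₁₂ _ _ h]
    simp only [orientedValue_swap₁₂ _ e h, orientedValue_swap₁₂ _ d h, neg_mul_neg, div_neg]
    ring
  · intro a b d e h H ht
    rw [quad_perm₂₃] at ht ⊢
    rw [H ht, quadSign_swap₂₃ _ _ h]
    simp only [orientedValue_swap₁₂ _ e h, orientedValue_swap₂₃ _ a h, neg_mul_neg, div_neg]
    ring
  · intro a b d e h H ht
    rw [quad_perm₃₄] at ht ⊢
    rw [H ht, quadSign_swap₃₄ _ _ h]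
    simp only [orientedValue_swap₂₃ _ b h, orientedValue_swap₂₃ _ a h, neg_mul_neg, div_neg]
    ring

/-- The determinant in the antisymmetric part of `β_t(c) γ_t(c')`, for the tetrahedron `abde`. -/
noncomputable def orientedDet (c c' w : Finset ℕ → ℂ) (a b d e : ℕ) : ℂ :=
  orientedValue c b d e * (orientedValue c' a d e * orientedValue w a b e
      - orientedValue c' a b e * orientedValue w a d e)
    - orientedValue c a d e * (orientedValue c' b d e * orientedValue w a b e
      - orientedValue c' a b e * orientedValue w b d e)
    + orientedValue c a b e * (orientedValue c' b d e * orientedValue w a d e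
      - orientedValue c' a d e * orientedValue w b d e)

/-- The determinant involves the three faces at the last vertex. A transposition among the first
three vertices exchanges two columns and negates the third one, with no net effect. Changing the
last vertex changes the omitted face, and the cocycle condition is needed. -/
theorem IsEdgeOperators.oriented_branch (hE : IsEdgeOperators X ω K β γ) (c c' : cocycles X) :
    ∀ a b d e : ℕ, a ≠ b → a ≠ d → a ≠ e → b ≠ d → b ≠ e → d ≠ e → {a, b, d, e} ∈ X.simplices 3 →
    β {a, b, d, e} c * γ {a, b, d, e} c' - β {a, b, d, e} c' * γ {a, b, d, e} c =
      orientedDet c.1 c'.1 ω.1 a b d e / K {a, b, d, e} := by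
  -- Distinctness of all four vertices is carried along, because the cocycle condition in the last
  -- transposition requires it.
  suffices H : ∀ a b d e : ℕ, a ≠ b → a ≠ d → a ≠ e → b ≠ d → b ≠ e → d ≠ e →
      ({a, b, d, e} ∈ X.simplices 3 ∧ [a, b, d, e].Nodup) →
      β {a, b, d, e} c * γ {a, b, d, e} c' - β {a, b, d, e} c' * γ {a, b, d, e} c =
        orientedDet c.1 c'.1 ω.1 a b d e / K {a, b, d, e} by
    intro a b d e h1 h2 h3 h4 h5 h6 ht
    exact H a b d e h1 h2 h3 h4 h5 h6 ⟨ht, by simp [h1, h2, h3, h4, h5, h6]⟩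
  refine forall_quadruple_of_increasing ?_ ?_ ?_ ?_
  · rintro a b d e hab hbd hde ⟨ht, -⟩
    rw [hE.branch a b d e hab hbd hde ht c c', Matrix.det_fin_three]
    unfold orientedDet
    simp only [orientedValue_of_lt _ hbd hde, orientedValue_of_lt _ (hab.trans hbd) hde,
      orientedValue_of_lt _ hab (hbd.trans hde)]
    congr 1
    simp only [Matrix.of_apply, Matrix.cons_val]
    ring
  · rintro a b d e h H ⟨ht, hn⟩
    have hn' : [a, b, d, e].Nodup := by rw [nodup_four_iff] at hn ⊢; omega
    rw [quad_perm₁₂] at ht ⊢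
    rw [H ⟨ht, hn'⟩]
    congr 1
    unfold orientedDet
    simp only [orientedValue_swap₁₂ _ e h]
    ring
  · rintro a b d e h H ⟨ht, hn⟩
    have hn' : [a, b, d, e].Nodup := by rw [nodup_four_iff] at hn ⊢; omega
    rw [quad_perm₂₃] at ht ⊢
    rw [H ⟨ht, hn'⟩]
    congr 1
    unfold orientedDet
    simp only [orientedValue_swap₁₂ _ e h]
    ring
  · rintro a b d e h H ⟨ht, hn⟩
    have hn' : [a, b, d, e].Nodup := by rw [nodup_four_iff] at hn ⊢; omega
    rw [quad_perm₃₄] at ht ⊢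
    rw [H ⟨ht, hn'⟩]
    congr 1
    have hd : a ≠ b ∧ a ≠ d ∧ a ≠ e ∧ b ≠ d ∧ b ≠ e ∧ d ≠ e := by
      rw [nodup_four_iff] at hn'; tauto
    obtain ⟨x1, x2, x3, x4, x5, x6⟩ := hd
    -- The face `abd`, absent from the old determinant, is eliminated from the new one.
    have z : ∀ x : cocycles X, orientedValue x.1 a b d =
        orientedValue x.1 b d e - orientedValue x.1 a d e + orientedValue x.1 a b e := fun x => by
      linear_combination -orientedValue_cocycle x a b d e x1 x2 x3 x4 x5 x6 ht
    unfold orientedDet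
    simp only [orientedValue_swap₂₃ _ b h, orientedValue_swap₂₃ _ a h, z]
    ring

/-! ## Values of the coboundaries of edges -/

theorem orientedValue_coboundary (x : Finset ℕ → ℂ) :
    ∀ a b d : ℕ, a ≠ b → a ≠ d → b ≠ d → {a, b, d} ∈ X.simplices 2 →
    orientedValue (coboundary X x).1 a b d =
      pairSign a b * x {a, b} + pairSign b d * x {b, d} - pairSign a d * x {a, d} := by
  refine forall_triple_of_increasing ?_ ?_ ?_
  · intro a b d hab hbd hs
    obtain ⟨h1, h2, h3⟩ := erase_triple (by omega : a ≠ b) (by omega : a ≠ d) (by omega : b ≠ d)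
    rw [orientedValue_of_lt _ hab hbd]
    simp only [coboundary, if_pos hs]
    have n1 : a ∉ ({b, d} : Finset ℕ) := by simp; omega
    rw [Finset.sum_insert n1, Finset.sum_pair (by omega)]
    simp only [sgn_eq_prod_pairSign]
    rw [h1, h2, h3, Finset.prod_pair (by omega), Finset.prod_pair (by omega),
      Finset.prod_pair (by omega), pairSign_of_lt hab, pairSign_of_lt hbd,
      pairSign_of_lt (hab.trans hbd), pairSign_of_gt hab, pairSign_of_gt hbd,
      pairSign_of_gt (hab.trans hbd)]
    ring
  · intro a b d h H hs
    rw [Finset.insert_comm b a] at hs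
    rw [orientedValue_swap₁₂ _ _ h, H hs, pairSign_swap h, Finset.pair_comm b a]
    ring
  · intro a b d h H hs
    rw [Finset.pair_comm d b] at hs
    rw [orientedValue_swap₂₃ _ _ h, H hs, pairSign_swap h, Finset.pair_comm d b]
    ring

/-- The value of the oriented edge `ab` on the oriented edge `xy`. -/
noncomputable def edgeValue (a b x y : ℕ) : ℂ :=
  if a = x ∧ b = y then 1 else if a = y ∧ b = x then -1 else 0

theorem edgeValue_eq {a b x y : ℕ} (hab : a ≠ b) (hxy : x ≠ y) :
    pairSign x y * (pairSign a b * (Pi.single ({a, b} : Finset ℕ) (1 : ℂ) : Finset ℕ → ℂ) {x, y})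
      = edgeValue a b x y := by
  unfold edgeValue
  by_cases h1 : a = x ∧ b = y
  · obtain ⟨rfl, rfl⟩ := h1
    simp only [Pi.single_eq_same, and_self, if_true]
    linear_combination pairSign_sq a b
  by_cases h2 : a = y ∧ b = x
  · obtain ⟨rfl, rfl⟩ := h2
    rw [if_neg h1, if_pos ⟨rfl, rfl⟩, Finset.pair_comm b a, Pi.single_eq_same, pairSign_swap hab]
    linear_combination -pairSign_sq a b
  · rw [if_neg h1, if_neg h2, Pi.single_eq_of_ne]
    · ring
    · intro h
      have hx : x ∈ ({a, b} : Finset ℕ) := h ▸ (by simp)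
      have hy : y ∈ ({a, b} : Finset ℕ) := h ▸ (by simp)
      simp only [mem_insert, mem_singleton] at hx hy
      omega

theorem orientedValue_orientedEdge {a b x y z : ℕ} (hab : a ≠ b) (hxy : x ≠ y) (hxz : x ≠ z)
    (hyz : y ≠ z) (hs : {x, y, z} ∈ X.simplices 2) :
    orientedValue (orientedEdge X a b).1 x y z =
      edgeValue a b x y + edgeValue a b y z - edgeValue a b x z := by
  have h : orientedValue (orientedEdge X a b).1 x y z =
      pairSign a b * orientedValue (edgeCocycle X {a, b}).1 x y z := by
    unfold orientedValue orientedEdge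
    simp only [Submodule.coe_smul, Pi.smul_apply, smul_eq_mul]
    ring
  rw [h, edgeCocycle, orientedValue_coboundary _ x y z hxy hxz hyz hs, ← edgeValue_eq hab hxy,
    ← edgeValue_eq hab hxz, ← edgeValue_eq hab hyz]
  ring

end PLFermion

namespace PLFermion

variable {X : FinComplex} {ω : cocycles X} {K q : Finset ℕ → ℂ}
  {β γ : Finset ℕ → cocycles X →ₗ[ℂ] ℂ}

/-! ## Edge operators in a tetrahedron -/

theorem triple_mem {a b d e : ℕ} (hn : [a, b, d, e].Nodup) (ht : {a, b, d, e} ∈ X.simplices 3) :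
    {b, d, e} ∈ X.simplices 2 ∧ {a, d, e} ∈ X.simplices 2 ∧ {a, b, e} ∈ X.simplices 2 ∧
      {a, b, d} ∈ X.simplices 2 := by
  rw [nodup_four_iff] at hn
  obtain ⟨⟨h1, h2, h3⟩, ⟨h4, h5⟩, h6⟩ := hn
  refine ⟨mem_simplices_of_subset ht ?_ (card_triple h4 h5 h6),
    mem_simplices_of_subset ht ?_ (card_triple h2 h3 h6),
    mem_simplices_of_subset ht ?_ (card_triple h1 h3 h5),
    mem_simplices_of_subset ht ?_ (card_triple h1 h2 h4)⟩ <;>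
  · intro x; simp only [mem_insert, mem_singleton]; omega

theorem orientedValue_ne_zero {c : Finset ℕ → ℂ} {a b d : ℕ} (h : c {a, b, d} ≠ 0) :
    orientedValue c a b d ≠ 0 := by
  unfold orientedValue
  exact mul_ne_zero (mul_ne_zero (mul_ne_zero (pairSign_ne_zero _ _) (pairSign_ne_zero _ _))
    (pairSign_ne_zero _ _)) h

theorem IsRootChoice.root_ne_zero (hR : IsRootChoice X ω K q)
    (hω : ∀ s ∈ X.simplices 2, ω.1 s ≠ 0) {s : Finset ℕ} (hs : s ∈ X.simplices 2) : q s ≠ 0 := by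
  intro h
  have := hR.sq s hs
  rw [h] at this
  exact hω s hs (by rw [← this]; norm_num)

theorem IsRootChoice.agree_quadruple (hR : IsRootChoice X ω K q) {a b d e : ℕ}
    (hn : [a, b, d, e].Nodup) (ht : {a, b, d, e} ∈ X.simplices 3) :
    K {a, b, d, e} = q {b, d, e} * q {a, d, e} * q {a, b, e} * q {a, b, d} := by
  have hn' := hn
  rw [nodup_four_iff] at hn
  obtain ⟨⟨h1, h2, h3⟩, ⟨h4, h5⟩, h6⟩ := hn
  obtain ⟨e1, e2, e3, e4⟩ := erase_quadruple h1 h2 h3 h4 h5 h6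
  rw [hR.agree _ ht, prod_quadruple h1 h2 h3 h4 h5 h6, e1, e2, e3, e4]

theorem IsRootChoice.ne_zero (hR : IsRootChoice X ω K q) (hω : ∀ s ∈ X.simplices 2, ω.1 s ≠ 0)
    {a b d e : ℕ} (hn : [a, b, d, e].Nodup) (ht : {a, b, d, e} ∈ X.simplices 3) :
    K {a, b, d, e} ≠ 0 := by
  obtain ⟨m1, m2, m3, m4⟩ := triple_mem hn ht
  rw [hR.agree_quadruple hn ht]
  exact mul_ne_zero (mul_ne_zero (mul_ne_zero (hR.root_ne_zero hω m1) (hR.root_ne_zero hω m2))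
    (hR.root_ne_zero hω m3)) (hR.root_ne_zero hω m4)

theorem IsRootChoice.sq_eq (hR : IsRootChoice X ω K q)
    {a b d e : ℕ} (hn : [a, b, d, e].Nodup) (ht : {a, b, d, e} ∈ X.simplices 3) :
    K {a, b, d, e} ^ 2 = orientedValue ω.1 b d e * orientedValue ω.1 a d e *
      orientedValue ω.1 a b e * orientedValue ω.1 a b d := by
  obtain ⟨m1, m2, m3, m4⟩ := triple_mem hn ht
  rw [hR.agree_quadruple hn ht, mul_pow, mul_pow, mul_pow, hR.sq _ m1, hR.sq _ m2, hR.sq _ m3,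
    hR.sq _ m4]
  unfold orientedValue
  have := pairSign_sq a b
  have := pairSign_sq a d
  have := pairSign_sq a e
  have := pairSign_sq b d
  have := pairSign_sq b e
  have := pairSign_sq d e
  calc _ = (pairSign a b ^ 2 * pairSign a d ^ 2 * pairSign a e ^ 2 * pairSign b d ^ 2 *
      pairSign b e ^ 2 * pairSign d e ^ 2) *
        (ω.1 {b, d, e} * ω.1 {a, d, e} * ω.1 {a, b, e} * ω.1 {a, b, d}) := by
        simp only [*]; ring
    _ = _ := by ring

/-- The sum of the symmetric and antisymmetric parts: the product is completely determined by `ω`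
and `K`, although the factors are only determined up to reciprocal scalars. -/
theorem IsEdgeOperators.two_mul_mul (hE : IsEdgeOperators X ω K β γ) (c c' : cocycles X)
    {a b d e : ℕ} (hn : [a, b, d, e].Nodup) (ht : {a, b, d, e} ∈ X.simplices 3) :
    2 * (β {a, b, d, e} c * γ {a, b, d, e} c') =
      quadSign a b d e *
        (orientedValue c.1 b d e * orientedValue c'.1 b d e / orientedValue ω.1 b d e
        - orientedValue c.1 a d e * orientedValue c'.1 a d e / orientedValue ω.1 a d e
        + orientedValue c.1 a b e * orientedValue c'.1 a b e / orientedValue ω.1 a b e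
        - orientedValue c.1 a b d * orientedValue c'.1 a b d / orientedValue ω.1 a b d)
      + orientedDet c.1 c'.1 ω.1 a b d e / K {a, b, d, e} := by
  rw [nodup_four_iff] at hn
  obtain ⟨⟨h1, h2, h3⟩, ⟨h4, h5⟩, h6⟩ := hn
  rw [← hE.oriented_scalar_product c c' a b d e h1 h2 h3 h4 h5 h6 ht,
    ← hE.oriented_branch c c' a b d e h1 h2 h3 h4 h5 h6 ht]
  ring

/-- The values of an oriented edge of a tetrahedron on the faces of the tetrahedron, computed from
`orientedValue_orientedEdge`. -/
theorem orientedValue_orientedEdge_self {a b d : ℕ} (hab : a ≠ b) (had : a ≠ d) (hbd : b ≠ d)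
    (hs : {a, b, d} ∈ X.simplices 2) :
    orientedValue (orientedEdge X a b).1 a b d = 1 ∧
      orientedValue (orientedEdge X a d).1 a b d = -1 ∧
      orientedValue (orientedEdge X b d).1 a b d = 1 := by
  rw [orientedValue_orientedEdge hab hab had hbd hs, orientedValue_orientedEdge had hab had hbd hs,
    orientedValue_orientedEdge hbd hab had hbd hs]
  simp [edgeValue, hab, had, hbd, hab.symm, had.symm, hbd.symm]

theorem orientedEdge_apply_eq_zero {a b : ℕ} {s : Finset ℕ} (h : ¬({a, b} : Finset ℕ) ⊆ s) :
    (orientedEdge X a b).1 s = 0 := by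
  have : (edgeCocycle X {a, b}).1 s = 0 := by
    simp only [edgeCocycle, coboundary]
    split_ifs with hs
    · refine Finset.sum_eq_zero fun v _ => ?_
      rw [Pi.single_eq_of_ne, mul_zero]
      exact fun h' => h (h' ▸ Finset.erase_subset v s)
    · rfl
  simp only [orientedEdge, Submodule.coe_smul, Pi.smul_apply, this, smul_zero]

theorem orientedValue_eq_zero {c : Finset ℕ → ℂ} {a b d : ℕ} (h : c {a, b, d} = 0) :
    orientedValue c a b d = 0 := by
  unfold orientedValue; rw [h, mul_zero]

theorem orientedValue_orientedEdge_eq_zero {a b x y z : ℕ} (h : ¬({a, b} : Finset ℕ) ⊆ {x, y, z}) :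
    orientedValue (orientedEdge X a b).1 x y z = 0 :=
  orientedValue_eq_zero (orientedEdge_apply_eq_zero h)

theorem pair_not_subset_left {a b : ℕ} {s : Finset ℕ} (h : a ∉ s) : ¬({a, b} : Finset ℕ) ⊆ s :=
  fun h' => h (h' (by simp))

theorem pair_not_subset_right {a b : ℕ} {s : Finset ℕ} (h : b ∉ s) : ¬({a, b} : Finset ℕ) ⊆ s :=
  fun h' => h (h' (by simp))

/-- On the faces at `e`, the edge `bd` is seen only by `bde`, and `de` is not seen by `abe`, so the
determinant is triangular. -/
theorem orientedDet_path {a b d e : ℕ} (hn : [a, b, d, e].Nodup)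
    (ht : {a, b, d, e} ∈ X.simplices 3) :
    orientedDet (orientedEdge X b d).1 (orientedEdge X d e).1 ω.1 a b d e =
      orientedValue ω.1 a b e := by
  obtain ⟨m1, m2, m3, m4⟩ := triple_mem hn ht
  rw [nodup_four_iff] at hn
  obtain ⟨⟨h1, h2, h3⟩, ⟨h4, h5⟩, h6⟩ := hn
  have e1 := (orientedValue_orientedEdge_self h4 h5 h6 m1).1
  have e2 := (orientedValue_orientedEdge_self h4 h5 h6 m1).2.2
  have e3 := (orientedValue_orientedEdge_self h2 h3 h6 m2).2.2
  have z1 : orientedValue (orientedEdge X b d).1 a d e = 0 :=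
    orientedValue_orientedEdge_eq_zero (pair_not_subset_left (by simp; omega))
  have z2 : orientedValue (orientedEdge X b d).1 a b e = 0 :=
    orientedValue_orientedEdge_eq_zero (pair_not_subset_right (by simp; omega))
  have z3 : orientedValue (orientedEdge X d e).1 a b e = 0 :=
    orientedValue_orientedEdge_eq_zero (pair_not_subset_left (by simp; omega))
  unfold orientedDet
  rw [e1, e2, e3, z1, z2, z3]
  ring

/-- A nonzero value of the antisymmetric form: it shows that `β_t` and `γ_t` do not vanish, and it
evaluates the 2×2 blocks in the denominator of `H_u`. -/
theorem IsEdgeOperators.wedge_path (hE : IsEdgeOperators X ω K β γ) {a b d e : ℕ}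
    (hn : [a, b, d, e].Nodup) (ht : {a, b, d, e} ∈ X.simplices 3) :
    β {a, b, d, e} (orientedEdge X b d) * γ {a, b, d, e} (orientedEdge X d e)
      - β {a, b, d, e} (orientedEdge X d e) * γ {a, b, d, e} (orientedEdge X b d) =
      orientedValue ω.1 a b e / K {a, b, d, e} := by
  have hn' := hn
  rw [nodup_four_iff] at hn
  obtain ⟨⟨h1, h2, h3⟩, ⟨h4, h5⟩, h6⟩ := hn
  rw [hE.oriented_branch _ _ a b d e h1 h2 h3 h4 h5 h6 ht, orientedDet_path hn' ht]

theorem exists_quadruple {t : Finset ℕ} (ht : t ∈ X.simplices 3) :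
    ∃ a b d e : ℕ, [a, b, d, e].Nodup ∧ t = {a, b, d, e} := by
  obtain ⟨a, b, d, e, h1, h2, h3, h4, h5, h6, h⟩ := Finset.card_eq_four.1 (mem_simplices.1 ht).2
  exact ⟨a, b, d, e, nodup_four_iff.2 ⟨⟨h1, h2, h3⟩, ⟨h4, h5⟩, h6⟩, h⟩

theorem IsEdgeOperators.exists_ne_zero (hE : IsEdgeOperators X ω K β γ)
    (hR : IsRootChoice X ω K q) (hω : ∀ s ∈ X.simplices 2, ω.1 s ≠ 0) {t : Finset ℕ}
    (ht : t ∈ X.simplices 3) : (∃ c, β t c ≠ 0) ∧ ∃ c, γ t c ≠ 0 := by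
  obtain ⟨a, b, d, e, hn, rfl⟩ := exists_quadruple ht
  have h := hE.wedge_path hn ht
  have h0 : orientedValue ω.1 a b e / K {a, b, d, e} ≠ 0 :=
    div_ne_zero (orientedValue_ne_zero (hω _ (triple_mem hn ht).2.2.1)) (hR.ne_zero hω hn ht)
  constructor
  · by_contra! hc
    rw [hc, hc, zero_mul, zero_mul, sub_zero] at h
    exact h0 h.symm
  · by_contra! hc
    rw [hc, hc, mul_zero, mul_zero, sub_zero] at h
    exact h0 h.symm

theorem IsEdgeOperators.eq_zero_of_mul (hE : IsEdgeOperators X ω K β γ)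
    (hR : IsRootChoice X ω K q) (hω : ∀ s ∈ X.simplices 2, ω.1 s ≠ 0) {t : Finset ℕ}
    (ht : t ∈ X.simplices 3) {c : cocycles X} (h : ∀ c', β t c * γ t c' = 0)
    (h' : ∀ c', β t c' * γ t c = 0) : β t c = 0 ∧ γ t c = 0 := by
  obtain ⟨⟨c₁, h₁⟩, c₂, h₂⟩ := hE.exists_ne_zero hR hω ht
  exact ⟨(mul_eq_zero.1 (h c₂)).resolve_right h₂, (mul_eq_zero.1 (h' c₁)).resolve_left h₁⟩

/-- The edge operator in a tetrahedron depends only on the restriction of the cocycle. -/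
theorem IsEdgeOperators.eq_zero_of_restrict (hE : IsEdgeOperators X ω K β γ)
    (hR : IsRootChoice X ω K q) (hω : ∀ s ∈ X.simplices 2, ω.1 s ≠ 0) {t : Finset ℕ}
    (ht : t ∈ X.simplices 3) {c : cocycles X} (hc : ∀ s ⊆ t, s.card = 3 → c.1 s = 0) :
    β t c = 0 ∧ γ t c = 0 := by
  obtain ⟨a, b, d, e, hn, rfl⟩ := exists_quadruple ht
  have hn' := hn
  rw [nodup_four_iff] at hn'
  obtain ⟨⟨h1, h2, h3⟩, ⟨h4, h5⟩, h6⟩ := hn'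
  have z1 : orientedValue c.1 b d e = 0 := orientedValue_eq_zero
    (hc _ (by intro x; simp only [mem_insert, mem_singleton]; omega) (card_triple h4 h5 h6))
  have z2 : orientedValue c.1 a d e = 0 := orientedValue_eq_zero
    (hc _ (by intro x; simp only [mem_insert, mem_singleton]; omega) (card_triple h2 h3 h6))
  have z3 : orientedValue c.1 a b e = 0 := orientedValue_eq_zero
    (hc _ (by intro x; simp only [mem_insert, mem_singleton]; omega) (card_triple h1 h3 h5))
  have z4 : orientedValue c.1 a b d = 0 := orientedValue_eq_zero
    (hc _ (by intro x; simp only [mem_insert, mem_singleton]; omega) (card_triple h1 h2 h4))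
  refine hE.eq_zero_of_mul hR hω ht (fun c' => ?_) (fun c' => ?_)
  · have := hE.two_mul_mul c c' hn ht
    unfold orientedDet at this
    rw [z1, z2, z3, z4] at this
    simpa using this
  · have := hE.two_mul_mul c' c hn ht
    unfold orientedDet at this
    rw [z1, z2, z3, z4] at this
    simpa using this

/-- With `ω` as one argument, the scalar product becomes the cocycle condition for the other
argument and the determinant has two equal rows. -/
theorem IsEdgeOperators.apply_omega (hE : IsEdgeOperators X ω K β γ)
    (hR : IsRootChoice X ω K q) (hω : ∀ s ∈ X.simplices 2, ω.1 s ≠ 0) {t : Finset ℕ}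
    (ht : t ∈ X.simplices 3) : β t ω = 0 ∧ γ t ω = 0 := by
  obtain ⟨a, b, d, e, hn, rfl⟩ := exists_quadruple ht
  have hn' := hn
  rw [nodup_four_iff] at hn'
  obtain ⟨⟨h1, h2, h3⟩, ⟨h4, h5⟩, h6⟩ := hn'
  obtain ⟨m1, m2, m3, m4⟩ := triple_mem hn ht
  have n1 := orientedValue_ne_zero (hω _ m1)
  have n2 := orientedValue_ne_zero (hω _ m2)
  have n3 := orientedValue_ne_zero (hω _ m3)
  have n4 := orientedValue_ne_zero (hω _ m4)
  refine hE.eq_zero_of_mul hR hω ht (fun c' => ?_) (fun c' => ?_)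
  · have := hE.two_mul_mul ω c' hn ht
    have hc := orientedValue_cocycle c' a b d e h1 h2 h3 h4 h5 h6 ht
    rw [mul_div_cancel_left₀ _ n1, mul_div_cancel_left₀ _ n2, mul_div_cancel_left₀ _ n3,
      mul_div_cancel_left₀ _ n4, hc] at this
    have hd : orientedDet ω.1 c'.1 ω.1 a b d e = 0 := by unfold orientedDet; ring
    rw [hd] at this
    simpa using this
  · have := hE.two_mul_mul c' ω hn ht
    have hc := orientedValue_cocycle c' a b d e h1 h2 h3 h4 h5 h6 ht
    rw [mul_div_cancel_right₀ _ n1, mul_div_cancel_right₀ _ n2, mul_div_cancel_right₀ _ n3,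
      mul_div_cancel_right₀ _ n4, hc] at this
    have hd : orientedDet c'.1 ω.1 ω.1 a b d e = 0 := by unfold orientedDet; ring
    rw [hd] at this
    simpa using this

/-- The components of `∂_t` for two opposite edges of a tetrahedron are proportional. -/
theorem IsEdgeOperators.apply_opposite_edge (hE : IsEdgeOperators X ω K β γ)
    (hR : IsRootChoice X ω K q) (hω : ∀ s ∈ X.simplices 2, ω.1 s ≠ 0) {a b d e : ℕ}
    (hn : [a, b, d, e].Nodup) (ht : {a, b, d, e} ∈ X.simplices 3) :
    β {a, b, d, e} (orientedEdge X d e) * (orientedValue ω.1 b d e * orientedValue ω.1 a d e) =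
      quadSign a b d e * K {a, b, d, e} * β {a, b, d, e} (orientedEdge X a b) := by
  -- Only products with `γ_t(c)` are known explicitly, so the identity is tested after
  -- multiplication by a nonzero `γ_t(c)`.
  obtain ⟨c, hc⟩ := (hE.exists_ne_zero hR hω ht).2
  have e1 := hE.two_mul_mul (orientedEdge X d e) c hn ht
  have e2 := hE.two_mul_mul (orientedEdge X a b) c hn ht
  have hK := hR.sq_eq hn ht
  have hK0 := hR.ne_zero hω hn ht
  have hσ := quadSign_sq a b d e
  obtain ⟨m1, m2, m3, m4⟩ := triple_mem hn ht
  have n1 := orientedValue_ne_zero (hω _ m1)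
  have n2 := orientedValue_ne_zero (hω _ m2)
  have n3 := orientedValue_ne_zero (hω _ m3)
  have n4 := orientedValue_ne_zero (hω _ m4)
  rw [nodup_four_iff] at hn
  obtain ⟨⟨h1, h2, h3⟩, ⟨h4, h5⟩, h6⟩ := hn
  have cc := orientedValue_cocycle c a b d e h1 h2 h3 h4 h5 h6 ht
  have cω := orientedValue_cocycle ω a b d e h1 h2 h3 h4 h5 h6 ht
  have v1 := (orientedValue_orientedEdge_self h4 h5 h6 m1).2.2
  have v2 := (orientedValue_orientedEdge_self h2 h3 h6 m2).2.2
  have v3 : orientedValue (orientedEdge X d e).1 a b e = 0 :=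
    orientedValue_orientedEdge_eq_zero (pair_not_subset_left (by simp; omega))
  have v4 : orientedValue (orientedEdge X d e).1 a b d = 0 :=
    orientedValue_orientedEdge_eq_zero (pair_not_subset_right (by simp; omega))
  have w1 : orientedValue (orientedEdge X a b).1 b d e = 0 :=
    orientedValue_orientedEdge_eq_zero (pair_not_subset_left (by simp; omega))
  have w2 : orientedValue (orientedEdge X a b).1 a d e = 0 :=
    orientedValue_orientedEdge_eq_zero (pair_not_subset_right (by simp; omega))
  have w3 := (orientedValue_orientedEdge_self h1 h3 h5 m3).1
  have w4 := (orientedValue_orientedEdge_self h1 h2 h4 m4).1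
  unfold orientedDet at e1 e2
  rw [v1, v2, v3, v4] at e1
  rw [w1, w2, w3, w4] at e2
  generalize orientedValue ω.1 b d e = x1 at *
  generalize orientedValue ω.1 a d e = x2 at *
  generalize orientedValue ω.1 a b e = x3 at *
  generalize orientedValue ω.1 a b d = x4 at *
  generalize orientedValue c.1 b d e = y1 at *
  generalize orientedValue c.1 a d e = y2 at *
  generalize orientedValue c.1 a b e = y3 at *
  generalize orientedValue c.1 a b d = y4 at *
  generalize quadSign a b d e = σ at *
  generalize K {a, b, d, e} = k at *
  refine mul_right_cancel₀ hc (mul_left_cancel₀ (two_ne_zero (α := ℂ)) ?_)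
  have hx : x4 = x1 - x2 + x3 := by linear_combination -cω
  have hy : y4 = y1 - y2 + y3 := by linear_combination -cc
  -- Both sides reduce to the same expression: for the edge `de` through `K_t ^ 2 = ∏ ω_s` and the
  -- cocycle conditions, for the edge `ab` through `σ ^ 2 = 1`.
  have f1 : 2 * (β {a, b, d, e} (orientedEdge X d e) * γ {a, b, d, e} c) * (x1 * x2) =
      σ * (y1 * x2 - y2 * x1) + k * (y3 / x3 - y4 / x4) := by
    rw [e1]
    field_simp
    linear_combination (-(y3 * x4 - x3 * y4)) * hK + x1 * x2 * x3 * x4 * (x3 * hy - y3 * hx)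
  have f2 : 2 * (β {a, b, d, e} (orientedEdge X a b) * γ {a, b, d, e} c) * (σ * k) =
      σ * (y1 * x2 - y2 * x1) + k * (y3 / x3 - y4 / x4) := by
    rw [e2]
    field_simp
    linear_combination x1 * x2 * k * (y3 * x4 - x3 * y4) * hσ
  linear_combination f1 - f2

/-! ## The matrix of edge operators in a pentachoron -/

/-- The determinant of the components of `∂_t`, in the tetrahedra of a pentachoron `ijklm`, for
five of the edges. -/
noncomputable def edgeDet (β : Finset ℕ → cocycles X →ₗ[ℂ] ℂ) (i j k l m : ℕ) : ℂ :=
  Matrix.det (Matrix.of fun r s : Fin 5 =>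
    β ((![{j, k, l, m}, {i, k, l, m}, {i, j, l, m}, {i, j, k, m}, {i, j, k, l}] :
        Fin 5 → Finset ℕ) s)
      ((![orientedEdge X j l, orientedEdge X l m, orientedEdge X j k, orientedEdge X k m,
        orientedEdge X k l] : Fin 5 → cocycles X) r))

theorem quadruple_mem {i j k l m : ℕ} (hn : [i, j, k, l, m].Nodup)
    (hu : {i, j, k, l, m} ∈ X.simplices 4) :
    {j, k, l, m} ∈ X.simplices 3 ∧ {i, k, l, m} ∈ X.simplices 3 ∧ {i, j, l, m} ∈ X.simplices 3 ∧
      {i, j, k, m} ∈ X.simplices 3 ∧ {i, j, k, l} ∈ X.simplices 3 := by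
  rw [nodup_five_iff] at hn
  obtain ⟨⟨h1, h2, h3, h4⟩, ⟨h5, h6, h7⟩, ⟨h8, h9⟩, h10⟩ := hn
  refine ⟨mem_simplices_of_subset hu ?_ (card_quadruple h5 h6 h7 h8 h9 h10),
    mem_simplices_of_subset hu ?_ (card_quadruple h2 h3 h4 h8 h9 h10),
    mem_simplices_of_subset hu ?_ (card_quadruple h1 h3 h4 h6 h7 h10),
    mem_simplices_of_subset hu ?_ (card_quadruple h1 h2 h4 h5 h7 h9),
    mem_simplices_of_subset hu ?_ (card_quadruple h1 h2 h3 h5 h6 h8)⟩ <;>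
  · intro x; simp only [mem_insert, mem_singleton]; omega

end PLFermion

/-! ### Linear relations between edge operators in a pentachoron -/

namespace PLFermion

variable {X : FinComplex} {ω : cocycles X} {K q : Finset ℕ → ℂ}
  {β γ : Finset ℕ → cocycles X →ₗ[ℂ] ℂ}

theorem orientedValue_add (c c' : Finset ℕ → ℂ) (a b d : ℕ) :
    orientedValue (c + c') a b d = orientedValue c a b d + orientedValue c' a b d := by
  simp only [orientedValue, Pi.add_apply]; ring

theorem orientedValue_sub (c c' : Finset ℕ → ℂ) (a b d : ℕ) :
    orientedValue (c - c') a b d = orientedValue c a b d - orientedValue c' a b d := by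
  simp only [orientedValue, Pi.sub_apply]; ring

theorem orientedValue_smul (r : ℂ) (c : Finset ℕ → ℂ) (a b d : ℕ) :
    orientedValue (r • c) a b d = r * orientedValue c a b d := by
  simp only [orientedValue, Pi.smul_apply, smul_eq_mul]; ring

theorem eq_zero_of_orientedValue {c : Finset ℕ → ℂ} {a b d : ℕ} (h : orientedValue c a b d = 0) :
    c {a, b, d} = 0 := by
  unfold orientedValue at h
  exact (mul_eq_zero.1 h).resolve_left (mul_ne_zero (mul_ne_zero (pairSign_ne_zero _ _)
    (pairSign_ne_zero _ _)) (pairSign_ne_zero _ _))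

/-- A cocycle that vanishes on the faces of a pentachoron at one of its vertices vanishes on all
its faces. -/
theorem cocycle_eq_zero_of_cone {i j k l m : ℕ} (hn : [i, j, k, l, m].Nodup)
    (hu : {i, j, k, l, m} ∈ X.simplices 4) {c : cocycles X}
    (h1 : orientedValue c.1 i j k = 0) (h2 : orientedValue c.1 i j l = 0)
    (h3 : orientedValue c.1 i j m = 0) (h4 : orientedValue c.1 i k l = 0)
    (h5 : orientedValue c.1 i k m = 0) (h6 : orientedValue c.1 i l m = 0)
    {s : Finset ℕ} (hs : s ⊆ {i, j, k, l, m}) (hcard : s.card = 3) : c.1 s = 0 := by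
  have hn' := nodup_five_iff.1 hn
  obtain ⟨⟨n1, n2, n3, n4⟩, ⟨n5, n6, n7⟩, ⟨n8, n9⟩, n10⟩ := hn'
  have cone : ∀ x ∈ ({j, k, l, m} : Finset ℕ), ∀ y ∈ ({j, k, l, m} : Finset ℕ), x ≠ y →
      orientedValue c.1 i x y = 0 := by
    have sw : ∀ x y : ℕ, x ≠ y → orientedValue c.1 i x y = 0 → orientedValue c.1 i y x = 0 :=
      fun x y hxy h => by rw [orientedValue_swap₂₃ _ _ hxy, h, neg_zero]
    have t1 := sw _ _ n5 h1
    have t2 := sw _ _ n6 h2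
    have t3 := sw _ _ n7 h3
    have t4 := sw _ _ n8 h4
    have t5 := sw _ _ n9 h5
    have t6 := sw _ _ n10 h6
    intro x hx y hy hxy
    simp only [mem_insert, mem_singleton] at hx hy
    rcases hx with rfl | rfl | rfl | rfl <;> rcases hy with rfl | rfl | rfl | rfl <;>
      first
      | exact absurd rfl hxy
      | assumption
  obtain ⟨x, y, z, hxy, hxz, hyz, rfl⟩ := Finset.card_eq_three.1 hcard
  have mem : ∀ v ∈ ({x, y, z} : Finset ℕ), v ≠ i → v ∈ ({j, k, l, m} : Finset ℕ) := fun v hv hvi =>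
    (Finset.mem_insert.1 (hs hv)).resolve_left hvi
  apply eq_zero_of_orientedValue
  by_cases hx : x = i
  · subst hx
    exact cone y (mem y (by simp) hxy.symm) z (mem z (by simp) hxz.symm) hyz
  by_cases hy : y = i
  · subst hy
    rw [orientedValue_swap₁₂ _ _ hxy.symm, cone x (mem x (by simp) hx) z (mem z (by simp) hyz.symm) hxz,
      neg_zero]
  by_cases hz : z = i
  · subst hz
    rw [orientedValue_swap₂₃ _ _ hyz.symm, orientedValue_swap₁₂ _ _ hxz.symm,
      cone x (mem x (by simp) hx) y (mem y (by simp) hy) hxy, neg_zero, neg_zero]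
  have hx' := mem x (by simp) hx
  have hy' := mem y (by simp) hy
  have hz' := mem z (by simp) hz
  -- A face away from `i` is the last face of its cone over `i`, and the cocycle vanishes on the
  -- three others.
  have ht : ({i, x, y, z} : Finset ℕ) ∈ X.simplices 3 := by
    refine mem_simplices_of_subset hu (Finset.insert_subset (by simp) hs) ?_
    rw [Finset.card_insert_of_notMem (by simp; omega), hcard]
  have h := orientedValue_cocycle c i x y z (Ne.symm hx) (Ne.symm hy) (Ne.symm hz) hxy hxz hyz ht
  rw [cone x hx' y hy' hxy, cone x hx' z hz' hxz, cone y hy' z hz' hyz] at h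
  simpa using h

theorem orientedValue_orientedEdge_cone {i a b x y : ℕ} (hab : a ≠ b) (hix : i ≠ x) (hiy : i ≠ y)
    (hxy : x ≠ y) (hai : a ≠ i) (hbi : b ≠ i) (hs : {i, x, y} ∈ X.simplices 2) :
    orientedValue (orientedEdge X a b).1 i x y = edgeValue a b x y := by
  rw [orientedValue_orientedEdge hab hix hiy hxy hs]
  simp [edgeValue, hai, hbi]

theorem cone_mem {i j k l m : ℕ} (hn : [i, j, k, l, m].Nodup)
    (hu : {i, j, k, l, m} ∈ X.simplices 4) :
    ({i, j, k} ∈ X.simplices 2 ∧ {i, j, l} ∈ X.simplices 2 ∧ {i, j, m} ∈ X.simplices 2) ∧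
      {i, k, l} ∈ X.simplices 2 ∧ {i, k, m} ∈ X.simplices 2 ∧ {i, l, m} ∈ X.simplices 2 := by
  rw [nodup_five_iff] at hn
  obtain ⟨⟨n1, n2, n3, n4⟩, ⟨n5, n6, n7⟩, ⟨n8, n9⟩, n10⟩ := hn
  refine ⟨⟨mem_simplices_of_subset hu ?_ (card_triple n1 n2 n5),
    mem_simplices_of_subset hu ?_ (card_triple n1 n3 n6),
    mem_simplices_of_subset hu ?_ (card_triple n1 n4 n7)⟩,
    mem_simplices_of_subset hu ?_ (card_triple n2 n3 n8),
    mem_simplices_of_subset hu ?_ (card_triple n2 n4 n9),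
    mem_simplices_of_subset hu ?_ (card_triple n3 n4 n10)⟩ <;>
  · intro x; simp only [mem_insert, mem_singleton]; omega

/-- Linear relations between edge operators in the tetrahedra of a pentachoron may be checked on
its faces at one vertex. -/
theorem IsEdgeOperators.eq_zero_of_cone (hE : IsEdgeOperators X ω K β γ)
    (hR : IsRootChoice X ω K q) (hω : ∀ s ∈ X.simplices 2, ω.1 s ≠ 0)
    {i j k l m : ℕ} (hn : [i, j, k, l, m].Nodup)
    (hu : {i, j, k, l, m} ∈ X.simplices 4) {c : cocycles X}
    (h1 : orientedValue c.1 i j k = 0) (h2 : orientedValue c.1 i j l = 0)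
    (h3 : orientedValue c.1 i j m = 0) (h4 : orientedValue c.1 i k l = 0)
    (h5 : orientedValue c.1 i k m = 0) (h6 : orientedValue c.1 i l m = 0)
    {t : Finset ℕ} (ht : t ∈ X.simplices 3) (htu : t ⊆ {i, j, k, l, m}) :
    β t c = 0 :=
  (hE.eq_zero_of_restrict hR hω ht fun _ hs hcard =>
    cocycle_eq_zero_of_cone hn hu h1 h2 h3 h4 h5 h6 (hs.trans htu) hcard).1

/-- The four edges of the pentachoron oriented towards `l` sum to the coboundary of a vertex
cochain, up to sign, and the coboundary of that is zero. -/
theorem IsEdgeOperators.vertex_relation (hE : IsEdgeOperators X ω K β γ)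
    (hR : IsRootChoice X ω K q) (hω : ∀ s ∈ X.simplices 2, ω.1 s ≠ 0)
    {i j k l m : ℕ} (hn : [i, j, k, l, m].Nodup)
    (hu : {i, j, k, l, m} ∈ X.simplices 4)
    {t : Finset ℕ} (ht : t ∈ X.simplices 3) (htu : t ⊆ {i, j, k, l, m}) :
    β t (orientedEdge X i l) = β t (orientedEdge X l m) - β t (orientedEdge X j l)
      - β t (orientedEdge X k l) := by
  have H : β t (orientedEdge X i l + orientedEdge X j l + orientedEdge X k l
      - orientedEdge X l m) = 0 := by
    have hn' := nodup_five_iff.1 hn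
    obtain ⟨⟨n1, n2, n3, n4⟩, ⟨n5, n6, n7⟩, ⟨n8, n9⟩, n10⟩ := hn'
    obtain ⟨⟨m1, m2, m3⟩, m4, m5, m6⟩ := cone_mem hn hu
    refine hE.eq_zero_of_cone hR hω hn hu ?_ ?_ ?_ ?_ ?_ ?_ ht htu <;>
    · simp only [Submodule.coe_add, Submodule.coe_sub, orientedValue_add, orientedValue_sub]
      simp only [orientedValue_orientedEdge n3 n1 n2 n5 m1, orientedValue_orientedEdge n3 n1 n3 n6 m2,
        orientedValue_orientedEdge n3 n1 n4 n7 m3, orientedValue_orientedEdge n3 n2 n3 n8 m4,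
        orientedValue_orientedEdge n3 n2 n4 n9 m5, orientedValue_orientedEdge n3 n3 n4 n10 m6,
        orientedValue_orientedEdge n6 n1 n2 n5 m1, orientedValue_orientedEdge n6 n1 n3 n6 m2,
        orientedValue_orientedEdge n6 n1 n4 n7 m3, orientedValue_orientedEdge n6 n2 n3 n8 m4,
        orientedValue_orientedEdge n6 n2 n4 n9 m5, orientedValue_orientedEdge n6 n3 n4 n10 m6,
        orientedValue_orientedEdge n8 n1 n2 n5 m1, orientedValue_orientedEdge n8 n1 n3 n6 m2,
        orientedValue_orientedEdge n8 n1 n4 n7 m3, orientedValue_orientedEdge n8 n2 n3 n8 m4,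
        orientedValue_orientedEdge n8 n2 n4 n9 m5, orientedValue_orientedEdge n8 n3 n4 n10 m6,
        orientedValue_orientedEdge n10 n1 n2 n5 m1, orientedValue_orientedEdge n10 n1 n3 n6 m2,
        orientedValue_orientedEdge n10 n1 n4 n7 m3, orientedValue_orientedEdge n10 n2 n3 n8 m4,
        orientedValue_orientedEdge n10 n2 n4 n9 m5, orientedValue_orientedEdge n10 n3 n4 n10 m6]
      simp [edgeValue, n1, n2, n3, n4, n5, n6, n7, n8, n9, n10, n1.symm, n2.symm, n3.symm, n4.symm,
        n5.symm, n6.symm, n7.symm, n8.symm, n9.symm, n10.symm]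
  rw [map_sub, map_add, map_add] at H
  linear_combination H

/-- On the faces at `i`, the coboundaries of the six edges opposite to `i` are dual to these faces.
Hence `ω` coincides on the pentachoron with the combination having its own values as coefficients,
and `β_t(ω) = 0`. -/
theorem IsEdgeOperators.omega_relation (hE : IsEdgeOperators X ω K β γ)
    (hR : IsRootChoice X ω K q) (hω : ∀ s ∈ X.simplices 2, ω.1 s ≠ 0)
    {i j k l m : ℕ} (hn : [i, j, k, l, m].Nodup)
    (hu : {i, j, k, l, m} ∈ X.simplices 4)
    {t : Finset ℕ} (ht : t ∈ X.simplices 3) (htu : t ⊆ {i, j, k, l, m}) :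
    orientedValue ω.1 i j k * β t (orientedEdge X j k)
      + orientedValue ω.1 i j l * β t (orientedEdge X j l)
      + orientedValue ω.1 i j m * β t (orientedEdge X j m)
      + orientedValue ω.1 i k l * β t (orientedEdge X k l)
      + orientedValue ω.1 i k m * β t (orientedEdge X k m)
      + orientedValue ω.1 i l m * β t (orientedEdge X l m) = 0 := by
  have H : β t (orientedValue ω.1 i j k • orientedEdge X j k
      + orientedValue ω.1 i j l • orientedEdge X j l
      + orientedValue ω.1 i j m • orientedEdge X j m
      + orientedValue ω.1 i k l • orientedEdge X k l
      + orientedValue ω.1 i k m • orientedEdge X k m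
      + orientedValue ω.1 i l m • orientedEdge X l m - ω) = 0 := by
    have hn' := nodup_five_iff.1 hn
    obtain ⟨⟨n1, n2, n3, n4⟩, ⟨n5, n6, n7⟩, ⟨n8, n9⟩, n10⟩ := hn'
    obtain ⟨⟨m1, m2, m3⟩, m4, m5, m6⟩ := cone_mem hn hu
    refine hE.eq_zero_of_cone hR hω hn hu ?_ ?_ ?_ ?_ ?_ ?_ ht htu <;>
    · simp only [Submodule.coe_add, Submodule.coe_sub, Submodule.coe_smul, orientedValue_add,
        orientedValue_sub, orientedValue_smul]
      simp only [orientedValue_orientedEdge_cone n5 n1 n2 n5 n1.symm n2.symm m1,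
        orientedValue_orientedEdge_cone n5 n1 n3 n6 n1.symm n2.symm m2,
        orientedValue_orientedEdge_cone n5 n1 n4 n7 n1.symm n2.symm m3,
        orientedValue_orientedEdge_cone n5 n2 n3 n8 n1.symm n2.symm m4,
        orientedValue_orientedEdge_cone n5 n2 n4 n9 n1.symm n2.symm m5,
        orientedValue_orientedEdge_cone n5 n3 n4 n10 n1.symm n2.symm m6,
        orientedValue_orientedEdge_cone n6 n1 n2 n5 n1.symm n3.symm m1,
        orientedValue_orientedEdge_cone n6 n1 n3 n6 n1.symm n3.symm m2,
        orientedValue_orientedEdge_cone n6 n1 n4 n7 n1.symm n3.symm m3,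
        orientedValue_orientedEdge_cone n6 n2 n3 n8 n1.symm n3.symm m4,
        orientedValue_orientedEdge_cone n6 n2 n4 n9 n1.symm n3.symm m5,
        orientedValue_orientedEdge_cone n6 n3 n4 n10 n1.symm n3.symm m6,
        orientedValue_orientedEdge_cone n7 n1 n2 n5 n1.symm n4.symm m1,
        orientedValue_orientedEdge_cone n7 n1 n3 n6 n1.symm n4.symm m2,
        orientedValue_orientedEdge_cone n7 n1 n4 n7 n1.symm n4.symm m3,
        orientedValue_orientedEdge_cone n7 n2 n3 n8 n1.symm n4.symm m4,
        orientedValue_orientedEdge_cone n7 n2 n4 n9 n1.symm n4.symm m5,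
        orientedValue_orientedEdge_cone n7 n3 n4 n10 n1.symm n4.symm m6,
        orientedValue_orientedEdge_cone n8 n1 n2 n5 n2.symm n3.symm m1,
        orientedValue_orientedEdge_cone n8 n1 n3 n6 n2.symm n3.symm m2,
        orientedValue_orientedEdge_cone n8 n1 n4 n7 n2.symm n3.symm m3,
        orientedValue_orientedEdge_cone n8 n2 n3 n8 n2.symm n3.symm m4,
        orientedValue_orientedEdge_cone n8 n2 n4 n9 n2.symm n3.symm m5,
        orientedValue_orientedEdge_cone n8 n3 n4 n10 n2.symm n3.symm m6,
        orientedValue_orientedEdge_cone n9 n1 n2 n5 n2.symm n4.symm m1,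
        orientedValue_orientedEdge_cone n9 n1 n3 n6 n2.symm n4.symm m2,
        orientedValue_orientedEdge_cone n9 n1 n4 n7 n2.symm n4.symm m3,
        orientedValue_orientedEdge_cone n9 n2 n3 n8 n2.symm n4.symm m4,
        orientedValue_orientedEdge_cone n9 n2 n4 n9 n2.symm n4.symm m5,
        orientedValue_orientedEdge_cone n9 n3 n4 n10 n2.symm n4.symm m6,
        orientedValue_orientedEdge_cone n10 n1 n2 n5 n3.symm n4.symm m1,
        orientedValue_orientedEdge_cone n10 n1 n3 n6 n3.symm n4.symm m2,
        orientedValue_orientedEdge_cone n10 n1 n4 n7 n3.symm n4.symm m3,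
        orientedValue_orientedEdge_cone n10 n2 n3 n8 n3.symm n4.symm m4,
        orientedValue_orientedEdge_cone n10 n2 n4 n9 n3.symm n4.symm m5,
        orientedValue_orientedEdge_cone n10 n3 n4 n10 n3.symm n4.symm m6]
      simp [edgeValue, n5, n6, n7, n8, n9, n10,
        n5.symm, n6.symm, n7.symm, n8.symm, n9.symm, n10.symm]
  simp only [map_sub, map_add, map_smul, smul_eq_mul, (hE.apply_omega hR hω ht).1, sub_zero] at H
  exact H

end PLFermion

/-! ### Dependence of the edge determinant on the order of vertices -/

namespace PLFermion

variable {X : FinComplex} {ω : cocycles X} {K q : Finset ℕ → ℂ}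
  {β γ : Finset ℕ → cocycles X →ₗ[ℂ] ℂ}

/-- The tetrahedra of the pentachoron `ijklm`. -/
def pentTets (i j k l m : ℕ) : Fin 5 → Finset ℕ :=
  ![{j, k, l, m}, {i, k, l, m}, {i, j, l, m}, {i, j, k, m}, {i, j, k, l}]

/-- The edges whose coboundaries are used in `edgeDet`. -/
noncomputable def pentEdges (X : FinComplex) (j k l m : ℕ) : Fin 5 → cocycles X :=
  ![orientedEdge X j l, orientedEdge X l m, orientedEdge X j k, orientedEdge X k m,
    orientedEdge X k l]

theorem edgeDet_eq (β : Finset ℕ → cocycles X →ₗ[ℂ] ℂ) (i j k l m : ℕ) :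
    edgeDet β i j k l m = Matrix.det (Matrix.of fun r s : Fin 5 =>
      β (pentTets i j k l m s) (pentEdges X j k l m r)) := rfl

theorem pentTets_subset (i j k l m : ℕ) (s : Fin 5) :
    pentTets i j k l m s ⊆ {i, j, k, l, m} := by
  fin_cases s <;> · intro x; simp [pentTets]; omega

theorem pentTets_mem {i j k l m : ℕ} (hn : [i, j, k, l, m].Nodup)
    (hu : {i, j, k, l, m} ∈ X.simplices 4) (s : Fin 5) :
    pentTets i j k l m s ∈ X.simplices 3 := by
  obtain ⟨m1, m2, m3, m4, m5⟩ := quadruple_mem hn hu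
  fin_cases s <;> assumption

/-- The common pattern of the four adjacent transpositions: the tetrahedra (columns) are permuted by
`σ`, and the new edges (rows) are combinations of the old ones with coefficients `T`. -/
theorem det_eq_of_relations (tets tets' : Fin 5 → Finset ℕ) (rows rows' : Fin 5 → cocycles X)
    (T : Matrix (Fin 5) (Fin 5) ℂ) (σ : Equiv.Perm (Fin 5)) (hσ : ∀ s, tets' s = tets (σ s))
    (hT : ∀ s r, β (tets s) (rows' r) = ∑ x, T r x * β (tets s) (rows x)) :
    Matrix.det (Matrix.of fun r s : Fin 5 => β (tets' s) (rows' r)) =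
      (Equiv.Perm.sign σ : ℤ) * (T.det *
        Matrix.det (Matrix.of fun r s : Fin 5 => β (tets s) (rows r))) := by
  rw [← Matrix.det_mul, ← Matrix.det_permute']
  congr 1
  ext r s
  simp only [Matrix.of_apply, Matrix.submatrix_apply, id_eq, Matrix.mul_apply, hσ, hT]

/-- The new edges `il` and `ik` are eliminated by the relations at the vertices `l` and `k`; the row
transformation is unimodular, and the sign comes from the exchanged columns. -/
theorem edgeDet_swap₁₂ (hE : IsEdgeOperators X ω K β γ)
    (hR : IsRootChoice X ω K q) (hω : ∀ s ∈ X.simplices 2, ω.1 s ≠ 0)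
    {i j k l m : ℕ} (hn : [i, j, k, l, m].Nodup) (hu : {i, j, k, l, m} ∈ X.simplices 4) :
    edgeDet β j i k l m = -edgeDet β i j k l m := by
  rw [edgeDet_eq, edgeDet_eq, det_eq_of_relations (pentTets i j k l m) _ (pentEdges X j k l m) _
    !![-1, 1, 0, 0, -1; 0, 1, 0, 0, 0; 0, 0, -1, 1, 1; 0, 0, 0, 1, 0; 0, 0, 0, 0, 1]
    (Equiv.swap 0 1)]
  · rw [← edgeDet_eq, Equiv.Perm.sign_swap (by decide)]
    simp [Matrix.det_succ_row_zero, Fin.sum_univ_succ, Fin.succAbove]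
  · intro s
    fin_cases s
    · rfl
    · rfl
    all_goals exact Finset.insert_comm _ _ _
  · intro s r
    have h1 := hE.vertex_relation hR hω hn hu (pentTets_mem hn hu s) (pentTets_subset _ _ _ _ _ s)
    have hn' : [i, j, l, k, m].Nodup := by rw [nodup_five_iff] at hn ⊢; omega
    have hp : ({i, j, l, k, m} : Finset ℕ) = {i, j, k, l, m} := by rw [Finset.insert_comm l k]
    have h2 := hE.vertex_relation hR hω hn' (hp ▸ hu) (pentTets_mem hn hu s)
      (hp ▸ pentTets_subset _ _ _ _ _ s)
    have hkl : k ≠ l := (nodup_five_iff.1 hn).2.2.1.1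
    rw [orientedEdge_swap X hkl, map_neg] at h2
    fin_cases r <;> simp [pentEdges, Fin.sum_univ_succ, h1, h2] <;> ring

/-- The only new edge is `jm`, and the relation for `ω` expresses it with the denominator `ω_{ijm}`.
-/
theorem edgeDet_swap₂₃ (hE : IsEdgeOperators X ω K β γ)
    (hR : IsRootChoice X ω K q) (hω : ∀ s ∈ X.simplices 2, ω.1 s ≠ 0)
    {i j k l m : ℕ} (hn : [i, j, k, l, m].Nodup) (hu : {i, j, k, l, m} ∈ X.simplices 4) :
    edgeDet β i k j l m =
      orientedValue ω.1 i k m / orientedValue ω.1 i j m * edgeDet β i j k l m := by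
  have h0 : orientedValue ω.1 i j m ≠ 0 := orientedValue_ne_zero (hω _ (cone_mem hn hu).1.2.2)
  rw [edgeDet_eq, edgeDet_eq, det_eq_of_relations (pentTets i j k l m) _ (pentEdges X j k l m) _
    !![0, 0, 0, 0, 1; 0, 1, 0, 0, 0; 0, 0, -1, 0, 0;
      -(orientedValue ω.1 i j l / orientedValue ω.1 i j m),
      -(orientedValue ω.1 i l m / orientedValue ω.1 i j m),
      -(orientedValue ω.1 i j k / orientedValue ω.1 i j m),
      -(orientedValue ω.1 i k m / orientedValue ω.1 i j m),
      -(orientedValue ω.1 i k l / orientedValue ω.1 i j m);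
      1, 0, 0, 0, 0] (Equiv.swap 1 2)]
  · rw [← edgeDet_eq, Equiv.Perm.sign_swap (by decide)]
    simp [Matrix.det_succ_row_zero, Fin.sum_univ_succ, Fin.succAbove]
    left; ring
  · intro s
    fin_cases s
    · exact Finset.insert_comm _ _ _
    · rfl
    · rfl
    all_goals exact congrArg (insert i) (Finset.insert_comm _ _ _)
  · intro s r
    have h1 := hE.omega_relation hR hω hn hu (pentTets_mem hn hu s) (pentTets_subset _ _ _ _ _ s)
    have hjk : j ≠ k := (nodup_five_iff.1 hn).2.1.1
    fin_cases r <;> simp [pentEdges, Fin.sum_univ_succ, orientedEdge_swap X hjk]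
    field_simp
    linear_combination h1

theorem edgeDet_swap₃₄ (β : Finset ℕ → cocycles X →ₗ[ℂ] ℂ)
    {i j k l m : ℕ} (hn : [i, j, k, l, m].Nodup) :
    edgeDet β i j l k m = edgeDet β i j k l m := by
  rw [edgeDet_eq, edgeDet_eq, det_eq_of_relations (pentTets i j k l m) _ (pentEdges X j k l m) _
    !![0, 0, 1, 0, 0; 0, 0, 0, 1, 0; 1, 0, 0, 0, 0; 0, 1, 0, 0, 0; 0, 0, 0, 0, -1]
    (Equiv.swap 2 3)]
  · rw [← edgeDet_eq, Equiv.Perm.sign_swap (by decide)]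
    simp [Matrix.det_succ_row_zero, Fin.sum_univ_succ, Fin.succAbove]
  · intro s
    fin_cases s
    · exact congrArg (insert j) (Finset.insert_comm _ _ _)
    · exact congrArg (insert i) (Finset.insert_comm _ _ _)
    · rfl
    · rfl
    · exact congrArg (fun s => insert i (insert j s)) (Finset.pair_comm _ _)
  · intro s r
    have hkl : k ≠ l := (nodup_five_iff.1 hn).2.2.1.1
    fin_cases r <;> simp [pentEdges, Fin.sum_univ_succ, orientedEdge_swap X hkl]

/-- Again `jm` is the only new edge; it now replaces `jl`, whose coefficient in the relation gives
the factor. -/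
theorem edgeDet_swap₄₅ (hE : IsEdgeOperators X ω K β γ)
    (hR : IsRootChoice X ω K q) (hω : ∀ s ∈ X.simplices 2, ω.1 s ≠ 0)
    {i j k l m : ℕ} (hn : [i, j, k, l, m].Nodup) (hu : {i, j, k, l, m} ∈ X.simplices 4) :
    edgeDet β i j k m l =
      orientedValue ω.1 i j l / orientedValue ω.1 i j m * edgeDet β i j k l m := by
  have h0 : orientedValue ω.1 i j m ≠ 0 := orientedValue_ne_zero (hω _ (cone_mem hn hu).1.2.2)
  rw [edgeDet_eq, edgeDet_eq, det_eq_of_relations (pentTets i j k l m) _ (pentEdges X j k l m) _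
    !![-(orientedValue ω.1 i j l / orientedValue ω.1 i j m),
      -(orientedValue ω.1 i l m / orientedValue ω.1 i j m),
      -(orientedValue ω.1 i j k / orientedValue ω.1 i j m),
      -(orientedValue ω.1 i k m / orientedValue ω.1 i j m),
      -(orientedValue ω.1 i k l / orientedValue ω.1 i j m);
      0, -1, 0, 0, 0; 0, 0, 1, 0, 0; 0, 0, 0, 0, 1; 0, 0, 0, 1, 0] (Equiv.swap 3 4)]
  · rw [← edgeDet_eq, Equiv.Perm.sign_swap (by decide)]
    simp [Matrix.det_succ_row_zero, Fin.sum_univ_succ, Fin.succAbove]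
  · intro s
    fin_cases s
    · exact congrArg (fun s => insert j (insert k s)) (Finset.pair_comm _ _)
    · exact congrArg (fun s => insert i (insert k s)) (Finset.pair_comm _ _)
    · exact congrArg (fun s => insert i (insert j s)) (Finset.pair_comm _ _)
    · rfl
    · rfl
  · intro s r
    have h1 := hE.omega_relation hR hω hn hu (pentTets_mem hn hu s) (pentTets_subset _ _ _ _ _ s)
    have hlm : l ≠ m := (nodup_five_iff.1 hn).2.2.2
    fin_cases r <;> simp [pentEdges, Fin.sum_univ_succ, orientedEdge_swap X hlm]
    field_simp
    linear_combination h1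

/-- The determinant `edgeDet`, normalized by `ω`, depends only on the set of vertices of the
pentachoron. -/
theorem edgeDet_div_eq (hE : IsEdgeOperators X ω K β γ)
    (hR : IsRootChoice X ω K q) (hω : ∀ s ∈ X.simplices 2, ω.1 s ≠ 0)
    {u : Finset ℕ} (hu : u ∈ X.simplices 4) (hc : u.card = 5) :
    ∀ i j k l m : ℕ, [i, j, k, l, m].Nodup → u = {i, j, k, l, m} →
    edgeDet β i j k l m / orientedValue ω.1 i j m =
      edgeDet β (u.orderEmbOfFin hc 0) (u.orderEmbOfFin hc 1) (u.orderEmbOfFin hc 2)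
        (u.orderEmbOfFin hc 3) (u.orderEmbOfFin hc 4) /
        orientedValue ω.1 (u.orderEmbOfFin hc 0) (u.orderEmbOfFin hc 1) (u.orderEmbOfFin hc 4) := by
  refine forall_quintuple_of_increasing ?_ ?_ ?_ ?_ ?_
  · intro a b c d e hab hbc hcd hde h
    -- The reference order is the increasing one, for which both sides coincide literally.
    have hf : (![a, b, c, d, e] : Fin 5 → ℕ) = u.orderEmbOfFin hc := by
      refine Finset.orderEmbOfFin_unique hc ?_ ?_
      · intro x
        rw [h]
        fin_cases x <;> simp
      · refine Fin.strictMono_iff_lt_succ.2 fun x => ?_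
        fin_cases x <;> simpa
    rw [← hf]
    rfl
  · intro i j k l m hn H h
    have h' : u = {i, j, k, l, m} := by rw [h, Finset.insert_comm]
    rw [← H h', edgeDet_swap₁₂ hE hR hω hn (h' ▸ hu),
      orientedValue_swap₁₂ _ _ (nodup_five_iff.1 hn).1.1, neg_div_neg_eq]
  · intro i j k l m hn H h
    have h' : u = {i, j, k, l, m} := by rw [h, Finset.insert_comm k j]
    have hn' : [i, k, j, l, m].Nodup := by rw [nodup_five_iff] at hn ⊢; omega
    have h1 := orientedValue_ne_zero (hω _ (cone_mem hn' (h ▸ hu)).1.2.2)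
    rw [← H h', edgeDet_swap₂₃ hE hR hω hn (h' ▸ hu)]
    field_simp
  · intro i j k l m hn H h
    have h' : u = {i, j, k, l, m} := by rw [h, Finset.insert_comm l k]
    rw [← H h', edgeDet_swap₃₄ β hn]
  · intro i j k l m hn H h
    have h' : u = {i, j, k, l, m} := by rw [h, Finset.pair_comm m l]
    have hn' : [i, j, k, m, l].Nodup := by rw [nodup_five_iff] at hn ⊢; omega
    have h1 := orientedValue_ne_zero (hω _ (cone_mem hn' (h ▸ hu)).1.2.2)
    rw [← H h', edgeDet_swap₄₅ hE hR hω hn (h' ▸ hu)]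
    field_simp

/-! ## The pentachoron matrix -/

variable {ε : ℤ} {F : Finset ℕ → Finset ℕ → ℂ}

theorem sum_quintuple {i j k l m : ℕ} (hn : [i, j, k, l, m].Nodup) (f : ℕ → ℂ) :
    ∑ v ∈ {i, j, k, l, m}, f v = f i + f j + f k + f l + f m := by
  rw [nodup_five_iff] at hn
  rw [Finset.sum_insert (by simp; omega), Finset.sum_insert (by simp; omega),
    Finset.sum_insert (by simp; omega), Finset.sum_insert (by simp; omega), Finset.sum_singleton]
  ring

theorem IsPentachoronMatrix.annihilates_quintuple {i j k l m : ℕ}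
    (hF : IsPentachoronMatrix X β γ ε {i, j, k, l, m} F) (hn : [i, j, k, l, m].Nodup)
    (c : cocycles X) {w : ℕ} (hw : w ∈ ({i, j, k, l, m} : Finset ℕ)) :
    ∑ s, β (pentTets i j k l m s) c * F (pentTets i j k l m s) (({i, j, k, l, m} : Finset ℕ).erase w)
      = ε * sgn {i, j, k, l, m} w * γ (({i, j, k, l, m} : Finset ℕ).erase w) c := by
  obtain ⟨e1, e2, e3, e4, e5⟩ := erase_quintuple hn
  rw [← hF.annihilates c w hw, sum_quintuple hn, e1, e2, e3, e4, e5]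
  simp [Fin.sum_univ_succ, pentTets]
  ring

theorem tupleSign_eq (i j k l m : ℕ) : (tupleSign ![i, j, k, l, m] : ℂ) =
    pairSign i j * pairSign i k * pairSign i l * pairSign i m * pairSign j k * pairSign j l *
      pairSign j m * pairSign k l * pairSign k m * pairSign l m := by
  have h0 : (Finset.Ioi (0 : Fin 5)) = {1, 2, 3, 4} := by decide
  have h1 : (Finset.Ioi (1 : Fin 5)) = {2, 3, 4} := by decide
  have h2 : (Finset.Ioi (2 : Fin 5)) = {3, 4} := by decide
  have h3 : (Finset.Ioi (3 : Fin 5)) = {4} := by decide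
  have h4 : (Finset.Ioi (4 : Fin 5)) = ∅ := by decide
  have h (v : Fin 5 → ℕ) :
      (tupleSign v : ℂ) = ∏ a : Fin 5, ∏ b ∈ Finset.Ioi a, pairSign (v a) (v b) := by
    unfold tupleSign
    rw [Int.cast_prod]
    refine Finset.prod_congr rfl fun a _ => ?_
    rw [Int.cast_prod]
    refine Finset.prod_congr rfl fun b _ => ?_
    unfold pairSign; split_ifs <;> simp
  simp only [h, Fin.prod_univ_five, h0, h1, h2, h3, h4,
    Finset.prod_insert (show (1 : Fin 5) ∉ ({2, 3, 4} : Finset (Fin 5)) by decide),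
    Finset.prod_insert (show (2 : Fin 5) ∉ ({3, 4} : Finset (Fin 5)) by decide),
    Finset.prod_pair (show (3 : Fin 5) ≠ 4 by decide), Finset.prod_singleton, Finset.prod_empty]
  simp only [Matrix.cons_val]
  ring

/-- If all components of `∂_t` and `ϑ_t` vanish, then the cocycle is proportional to `ω`. -/
theorem IsEdgeOperators.orientedDet_eq_zero (hE : IsEdgeOperators X ω K β γ)
    (hR : IsRootChoice X ω K q) (hω : ∀ s ∈ X.simplices 2, ω.1 s ≠ 0)
    {a b d e : ℕ} (hn : [a, b, d, e].Nodup) (ht : {a, b, d, e} ∈ X.simplices 3) {c : cocycles X}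
    (hβ : β {a, b, d, e} c = 0) (hγ : γ {a, b, d, e} c = 0) (c' : cocycles X) :
    orientedDet c.1 c'.1 ω.1 a b d e = 0 := by
  have hK := hR.ne_zero hω hn ht
  rw [nodup_four_iff] at hn
  obtain ⟨⟨h1, h2, h3⟩, ⟨h4, h5⟩, h6⟩ := hn
  have := hE.oriented_branch c c' a b d e h1 h2 h3 h4 h5 h6 ht
  rw [hβ, hγ, zero_mul, mul_zero, sub_zero] at this
  exact (div_eq_zero_iff.1 this.symm).resolve_right hK

/-- A cocycle that vanishes on one face of a tetrahedron, and has no component in it, vanishes on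
the tetrahedron. -/
theorem IsEdgeOperators.restrict_eq_zero (hE : IsEdgeOperators X ω K β γ)
    (hR : IsRootChoice X ω K q) (hω : ∀ s ∈ X.simplices 2, ω.1 s ≠ 0)
    {a b d e : ℕ} (hn : [a, b, d, e].Nodup) (ht : {a, b, d, e} ∈ X.simplices 3) {c : cocycles X}
    (hβ : β {a, b, d, e} c = 0) (hγ : γ {a, b, d, e} c = 0) (h0 : orientedValue c.1 a b e = 0) :
    orientedValue c.1 b d e = 0 ∧ orientedValue c.1 a d e = 0 ∧ orientedValue c.1 a b d = 0 := by
  -- Given the zero on `abe`, testing with `bd` isolates the value on `ade`, and then testing with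
  -- `de` isolates the one on `bde`.
  have d1 := hE.orientedDet_eq_zero hR hω hn ht hβ hγ (orientedEdge X b d)
  have d2 := hE.orientedDet_eq_zero hR hω hn ht hβ hγ (orientedEdge X d e)
  obtain ⟨m1, m2, m3, m4⟩ := triple_mem hn ht
  have hx := orientedValue_ne_zero (hω _ m3)
  rw [nodup_four_iff] at hn
  obtain ⟨⟨h1, h2, h3⟩, ⟨h4, h5⟩, h6⟩ := hn
  have e1 := (orientedValue_orientedEdge_self h4 h5 h6 m1).1
  have e2 := (orientedValue_orientedEdge_self h4 h5 h6 m1).2.2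
  have e3 := (orientedValue_orientedEdge_self h2 h3 h6 m2).2.2
  have z1 : orientedValue (orientedEdge X b d).1 a d e = 0 :=
    orientedValue_orientedEdge_eq_zero (pair_not_subset_left (by simp; omega))
  have z2 : orientedValue (orientedEdge X b d).1 a b e = 0 :=
    orientedValue_orientedEdge_eq_zero (pair_not_subset_right (by simp; omega))
  have z3 : orientedValue (orientedEdge X d e).1 a b e = 0 :=
    orientedValue_orientedEdge_eq_zero (pair_not_subset_left (by simp; omega))
  unfold orientedDet at d1 d2
  rw [e1, z1, z2, h0] at d1
  rw [e2, e3, z3, h0] at d2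
  have g1 : orientedValue c.1 a d e = 0 :=
    (mul_eq_zero.1 (show orientedValue c.1 a d e * orientedValue ω.1 a b e = 0 by
      linear_combination -d1)).resolve_right hx
  rw [g1] at d2
  have g2 : orientedValue c.1 b d e = 0 :=
    (mul_eq_zero.1 (show orientedValue c.1 b d e * orientedValue ω.1 a b e = 0 by
      linear_combination d2)).resolve_right hx
  have := orientedValue_cocycle c a b d e h1 h2 h3 h4 h5 h6 ht
  exact ⟨g2, g1, by linear_combination -this + g2 - g1 + h0⟩

end PLFermion

/-! ### Nondegeneracy of the edge determinant and a formula for the pentachoron factor -/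

namespace PLFermion

variable {X : FinComplex} {ω : cocycles X} {K q : Finset ℕ → ℂ}
  {β γ : Finset ℕ → cocycles X →ₗ[ℂ] ℂ} {ε : ℤ} {F : Finset ℕ → Finset ℕ → ℂ}

/-- The values of a combination of the edges used in `edgeDet`. -/
theorem orientedValue_sum_pentEdges {i j k l m : ℕ} (hn : [i, j, k, l, m].Nodup)
    (hu : {i, j, k, l, m} ∈ X.simplices 4) (y : Fin 5 → ℂ) {c : cocycles X}
    (hc : c = ∑ r, y r • pentEdges X j k l m r) :
    orientedValue c.1 i j m = 0 ∧ orientedValue c.1 i j l = y 0 ∧ orientedValue c.1 i l m = y 1 ∧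
      orientedValue c.1 i j k = y 2 ∧ orientedValue c.1 i k m = y 3 ∧
      orientedValue c.1 i k l = y 4 := by
  have hn' := nodup_five_iff.1 hn
  obtain ⟨⟨n1, n2, n3, n4⟩, ⟨n5, n6, n7⟩, ⟨n8, n9⟩, n10⟩ := hn'
  obtain ⟨⟨m1, m2, m3⟩, m4, m5, m6⟩ := cone_mem hn hu
  have hc' : c.1 = y 0 • (orientedEdge X j l).1 + y 1 • (orientedEdge X l m).1
      + y 2 • (orientedEdge X j k).1 + y 3 • (orientedEdge X k m).1
      + y 4 • (orientedEdge X k l).1 := by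
    rw [hc, Fin.sum_univ_five]
    rfl
  have cone : ∀ x z : ℕ, i ≠ x → i ≠ z → x ≠ z → {i, x, z} ∈ X.simplices 2 →
      orientedValue c.1 i x z = y 0 * edgeValue j l x z + y 1 * edgeValue l m x z
        + y 2 * edgeValue j k x z + y 3 * edgeValue k m x z + y 4 * edgeValue k l x z := by
    intro x z hx hz hxz hs
    rw [hc']
    simp only [orientedValue_add, orientedValue_smul]
    rw [orientedValue_orientedEdge_cone n6 hx hz hxz n1.symm n3.symm hs,
      orientedValue_orientedEdge_cone n10 hx hz hxz n3.symm n4.symm hs,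
      orientedValue_orientedEdge_cone n5 hx hz hxz n1.symm n2.symm hs,
      orientedValue_orientedEdge_cone n9 hx hz hxz n2.symm n4.symm hs,
      orientedValue_orientedEdge_cone n8 hx hz hxz n2.symm n3.symm hs]
  rw [cone j m n1 n4 n7 m3, cone j l n1 n3 n6 m2, cone l m n3 n4 n10 m6, cone j k n1 n2 n5 m1,
    cone k m n2 n4 n9 m5, cone k l n2 n3 n8 m4]
  simp [edgeValue, n5, n6, n7, n8, n9, n10, n5.symm, n6.symm, n7.symm, n8.symm, n9.symm, n10.symm]

/-- In a pentachoron whose matrix exists, the components of `∂_t` are coordinates on the space of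
cocycles modulo `ω`. -/
theorem IsPentachoronMatrix.edgeDet_ne_zero (hE : IsEdgeOperators X ω K β γ)
    (hR : IsRootChoice X ω K q) (hω : ∀ s ∈ X.simplices 2, ω.1 s ≠ 0)
    {i j k l m : ℕ} (hn : [i, j, k, l, m].Nodup) (hu : {i, j, k, l, m} ∈ X.simplices 4)
    (hF : IsPentachoronMatrix X β γ ε {i, j, k, l, m} F) (hε : ε ≠ 0) :
    edgeDet β i j k l m ≠ 0 := by
  rw [edgeDet_eq]
  intro hdet
  obtain ⟨y, hy0, hy⟩ := Matrix.exists_vecMul_eq_zero_iff.2 hdet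
  refine hy0 ?_
  -- A row dependence is a combination of the five edges annihilated by all `β`; the matrix `F` then
  -- makes all `γ` vanish on it as well.
  obtain ⟨c, hc⟩ : ∃ c, c = ∑ r, y r • pentEdges X j k l m r := ⟨_, rfl⟩
  have hβ : ∀ s, β (pentTets i j k l m s) c = 0 := by
    intro s
    have := congrFun hy s
    simp only [Matrix.vecMul, dotProduct, Matrix.of_apply, Pi.zero_apply] at this
    rw [hc, map_sum, ← this]
    simp only [map_smul, smul_eq_mul]
  have hγ : ∀ w ∈ ({i, j, k, l, m} : Finset ℕ),
      γ (({i, j, k, l, m} : Finset ℕ).erase w) c = 0 := by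
    intro w hw
    have := hF.annihilates_quintuple hn c hw
    rw [Finset.sum_eq_zero (fun s _ => by rw [hβ s, zero_mul])] at this
    refine (mul_eq_zero.1 this.symm).resolve_left (mul_ne_zero (by exact_mod_cast hε) ?_)
    exact left_ne_zero_of_mul_eq_one (sgn_sq _ _)
  obtain ⟨e1, e2, e3, e4, e5⟩ := erase_quintuple hn
  obtain ⟨m1, m2, m3, m4, m5⟩ := quadruple_mem hn hu
  have g3 := hγ k (by simp)
  have g4 := hγ l (by simp)
  have g5 := hγ m (by simp)
  rw [e3] at g3; rw [e4] at g4; rw [e5] at g5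
  obtain ⟨v1, v2, v3, v4, v5, v6⟩ := orientedValue_sum_pentEdges hn hu y hc
  have n3 : [i, j, l, m].Nodup := by rw [nodup_five_iff] at hn; rw [nodup_four_iff]; omega
  have n4 : [i, j, k, m].Nodup := by rw [nodup_five_iff] at hn; rw [nodup_four_iff]; omega
  have n5 : [i, j, k, l].Nodup := by rw [nodup_five_iff] at hn; rw [nodup_four_iff]; omega
  -- Vanishing spreads from `ijm`, which none of the five edges sees, to `ijlm` and `ijkm`, and from
  -- the face `ijl` on to `ijkl`; the coefficients are the values on the other faces at `i`.
  have r3 := hE.restrict_eq_zero hR hω n3 m3 (hβ 2) g3 v1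
  have r4 := hE.restrict_eq_zero hR hω n4 m4 (hβ 3) g4 v1
  have r5 := hE.restrict_eq_zero hR hω n5 m5 (hβ 4) g5 r3.2.2
  funext r
  fin_cases r
  · exact v2.symm.trans r3.2.2
  · exact v3.symm.trans r3.2.1
  · exact v4.symm.trans r4.2.2
  · exact v5.symm.trans r4.2.1
  · exact v6.symm.trans r5.2.1

/-- The last row leaves only the entry `B 4 4`; in the rest, rows 0, 1 live in columns 0, 2 and rows
2, 3 in columns 1, 3. The sign is that of the exchange of columns 1 and 2. -/
theorem det_five_of_zeros (B : Matrix (Fin 5) (Fin 5) ℂ)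
    (h01 : B 0 1 = 0) (h03 : B 0 3 = 0) (h11 : B 1 1 = 0) (h13 : B 1 3 = 0)
    (h20 : B 2 0 = 0) (h22 : B 2 2 = 0) (h30 : B 3 0 = 0) (h32 : B 3 2 = 0)
    (h40 : B 4 0 = 0) (h41 : B 4 1 = 0) (h42 : B 4 2 = 0) (h43 : B 4 3 = 0) :
    B.det = -((B 0 0 * B 1 2 - B 0 2 * B 1 0) * (B 2 1 * B 3 3 - B 2 3 * B 3 1) * B 4 4) := by
  have h : B = !![B 0 0, 0, B 0 2, 0, B 0 4; B 1 0, 0, B 1 2, 0, B 1 4;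
      0, B 2 1, 0, B 2 3, B 2 4; 0, B 3 1, 0, B 3 3, B 3 4; 0, 0, 0, 0, B 4 4] := by
    ext r s
    fin_cases r <;> fin_cases s <;> simp [*]
  rw [h]
  simp [Matrix.det_succ_row_zero, Fin.sum_univ_succ, Fin.succAbove]
  ring

theorem sgn_quintuple₃ {i j k l m : ℕ} (hn : [i, j, k, l, m].Nodup) :
    (sgn {i, j, k, l, m} k : ℂ) =
      pairSign i k * pairSign j k * pairSign k l * pairSign k m := by
  rw [sgn_eq_prod_pairSign, (erase_quintuple hn).2.2.1]
  rw [nodup_five_iff] at hn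
  rw [prod_quadruple (by omega) (by omega) (by omega) (by omega) (by omega) (by omega),
    pairSign_swap hn.1.2.1, pairSign_swap hn.2.1.1]
  ring

theorem sgn_quintuple₄ {i j k l m : ℕ} (hn : [i, j, k, l, m].Nodup) :
    (sgn {i, j, k, l, m} l : ℂ) =
      -(pairSign i l * pairSign j l * pairSign k l * pairSign l m) := by
  rw [sgn_eq_prod_pairSign, (erase_quintuple hn).2.2.2.1]
  rw [nodup_five_iff] at hn
  rw [prod_quadruple (by omega) (by omega) (by omega) (by omega) (by omega) (by omega),
    pairSign_swap hn.1.2.2.1, pairSign_swap hn.2.1.2.1, pairSign_swap hn.2.2.1.1]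
  ring

theorem IsEdgeOperators.apply_orientedEdge_eq_zero (hE : IsEdgeOperators X ω K β γ)
    (hR : IsRootChoice X ω K q) (hω : ∀ s ∈ X.simplices 2, ω.1 s ≠ 0) {t : Finset ℕ}
    (ht : t ∈ X.simplices 3) {a b : ℕ} (h : ¬({a, b} : Finset ℕ) ⊆ t) :
    β t (orientedEdge X a b) = 0 ∧ γ t (orientedEdge X a b) = 0 :=
  hE.eq_zero_of_restrict hR hω ht fun _ hs _ =>
    orientedEdge_apply_eq_zero fun h' => h (h'.trans hs)

/-- The denominator in the pentachoron factor, in terms of `edgeDet`. -/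
theorem IsPentachoronMatrix.denominator_mul_edgeDet (hE : IsEdgeOperators X ω K β γ)
    (hR : IsRootChoice X ω K q) (hω : ∀ s ∈ X.simplices 2, ω.1 s ≠ 0)
    {i j k l m : ℕ} (hn : [i, j, k, l, m].Nodup) (hu : {i, j, k, l, m} ∈ X.simplices 4)
    (hF : IsPentachoronMatrix X β γ ε {i, j, k, l, m} F)
    (hε : tupleSign ![i, j, k, l, m] = ε) :
    (F {i, k, l, m} {i, j, k, m} * F {j, k, l, m} {i, j, l, m}
      - F {i, k, l, m} {i, j, l, m} * F {j, k, l, m} {i, j, k, m}) * edgeDet β i j k l m *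
        (K {i, j, l, m} * K {i, j, k, m}) =
      quadSign i j l m * quadSign i j k m * orientedValue ω.1 i j m ^ 2 *
        β {i, j, k, l} (orientedEdge X k l) := by
  obtain ⟨e1, e2, e3, e4, e5⟩ := erase_quintuple hn
  obtain ⟨m1, m2, m3, m4, m5⟩ := quadruple_mem hn hu
  have n3 : [i, j, l, m].Nodup := by rw [nodup_five_iff] at hn; rw [nodup_four_iff]; omega
  have n4 : [i, j, k, m].Nodup := by rw [nodup_five_iff] at hn; rw [nodup_four_iff]; omega
  have w3 := hE.wedge_path n3 m3
  have w4 := hE.wedge_path n4 m4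
  have k3 := hR.ne_zero hω n3 m3
  have k4 := hR.ne_zero hω n4 m4
  -- Induced orientations: for the order `ijklm`, omitting `k` (an even position, counted from zero)
  -- preserves the sign, and omitting `l` reverses it.
  have s3 : (ε : ℂ) * (sgn {i, j, k, l, m} k : ℂ) = quadSign i j l m := by
    rw [sgn_quintuple₃ hn, ← hε, tupleSign_eq]
    unfold quadSign
    calc _ = (pairSign i k ^ 2 * pairSign j k ^ 2 * pairSign k l ^ 2 * pairSign k m ^ 2) *
        (pairSign i j * pairSign i l * pairSign i m * pairSign j l * pairSign j m * pairSign l m) := by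
          ring
      _ = _ := by simp only [pairSign_sq]; ring
  have s4 : (ε : ℂ) * (sgn {i, j, k, l, m} l : ℂ) = -quadSign i j k m := by
    rw [sgn_quintuple₄ hn, ← hε, tupleSign_eq]
    unfold quadSign
    calc _ = -(pairSign i l ^ 2 * pairSign j l ^ 2 * pairSign k l ^ 2 * pairSign l m ^ 2) *
        (pairSign i j * pairSign i k * pairSign i m * pairSign j k * pairSign j m * pairSign k m) := by
          ring
      _ = _ := by simp only [pairSign_sq]; ring
  have a3 : ∀ c, ∑ s, β (pentTets i j k l m s) c * F (pentTets i j k l m s) {i, j, l, m} =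
      quadSign i j l m * γ {i, j, l, m} c := by
    intro c
    have := hF.annihilates_quintuple hn c (w := k) (by simp)
    rwa [e3, s3] at this
  have a4 : ∀ c, ∑ s, β (pentTets i j k l m s) c * F (pentTets i j k l m s) {i, j, k, m} =
      -quadSign i j k m * γ {i, j, k, m} c := by
    intro c
    have := hF.annihilates_quintuple hn c (w := l) (by simp)
    rwa [e4, s4] at this
  set f : Fin 5 → Fin 5 → ℂ := fun a b => F (pentTets i j k l m a) (pentTets i j k l m b) with hf
  set A : Matrix (Fin 5) (Fin 5) ℂ := Matrix.of fun r s =>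
    β (pentTets i j k l m s) (pentEdges X j k l m r) with hA
  -- Right multiplication by `N` replaces the `β`-columns of `jklm` and `iklm` by the columns of `γ`
  -- for `ijlm` and `ijkm`, up to signs; `det N` is precisely the denominator of `H_u`.
  set N : Matrix (Fin 5) (Fin 5) ℂ := !![f 0 2, f 0 3, 0, 0, 0; f 1 2, f 1 3, 0, 0, 0;
    f 2 2, f 2 3, 1, 0, 0; f 3 2, f 3 3, 0, 1, 0; f 4 2, f 4 3, 0, 0, 1] with hN
  have hdetN : N.det = F {i, k, l, m} {i, j, k, m} * F {j, k, l, m} {i, j, l, m}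
      - F {i, k, l, m} {i, j, l, m} * F {j, k, l, m} {i, j, k, m} := by
    have : N.det = f 1 3 * f 0 2 - f 1 2 * f 0 3 := by
      rw [hN]
      simp [Matrix.det_succ_row_zero, Fin.sum_univ_succ, Fin.succAbove]
      ring
    rw [this]
    rfl
  have c0 : ∀ r, (A * N) r 0 = quadSign i j l m * γ {i, j, l, m} (pentEdges X j k l m r) := by
    intro r
    rw [← a3, Matrix.mul_apply, Fin.sum_univ_five, Fin.sum_univ_five]
    rfl
  have c1 : ∀ r, (A * N) r 1 = -quadSign i j k m * γ {i, j, k, m} (pentEdges X j k l m r) := by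
    intro r
    rw [← a4, Matrix.mul_apply, Fin.sum_univ_five, Fin.sum_univ_five]
    rfl
  have c2 : ∀ r, (A * N) r 2 = β {i, j, l, m} (pentEdges X j k l m r) := by
    intro r
    rw [Matrix.mul_apply, Fin.sum_univ_five]
    simp [hN, hA, pentTets]
  have c3 : ∀ r, (A * N) r 3 = β {i, j, k, m} (pentEdges X j k l m r) := by
    intro r
    rw [Matrix.mul_apply, Fin.sum_univ_five]
    simp [hN, hA, pentTets]
  have c4 : ∀ r, (A * N) r 4 = β {i, j, k, l} (pentEdges X j k l m r) := by
    intro r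
    rw [Matrix.mul_apply, Fin.sum_univ_five]
    simp [hN, hA, pentTets]
  have hn' := nodup_five_iff.1 hn
  have nk : k ∉ ({i, j, l, m} : Finset ℕ) := by simp; omega
  have nl : l ∉ ({i, j, k, m} : Finset ℕ) := by simp; omega
  have z31 := hE.apply_orientedEdge_eq_zero hR hω m3 (pair_not_subset_right (a := j) nk)
  have z32 := hE.apply_orientedEdge_eq_zero hR hω m3 (pair_not_subset_left (b := m) nk)
  have z33 := hE.apply_orientedEdge_eq_zero hR hω m3 (pair_not_subset_left (b := l) nk)
  have z41 := hE.apply_orientedEdge_eq_zero hR hω m4 (pair_not_subset_right (a := j) nl)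
  have z42 := hE.apply_orientedEdge_eq_zero hR hω m4 (pair_not_subset_left (b := m) nl)
  have z43 := hE.apply_orientedEdge_eq_zero hR hω m4 (pair_not_subset_right (a := k) nl)
  -- Edges with the vertex `k` have no components in `ijlm`, and those with `l` have none in `ijkm`.
  -- What remains is the antisymmetric forms for the paths `jlm` and `jkm`, and the component of
  -- `kl` in `ijkl`.
  have hdet := det_five_of_zeros (A * N)
    ((c1 0).trans (by rw [show pentEdges X j k l m 0 = orientedEdge X j l from rfl, z41.2, mul_zero]))
    ((c3 0).trans z41.1)
    ((c1 1).trans (by rw [show pentEdges X j k l m 1 = orientedEdge X l m from rfl, z42.2, mul_zero]))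
    ((c3 1).trans z42.1)
    ((c0 2).trans (by rw [show pentEdges X j k l m 2 = orientedEdge X j k from rfl, z31.2, mul_zero]))
    ((c2 2).trans z31.1)
    ((c0 3).trans (by rw [show pentEdges X j k l m 3 = orientedEdge X k m from rfl, z32.2, mul_zero]))
    ((c2 3).trans z32.1)
    ((c0 4).trans (by rw [show pentEdges X j k l m 4 = orientedEdge X k l from rfl, z33.2, mul_zero]))
    ((c1 4).trans (by rw [show pentEdges X j k l m 4 = orientedEdge X k l from rfl, z43.2, mul_zero]))
    ((c2 4).trans z33.1) ((c3 4).trans z43.1)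
  rw [Matrix.det_mul, hdetN, c0, c0, c1, c1, c2, c2, c3, c3, c4] at hdet
  change edgeDet β i j k l m * _ = _ at hdet
  simp only [show pentEdges X j k l m 0 = orientedEdge X j l from rfl,
    show pentEdges X j k l m 1 = orientedEdge X l m from rfl,
    show pentEdges X j k l m 2 = orientedEdge X j k from rfl,
    show pentEdges X j k l m 3 = orientedEdge X k m from rfl,
    show pentEdges X j k l m 4 = orientedEdge X k l from rfl] at hdet
  rw [eq_div_iff k3] at w3
  rw [eq_div_iff k4] at w4
  calc _ = (edgeDet β i j k l m * (F {i, k, l, m} {i, j, k, m} * F {j, k, l, m} {i, j, l, m}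
      - F {i, k, l, m} {i, j, l, m} * F {j, k, l, m} {i, j, k, m})) *
        (K {i, j, l, m} * K {i, j, k, m}) := by ring
    _ = quadSign i j l m * quadSign i j k m * (
        ((β {i, j, l, m} (orientedEdge X j l) * γ {i, j, l, m} (orientedEdge X l m)
          - β {i, j, l, m} (orientedEdge X l m) * γ {i, j, l, m} (orientedEdge X j l)) *
            K {i, j, l, m}) *
        ((β {i, j, k, m} (orientedEdge X j k) * γ {i, j, k, m} (orientedEdge X k m)
          - β {i, j, k, m} (orientedEdge X k m) * γ {i, j, k, m} (orientedEdge X j k)) *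
            K {i, j, k, m})) * β {i, j, k, l} (orientedEdge X k l) := by rw [hdet]; ring
    _ = _ := by rw [w3, w4]; ring

theorem prod_powersetCard_insert {x : ℕ} {s : Finset ℕ} (hx : x ∉ s) (n : ℕ)
    (f : Finset ℕ → ℂ) : ∏ t ∈ (insert x s).powersetCard (n + 1), f t =
      (∏ t ∈ s.powersetCard (n + 1), f t) * ∏ t ∈ s.powersetCard n, f (insert x t) := by
  rw [Finset.powersetCard_succ_insert hx, Finset.prod_union, Finset.prod_image]
  · intro t ht t' ht' h
    have h1 : x ∉ t := fun h => hx ((Finset.mem_powersetCard.1 ht).1 h)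
    have h2 : x ∉ t' := fun h => hx ((Finset.mem_powersetCard.1 ht').1 h)
    rw [← Finset.erase_insert h1, ← Finset.erase_insert h2]
    exact congrArg (fun s => s.erase x) h
  · rw [Finset.disjoint_left]
    intro t ht ht'
    obtain ⟨t', -, rfl⟩ := Finset.mem_image.1 ht'
    exact hx ((Finset.mem_powersetCard.1 ht).1 (Finset.mem_insert_self _ _))

theorem prod_powersetCard_quintuple {i j k l m : ℕ} (hn : [i, j, k, l, m].Nodup)
    (f : Finset ℕ → ℂ) : ∏ s ∈ ({i, j, k, l, m} : Finset ℕ).powersetCard 3, f s =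
      f {i, j, k} * f {i, j, l} * f {i, j, m} * f {i, k, l} * f {i, k, m} * f {i, l, m} *
        f {j, k, l} * f {j, k, m} * f {j, l, m} * f {k, l, m} := by
  rw [nodup_five_iff] at hn
  have h1 : i ∉ ({j, k, l, m} : Finset ℕ) := by simp; omega
  have h2 : j ∉ ({k, l, m} : Finset ℕ) := by simp; omega
  have h3 : k ∉ ({l, m} : Finset ℕ) := by simp; omega
  have h4 : l ∉ ({m} : Finset ℕ) := by simp; omega
  have h5 : m ∉ (∅ : Finset ℕ) := by simp
  have h6 : ({m} : Finset ℕ) = insert m ∅ := rfl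
  have h7 : ∀ (n : ℕ) (g : Finset ℕ → ℂ), ∏ t ∈ (∅ : Finset ℕ).powersetCard (n + 1), g t = 1 :=
    fun n g => by rw [Finset.powersetCard_eq_empty.2 (by simp), Finset.prod_empty]
  rw [h6] at h1 h2 h3 h4 ⊢
  simp only [prod_powersetCard_insert h1, prod_powersetCard_insert h2, prod_powersetCard_insert h3,
    prod_powersetCard_insert h4, prod_powersetCard_insert h5, Finset.powersetCard_zero,
    Finset.prod_singleton, h7]
  simp only [← h6, insert_empty_eq]
  ring

/-- The pentachoron factor in terms of `edgeDet`. -/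
theorem IsPentachoronFactor.eq_edgeDet (hE : IsEdgeOperators X ω K β γ)
    (hR : IsRootChoice X ω K q) (hω : ∀ s ∈ X.simplices 2, ω.1 s ≠ 0) {u : Finset ℕ}
    (hu : u ∈ X.simplices 4) (hF : IsPentachoronMatrix X β γ ε u F)
    {H : ℂ} (hH : IsPentachoronFactor X q β ε u F H) :
    ∃ i j k l m : ℕ, [i, j, k, l, m].Nodup ∧ u = {i, j, k, l, m} ∧
      H = ε * (∏ s ∈ u.powersetCard 3, q s) *
        (edgeDet β i j k l m / orientedValue ω.1 i j m) := by
  obtain ⟨i, j, k, l, m, hinj, rfl, hij, hε, hden, rfl⟩ := hH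
  have hn : [i, j, k, l, m].Nodup := by
    have := List.nodup_ofFn.2 hinj
    simpa using this
  refine ⟨i, j, k, l, m, hn, rfl, ?_⟩
  obtain ⟨m1, m2, m3, m4, m5⟩ := quadruple_mem hn hu
  have n3 : [i, j, l, m].Nodup := by rw [nodup_five_iff] at hn; rw [nodup_four_iff]; omega
  have n4 : [i, j, k, m].Nodup := by rw [nodup_five_iff] at hn; rw [nodup_four_iff]; omega
  have n5 : [i, j, k, l].Nodup := by rw [nodup_five_iff] at hn; rw [nodup_four_iff]; omega
  have n2 : [i, k, l, m].Nodup := by rw [nodup_five_iff] at hn; rw [nodup_four_iff]; omega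
  have hD := hF.denominator_mul_edgeDet hE hR hω hn hu hε
  have hO := hE.apply_opposite_edge hR hω n5 m5
  have hε0 : ε ≠ 0 := by
    rintro rfl
    have := tupleSign_eq i j k l m
    rw [hε, Int.cast_zero] at this
    simp [pairSign_ne_zero] at this
  have hL := hF.edgeDet_ne_zero hE hR hω hn hu hε0
  have he : orientedEdge X i j = edgeCocycle X {i, j} := by
    unfold orientedEdge; rw [pairSign_of_lt hij, one_smul]
  rw [he] at hO
  rw [prod_powersetCard_quintuple hn, ← hε, tupleSign_eq, pairSign_of_lt hij]
  rw [hR.agree_quadruple n3 m3, hR.agree_quadruple n4 m4] at hD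
  rw [hR.agree_quadruple n5 m5] at hO
  obtain ⟨t1, t2, t3, t4⟩ := triple_mem n5 m5
  obtain ⟨t5, t6, t7, t8⟩ := triple_mem n4 m4
  obtain ⟨t9, t10, -, -⟩ := triple_mem n3 m3
  obtain ⟨t11, -, -, -⟩ := triple_mem n2 m2
  have Q1 := hR.root_ne_zero hω t1
  have Q2 := hR.root_ne_zero hω t2
  have Q3 := hR.root_ne_zero hω t3
  have Q4 := hR.root_ne_zero hω t4
  have Q5 := hR.root_ne_zero hω t5
  have Q6 := hR.root_ne_zero hω t6
  have Q7 := hR.root_ne_zero hω t7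
  have Q9 := hR.root_ne_zero hω t9
  have Q10 := hR.root_ne_zero hω t10
  have Q11 := hR.root_ne_zero hω t11
  have s1 := hR.sq _ t1
  have s2 := hR.sq _ t2
  have s7 := hR.sq _ t7
  have p1 := pairSign_of_lt hij
  unfold orientedValue at hD hO ⊢
  unfold quadSign at hD hO
  rw [← s7] at hD ⊢
  rw [← s1, ← s2] at hO
  rw [p1] at hD hO ⊢
  have P1 := pairSign_sq i k
  have P2 := pairSign_sq i l
  have P3 := pairSign_sq i m
  have P4 := pairSign_sq j k
  have P5 := pairSign_sq j l
  have P6 := pairSign_sq j m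
  have P7 := pairSign_sq k l
  have P8 := pairSign_sq k m
  have P9 := pairSign_sq l m
  have O1 := pairSign_ne_zero i k
  have O2 := pairSign_ne_zero i l
  have O3 := pairSign_ne_zero i m
  have O4 := pairSign_ne_zero j k
  have O5 := pairSign_ne_zero j l
  have O6 := pairSign_ne_zero j m
  have O7 := pairSign_ne_zero k l
  have O8 := pairSign_ne_zero k m
  have O9 := pairSign_ne_zero l m
  generalize F {i, k, l, m} {i, j, k, m} * F {j, k, l, m} {i, j, l, m}
      - F {i, k, l, m} {i, j, l, m} * F {j, k, l, m} {i, j, k, m} = D at *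
  generalize edgeDet β i j k l m = Λ at *
  generalize β {i, j, k, l} (orientedEdge X k l) = b at *
  generalize β {i, j, k, l} (edgeCocycle X {i, j}) = b' at *
  generalize pairSign i k = x1 at *
  generalize pairSign i l = x2 at *
  generalize pairSign i m = x3 at *
  generalize pairSign j k = x4 at *
  generalize pairSign j l = x5 at *
  generalize pairSign j m = x6 at *
  generalize pairSign k l = x7 at *
  generalize pairSign k m = x8 at *
  generalize pairSign l m = x9 at *
  generalize q {j, k, l} = q1 at *
  generalize q {i, k, l} = q2 at *
  generalize q {i, j, l} = q3 at *
  generalize q {i, j, k} = q4 at *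
  generalize q {j, k, m} = q5 at *
  generalize q {i, k, m} = q6 at *
  generalize q {i, j, m} = q7 at *
  generalize q {j, l, m} = q9 at *
  generalize q {i, l, m} = q10 at *
  generalize q {k, l, m} = q11 at *
  -- The factor `H_u` contains the edge `ij`, the formula for its denominator the opposite edge `kl`
  -- of `ijkl`; the proportionality of the two is rewritten in roots.
  have hb' : b' * (q3 * q4) = b * x7 * (q1 * q2) := by
    refine mul_left_cancel₀ (a := x1 * x2 * x4 * x5 * x7 * (q1 * q2)) ?_ ?_
    · simp only [ne_eq, mul_eq_zero, not_or]; tauto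
    · linear_combination -hO
  -- The two roots `K` share the face `ijm`, so `q_{ijm} ^ 2` cancels on both sides.
  have hb : D * Λ * (q9 * q10 * q3 * q5 * q6 * q4) = x1 * x2 * x4 * x5 * x8 * x9 * q7 ^ 2 * b := by
    refine mul_left_cancel₀ (a := q7 ^ 2) (pow_ne_zero 2 Q7) ?_
    have e : x3 ^ 4 * x6 ^ 4 = 1 := by
      rw [show x3 ^ 4 * x6 ^ 4 = (x3 ^ 2) ^ 2 * (x6 ^ 2) ^ 2 by ring, P3, P6]; norm_num
    linear_combination hD + x1 * x2 * x4 * x5 * x8 * x9 * q7 ^ 4 * b * e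
  have hx : (x1 * x2 * x4 * x5 * x8 * x9) ^ 2 = 1 := by
    simp only [mul_pow, P1, P2, P4, P5, P8, P9, mul_one]
  rw [div_eq_iff hden, mul_div_assoc', div_mul_eq_mul_div, eq_div_iff]
  · linear_combination q7 ^ 3 * q11 * x3 * x6 * hb'
      - x1 * x2 * x3 * x4 * x5 * x6 * x7 * x8 * x9 * q1 * q2 * q7 * q11 * hb
      - b * q7 ^ 3 * q1 * q2 * q11 * x3 * x6 * x7 * hx
  · simp only [ne_eq, mul_eq_zero, not_or, pow_eq_zero_iff, one_ne_zero, OfNat.ofNat_ne_zero,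
      not_false_eq_true]
    tauto

end PLFermion

namespace PLFermion

variable {X : FinComplex} {ω : cocycles X} {K q K' q' : Finset ℕ → ℂ}
  {β γ β' γ' : Finset ℕ → cocycles X →ₗ[ℂ] ℂ} {ε : ℤ} {F F' : Finset ℕ → Finset ℕ → ℂ}

/-! ## The change of the edge operators under a change of the square roots -/

/-- A nonzero rank-one bilinear form determines its two factors up to reciprocal scalars. -/
theorem exists_scale_of_mul_eq {V : Type*} [AddCommGroup V] [Module ℂ V] {f g f' g' : V →ₗ[ℂ] ℂ}
    (h : ∀ c c', f' c * g' c' = f c * g c') (hf' : ∃ c, f' c ≠ 0) (hg' : ∃ c, g' c ≠ 0) :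
    ∃ r : ℂ, r ≠ 0 ∧ (∀ c, f' c = r * f c) ∧ ∀ c, g' c = r⁻¹ * g c := by
  obtain ⟨c₁, h₁⟩ := hf'
  obtain ⟨c₂, h₂⟩ := hg'
  have hf : ∀ c, f' c = g c₂ / g' c₂ * f c := by
    intro c
    rw [div_mul_eq_mul_div, eq_div_iff h₂, h c c₂]
    ring
  have hr : g c₂ / g' c₂ ≠ 0 := fun h0 => h₁ (by rw [hf, h0, zero_mul])
  refine ⟨g c₂ / g' c₂, hr, hf, fun c => ?_⟩
  have h3 : f c₁ ≠ 0 := fun h0 => h₁ (by rw [hf, h0, mul_zero])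
  have := h c₁ c
  rw [hf c₁] at this
  rw [eq_inv_mul_iff_mul_eq₀ hr]
  exact mul_left_cancel₀ h3 (by linear_combination this)

/-- Edge operators for two choices of the root `K_t` are related by an orthogonal transformation of
the hyperbolic plane spanned by `∂_t` and `ϑ_t`, with determinant `K'_t / K_t`. -/
structure IsGauge (K K' : Finset ℕ → ℂ) (β γ β' γ' : Finset ℕ → cocycles X →ₗ[ℂ] ℂ)
    (t : Finset ℕ) (a b c d : ℂ) : Prop where
  apply_left : ∀ x, β' t x = a * β t x + b * γ t x
  apply_right : ∀ x, γ' t x = c * γ t x + d * β t x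
  perm : a * c + b * d = 1
  left : a * d = 0
  right : b * c = 0
  det : (a * c - b * d) * K t = K' t

/-- The squares of `K_t` and `K'_t` agree. If the roots are equal, the products of `β_t` and `γ_t`
agree and the pair is rescaled. If they are opposite, the antisymmetric part changes its sign, so
`β'_t` is proportional to `γ_t` and `γ'_t` to `β_t`. -/
theorem IsEdgeOperators.exists_gauge (hω : ∀ s ∈ X.simplices 2, ω.1 s ≠ 0)
    (hR : IsRootChoice X ω K q) (hE : IsEdgeOperators X ω K β γ)
    (hR' : IsRootChoice X ω K' q') (hE' : IsEdgeOperators X ω K' β' γ')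
    {t : Finset ℕ} (ht : t ∈ X.simplices 3) : ∃ a b c d, IsGauge K K' β γ β' γ' t a b c d := by
  obtain ⟨hβ', hγ'⟩ := hE'.exists_ne_zero hR' hω ht
  obtain ⟨x, y, z, w, hn, rfl⟩ := exists_quadruple ht
  have hK : K' {x, y, z, w} ^ 2 = K {x, y, z, w} ^ 2 := by rw [hR.sq_eq hn ht, hR'.sq_eq hn ht]
  obtain ⟨⟨h1, h2, h3⟩, ⟨h4, h5⟩, h6⟩ := nodup_four_iff.1 hn
  rcases sq_eq_sq_iff_eq_or_eq_neg.1 hK with h | h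
  · obtain ⟨r, hr, e1, e2⟩ := exists_scale_of_mul_eq (f := β {x, y, z, w}) (g := γ {x, y, z, w})
      (f' := β' {x, y, z, w}) (g' := γ' {x, y, z, w}) (by
        intro c c'
        refine mul_left_cancel₀ (two_ne_zero (α := ℂ)) ?_
        rw [hE.two_mul_mul c c' hn ht, hE'.two_mul_mul c c' hn ht, h]) hβ' hγ'
    exact ⟨r, 0, r⁻¹, 0, by simpa using e1, by simpa using e2, by simp [hr], by simp, by simp,
      by simp [hr, h]⟩
  · obtain ⟨r, hr, e1, e2⟩ := exists_scale_of_mul_eq (f := γ {x, y, z, w}) (g := β {x, y, z, w})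
      (f' := β' {x, y, z, w}) (g' := γ' {x, y, z, w}) (by
        intro c c'
        refine mul_left_cancel₀ (two_ne_zero (α := ℂ)) ?_
        have s1 := hE.oriented_scalar_product c c' x y z w h1 h2 h3 h4 h5 h6 ht
        have s2 := hE.oriented_branch c c' x y z w h1 h2 h3 h4 h5 h6 ht
        rw [hE'.two_mul_mul c c' hn ht, h, ← s1, div_neg, ← s2]
        ring) hβ' hγ'
    exact ⟨0, r, 0, r⁻¹, by simpa using e1, by simpa using e2, by simp [hr], by simp, by simp,
      by simp [hr, h]⟩

/-- The matrix that expresses the new components of `∂_t` in the tetrahedra of a pentachoron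
in terms of the old ones. -/
noncomputable def gaugeMatrix (a b : Finset ℕ → ℂ) (ε : ℤ) (u : Finset ℕ)
    (F : Finset ℕ → Finset ℕ → ℂ) : Matrix u u ℂ :=
  Matrix.of fun v w => (if v = w then a (u.erase v) else 0)
    + b (u.erase v) * (ε * sgn u v) * F (u.erase w) (u.erase v)

/-- In `β' = a β + b γ` the component `γ` is eliminated by the annihilation relation, whose sign `ε
sgn` is its own inverse. -/
theorem gaugeMatrix_apply_beta {u : Finset ℕ} (hε : (ε : ℂ) * ε = 1)
    (hF : IsPentachoronMatrix X β γ ε u F) {a b c d : Finset ℕ → ℂ}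
    (hg : ∀ v ∈ u, IsGauge K K' β γ β' γ' (u.erase v) (a (u.erase v)) (b (u.erase v))
      (c (u.erase v)) (d (u.erase v))) (x : cocycles X) (v : u) :
    β' (u.erase v) x = ∑ w : u, gaugeMatrix a b ε u F v w * β (u.erase w) x := by
  have h := hF.annihilates x v v.2
  have e : ((ε : ℂ) * sgn u v) * (ε * sgn u v) = 1 := by
    linear_combination hε * (sgn u v : ℂ) * (sgn u v : ℂ) + sgn_sq u v
  rw [(hg v v.2).apply_left]
  simp only [gaugeMatrix, Matrix.of_apply, add_mul, Finset.sum_add_distrib, ite_mul, zero_mul,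
    Finset.sum_ite_eq, Finset.mem_univ, if_true]
  congr 1
  have h' : ∑ w : u, b (u.erase v) * (ε * sgn u v) * F (u.erase w) (u.erase v) * β (u.erase w) x =
      b (u.erase v) * (ε * sgn u v) * ∑ w ∈ u, β (u.erase w) x * F (u.erase w) (u.erase v) := by
    rw [Finset.mul_sum, ← Finset.sum_coe_sort u]
    exact Finset.sum_congr rfl fun w _ => by ring
  rw [h', h]
  linear_combination -(b (u.erase v) * γ (u.erase v) x) * e

/-- The numbering of the vertices of a pentachoron. -/
theorem exists_equiv_quintuple {i j k l m : ℕ} (hn : [i, j, k, l, m].Nodup) :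
    ∃ e : Fin 5 ≃ ({i, j, k, l, m} : Finset ℕ),
      ∀ s, ({i, j, k, l, m} : Finset ℕ).erase (e s) = pentTets i j k l m s := by
  have hmem : ∀ s, (![i, j, k, l, m] : Fin 5 → ℕ) s ∈ ({i, j, k, l, m} : Finset ℕ) := by
    intro s; fin_cases s <;> simp
  have hinj : Function.Injective (![i, j, k, l, m] : Fin 5 → ℕ) := by
    rw [← List.nodup_ofFn]; simpa using hn
  have hcard : Fintype.card (Fin 5) = Fintype.card ({i, j, k, l, m} : Finset ℕ) := by
    have hn' := nodup_five_iff.1 hn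
    rw [Fintype.card_coe, Finset.card_insert_of_notMem (by simp; omega),
      card_quadruple (by omega) (by omega) (by omega) (by omega) (by omega) (by omega)]
    rfl
  refine ⟨Equiv.ofBijective (fun s => ⟨_, hmem s⟩) ((Fintype.bijective_iff_injective_and_card _).2
    ⟨fun s s' h => hinj (congrArg Subtype.val h), hcard⟩), fun s => ?_⟩
  obtain ⟨e1, e2, e3, e4, e5⟩ := erase_quintuple hn
  fin_cases s
  exacts [e1, e2, e3, e4, e5]

theorem edgeDet_gauge {i j k l m : ℕ} (hn : [i, j, k, l, m].Nodup) (hε : (ε : ℂ) * ε = 1)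
    (hF : IsPentachoronMatrix X β γ ε {i, j, k, l, m} F) {a b c d : Finset ℕ → ℂ}
    (hg : ∀ v ∈ ({i, j, k, l, m} : Finset ℕ),
      IsGauge K K' β γ β' γ' (({i, j, k, l, m} : Finset ℕ).erase v)
        (a (({i, j, k, l, m} : Finset ℕ).erase v)) (b (({i, j, k, l, m} : Finset ℕ).erase v))
        (c (({i, j, k, l, m} : Finset ℕ).erase v)) (d (({i, j, k, l, m} : Finset ℕ).erase v))) :
    edgeDet β' i j k l m = (gaugeMatrix a b ε {i, j, k, l, m} F).det * edgeDet β i j k l m := by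
  obtain ⟨e, he⟩ := exists_equiv_quintuple hn
  rw [edgeDet_eq, edgeDet_eq, ← Matrix.det_submatrix_equiv_self e, ← Matrix.det_transpose,
    ← Matrix.det_transpose (Matrix.of _), ← Matrix.det_mul]
  congr 1
  ext s r
  have := gaugeMatrix_apply_beta hε hF hg (pentEdges X j k l m r) (e s)
  rw [he] at this
  simp only [Matrix.transpose_apply, Matrix.of_apply, Matrix.mul_apply, Matrix.submatrix_apply]
  rw [this, ← e.sum_comp]
  exact Finset.sum_congr rfl fun w _ => by rw [he]

theorem exists_quintuple {u : Finset ℕ} (hu : u ∈ X.simplices 4) :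
    ∃ i j k l m : ℕ, [i, j, k, l, m].Nodup ∧ u = {i, j, k, l, m} := by
  have hc := (mem_simplices.1 hu).2
  obtain ⟨i, s, his, rfl, hs⟩ := Finset.card_eq_succ.1 hc
  obtain ⟨j, k, l, m, h1, h2, h3, h4, h5, h6, rfl⟩ := Finset.card_eq_four.1 hs
  refine ⟨i, j, k, l, m, ?_, rfl⟩
  simp only [mem_insert, mem_singleton, not_or] at his
  rw [nodup_five_iff]
  tauto

/-- The two factors may be calculated from different edges and tetrahedra; independence of the
vertex order first brings both to a common order, where only the roots and the edge determinant
differ. -/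
theorem IsPentachoronFactor.gauge (hω : ∀ s ∈ X.simplices 2, ω.1 s ≠ 0)
    (hR : IsRootChoice X ω K q) (hE : IsEdgeOperators X ω K β γ)
    (hR' : IsRootChoice X ω K' q') (hE' : IsEdgeOperators X ω K' β' γ')
    {u : Finset ℕ} (hu : u ∈ X.simplices 4) (hε : (ε : ℂ) * ε = 1)
    (hF : IsPentachoronMatrix X β γ ε u F) (hF' : IsPentachoronMatrix X β' γ' ε u F')
    {a b c d : Finset ℕ → ℂ}
    (hg : ∀ v ∈ u, IsGauge K K' β γ β' γ' (u.erase v) (a (u.erase v)) (b (u.erase v))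
      (c (u.erase v)) (d (u.erase v)))
    {H H' : ℂ} (hH : IsPentachoronFactor X q β ε u F H)
    (hH' : IsPentachoronFactor X q' β' ε u F' H') :
    H' * ∏ s ∈ u.powersetCard 3, q s =
      (gaugeMatrix a b ε u F).det * (∏ s ∈ u.powersetCard 3, q' s) * H := by
  obtain ⟨i, j, k, l, m, hn, hv, h⟩ := hH.eq_edgeDet hE hR hω hu hF
  obtain ⟨i', j', k', l', m', hn', hv', h'⟩ := hH'.eq_edgeDet hE' hR' hω hu hF'
  have hc := (mem_simplices.1 hu).2
  rw [edgeDet_div_eq hE' hR' hω hu hc _ _ _ _ _ hn' hv',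
    ← edgeDet_div_eq hE' hR' hω hu hc _ _ _ _ _ hn hv] at h'
  subst hv
  rw [edgeDet_gauge hn hε hF hg] at h'
  rw [h, h']
  ring

/-- Since the edge determinant is nonzero, the `β`-vectors of cocycles span all five coordinates of
a pentachoron. Matrix identities may thus be tested on cocycles. -/
theorem IsPentachoronMatrix.eq_zero_of_sum (hω : ∀ s ∈ X.simplices 2, ω.1 s ≠ 0)
    (hR : IsRootChoice X ω K q) (hE : IsEdgeOperators X ω K β γ)
    {u : Finset ℕ} (hu : u ∈ X.simplices 4) (hε : (ε : ℂ) * ε = 1)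
    (hF : IsPentachoronMatrix X β γ ε u F) {y : u → ℂ}
    (hy : ∀ c, ∑ w : u, β (u.erase w) c * y w = 0) : y = 0 := by
  obtain ⟨i, j, k, l, m, hn, rfl⟩ := exists_quintuple hu
  obtain ⟨e, he⟩ := exists_equiv_quintuple hn
  have hd := hF.edgeDet_ne_zero hE hR hω hn hu (by rintro rfl; simp at hε)
  rw [edgeDet_eq] at hd
  have h0 := Matrix.eq_zero_of_mulVec_eq_zero hd (v := y ∘ e) (by
    funext r
    simp only [Matrix.mulVec, dotProduct, Matrix.of_apply, Function.comp_apply, Pi.zero_apply]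
    rw [← hy (pentEdges X j k l m r), ← e.sum_comp]
    exact Finset.sum_congr rfl fun w _ => by rw [he])
  funext v
  have := congrFun h0 (e.symm v)
  simpa using this

end PLFermion

namespace PLFermion

/-! ## Bordered determinants -/

open Matrix

section Selection

variable {n d : Type*} [Fintype n] [DecidableEq n]

/-- The matrix of the inclusion of the coordinates chosen by `e`. -/
def selection (e : d → n) : Matrix n d ℂ := Matrix.of fun t i => if t = e i then 1 else 0

theorem selection_transpose_mul {m : Type*} (e : d → n) (A : Matrix n m ℂ) :
    (selection e)ᵀ * A = A.submatrix e id := by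
  ext i j
  simp [selection, Matrix.mul_apply]

theorem mul_selection {m : Type*} (e : d → n) (A : Matrix m n ℂ) :
    A * selection e = A.submatrix id e := by
  ext i j
  simp [selection, Matrix.mul_apply]

end Selection

section Bordered

variable {n d : Type*} [Fintype n] [DecidableEq n] [Fintype d] [DecidableEq d]

/-- If `Φ k = 0`, the determinant of `Φ` with borders `P`, `Q` is proportional to `det (Q k)`. -/
theorem det_border_mul_det_mul {Φ : Matrix n n ℂ} {k : Matrix n d ℂ} (hk : Φ * k = 0)
    (P : Matrix n d ℂ) (Q Q₀ : Matrix d n ℂ) :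
    (fromBlocks Φ P Q 0).det * (Q₀ * k).det = (fromBlocks Φ P Q₀ 0).det * (Q * k).det := by
  -- The identity is symmetric in `Q` and `Q₀`, so one nonzero bordered determinant suffices; if
  -- both vanish, nothing is left to prove.
  have main : ∀ Q Q₀ : Matrix d n ℂ, (fromBlocks Φ P Q₀ 0).det ≠ 0 →
      (fromBlocks Φ P Q 0).det * (Q₀ * k).det = (fromBlocks Φ P Q₀ 0).det * (Q * k).det := by
    intro Q Q₀ h
    have hu : IsUnit (fromBlocks Φ P Q₀ 0).det := isUnit_iff_ne_zero.2 h
    obtain ⟨A, K, L, Z, hinv⟩ : ∃ A K L Z, (fromBlocks Φ P Q₀ 0)⁻¹ = fromBlocks A K L Z :=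
      ⟨_, _, _, _, (fromBlocks_toBlocks _).symm⟩
    have h1 := Matrix.mul_nonsing_inv _ hu
    have h2 := Matrix.nonsing_inv_mul _ hu
    rw [hinv, fromBlocks_multiply] at h1 h2
    rw [← fromBlocks_one, fromBlocks_inj] at h1 h2
    obtain ⟨a1, a2, a3, a4⟩ := h1
    obtain ⟨b1, b2, b3, b4⟩ := h2
    -- The block `A * Φ + K * Q₀ = 1` of the inverse, applied to `k`.
    have hK : K * (Q₀ * k) = k := by
      have : (A * Φ + K * Q₀) * k = k := by rw [b1, Matrix.one_mul]
      rwa [Matrix.add_mul, Matrix.mul_assoc, hk, Matrix.mul_zero, zero_add,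
        Matrix.mul_assoc] at this
    have hp : fromBlocks Φ P Q 0 * fromBlocks A K L Z = fromBlocks 1 0 (Q * A) (Q * K) := by
      rw [fromBlocks_multiply, a1, a2, Matrix.zero_mul, Matrix.zero_mul, add_zero, add_zero]
    have hdet := congrArg Matrix.det hp
    rw [Matrix.det_mul, det_fromBlocks_zero₁₂, det_one, one_mul, ← hinv,
      Matrix.det_nonsing_inv, Ring.inverse_eq_inv'] at hdet
    have h3 : (Q * k).det = (Q * K).det * (Q₀ * k).det := by
      rw [← Matrix.det_mul, Matrix.mul_assoc, hK]
    rw [h3, ← hdet]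
    field_simp
  by_cases h : (fromBlocks Φ P Q₀ 0).det = 0
  · by_cases h' : (fromBlocks Φ P Q 0).det = 0
    · rw [h, h', zero_mul, zero_mul]
    · exact (main Q₀ Q h').symm
  · exact main Q Q₀ h

theorem det_border_mul_det_mul' {Φ : Matrix n n ℂ} {l : Matrix d n ℂ} (hl : l * Φ = 0)
    (P P₀ : Matrix n d ℂ) (Q : Matrix d n ℂ) :
    (fromBlocks Φ P Q 0).det * (l * P₀).det = (fromBlocks Φ P₀ Q 0).det * (l * P).det := by
  have h := det_border_mul_det_mul (Φ := Φᵀ) (k := lᵀ)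
    (by rw [← Matrix.transpose_mul, hl, Matrix.transpose_zero]) Qᵀ Pᵀ P₀ᵀ
  rw [← Matrix.transpose_mul, ← Matrix.transpose_mul, det_transpose, det_transpose,
    ← det_transpose (fromBlocks _ _ _ _), ← det_transpose (fromBlocks _ _ _ _),
    fromBlocks_transpose, fromBlocks_transpose] at h
  simpa using h

/-- The normalized bordered determinants of two operators that differ by isomorphisms. -/
theorem det_border_conj {Ψ Ψ' S N : Matrix n n ℂ} (h : S * Ψ = Ψ' * N)
    {k : Matrix n d ℂ} (hk : Ψ * k = 0) {l l' : Matrix d n ℂ} (hl' : l' * Ψ' = 0)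
    (hl : l' * S = l) (P P' : Matrix n d ℂ) (Q Q' : Matrix d n ℂ) :
    (fromBlocks Ψ' P' Q' 0).det * N.det * (Q * k).det * (l * P).det =
      S.det * (fromBlocks Ψ P Q 0).det * (Q' * (N * k)).det * (l' * P').det := by
  -- The intertwining relation carries the borders `P`, `Q' N` of the old operator to `S P`, `Q'` of
  -- the new one; the two border lemmas then restore the prescribed borders.
  have h1 : (fromBlocks Ψ' (S * P) Q' 0).det * N.det
      = S.det * (fromBlocks Ψ P (Q' * N) 0).det := by
    have e1 : fromBlocks Ψ' (S * P) Q' 0 * fromBlocks N 0 0 (1 : Matrix d d ℂ) =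
        fromBlocks S 0 0 (1 : Matrix d d ℂ) * fromBlocks Ψ P (Q' * N) 0 := by
      rw [fromBlocks_multiply, fromBlocks_multiply]
      simp [h]
    have e2 := congrArg Matrix.det e1
    rwa [det_mul, det_mul, det_fromBlocks_zero₁₂, det_fromBlocks_zero₁₂, det_one, mul_one,
      mul_one] at e2
  have h2 := det_border_mul_det_mul hk P (Q' * N) Q
  have h3 := det_border_mul_det_mul' hl' (S * P) P' Q'
  rw [← Matrix.mul_assoc, hl] at h3
  rw [Matrix.mul_assoc] at h2
  calc _ = ((fromBlocks Ψ' P' Q' 0).det * (l * P).det) * N.det * (Q * k).det := by ring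
    _ = ((fromBlocks Ψ' (S * P) Q' 0).det * N.det) * (l' * P').det * (Q * k).det := by
        rw [← h3]; ring
    _ = S.det * ((fromBlocks Ψ P (Q' * N) 0).det * (Q * k).det) * (l' * P').det := by
        rw [h1]; ring
    _ = _ := by rw [h2]; ring

/-- The determinant of a matrix bordered by unit vectors is, up to a sign that depends only on the
number of these vectors, a principal minor. -/
theorem det_border_selection (D : Matrix n n ℂ) (e : d ↪ n)
    [Fintype {t // t ∉ Set.range e}] [DecidableEq {t // t ∉ Set.range e}] :
    (fromBlocks D (selection e) (selection e)ᵀ 0).det =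
      (fromBlocks 0 1 1 0 : Matrix (d ⊕ d) (d ⊕ d) ℂ).det *
        (D.submatrix (Subtype.val : {t // t ∉ Set.range e} → n) Subtype.val).det := by
  classical
  let g : {t // t ∉ Set.range e} ⊕ d ≃ n :=
    (Equiv.sumComm _ _).trans (((Equiv.ofInjective e e.injective).sumCongr (Equiv.refl _)).trans
      (Equiv.sumCompl fun t => t ∈ Set.range e))
  have g1 : ∀ t, g (Sum.inl t) = t.1 := fun t => by simp [g]
  have g2 : ∀ i, g (Sum.inr i) = e i := fun i => by simp [g]
  let φ : {t // t ∉ Set.range e} ⊕ (d ⊕ d) ≃ n ⊕ d :=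
    (Equiv.sumAssoc _ _ _).symm.trans (g.sumCongr (Equiv.refl d))
  have φ1 : ∀ t, φ (Sum.inl t) = Sum.inl t.1 := fun t => by simp [φ, g1]
  have φ2 : ∀ i, φ (Sum.inr (Sum.inl i)) = Sum.inl (e i) := fun i => by simp [φ, g2]
  have φ3 : ∀ i, φ (Sum.inr (Sum.inr i)) = Sum.inr i := fun i => by simp [φ]
  set v : {t // t ∉ Set.range e} → n := Subtype.val with hv
  -- Indices are ordered as: not selected, selected, border.
  have hB : (fromBlocks D (selection e) (selection e)ᵀ 0).submatrix φ φ =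
      fromBlocks (D.submatrix v v) (fromCols (D.submatrix v e) 0)
        (fromRows (D.submatrix e v) 0) (fromBlocks (D.submatrix e e) 1 1 0) := by
    ext x y
    rcases x with x | x | x <;> rcases y with y | y | y <;>
      simp only [submatrix_apply, φ1, φ2, φ3, fromBlocks_apply₁₁, fromBlocks_apply₁₂,
        fromBlocks_apply₂₁, fromBlocks_apply₂₂, fromCols_apply_inl, fromCols_apply_inr,
        fromRows_apply_inl, fromRows_apply_inr, selection, of_apply, transpose_apply,
        Matrix.zero_apply, hv, Matrix.one_apply, e.injective.eq_iff]
    · exact if_neg fun h => x.2 ⟨y, h.symm⟩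
    · exact if_neg fun h => y.2 ⟨x, h.symm⟩
    · simp only [eq_comm]
  have hW : (fromBlocks (D.submatrix e e) 1 1 0 : Matrix (d ⊕ d) (d ⊕ d) ℂ) =
      fromBlocks 1 (D.submatrix e e) 0 1 * fromBlocks 0 1 1 0 := by
    rw [fromBlocks_multiply]; simp
  have hWdet : (fromBlocks (D.submatrix e e) 1 1 0 : Matrix (d ⊕ d) (d ⊕ d) ℂ).det =
      (fromBlocks 0 1 1 0 : Matrix (d ⊕ d) (d ⊕ d) ℂ).det := by
    rw [hW, det_mul, det_fromBlocks_zero₂₁]; simp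
  let _ : Invertible (fromBlocks (D.submatrix e e) 1 1 0 : Matrix (d ⊕ d) (d ⊕ d) ℂ) :=
    ⟨fromBlocks 0 1 1 (-(D.submatrix e e)), by rw [fromBlocks_multiply]; simp,
      by rw [fromBlocks_multiply]; simp⟩
  -- The corner of selected and border indices is invertible, and its inverse has a zero block at
  -- the selected indices; therefore the Schur complement is the unchanged principal submatrix.
  rw [← det_submatrix_equiv_self φ, hB, det_fromBlocks₂₂, hWdet]
  congr 2
  have : ⅟(fromBlocks (D.submatrix e e) 1 1 0 : Matrix (d ⊕ d) (d ⊕ d) ℂ) =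
      fromBlocks 0 1 1 (-(D.submatrix e e)) := rfl
  rw [this, Matrix.fromCols_mul_fromBlocks]
  simp [Matrix.fromCols_mul_fromRows]

/-- Bringing the two copies of each index together leaves independent 2×2 blocks. -/
theorem det_fromBlocks_diagonal (a b c e : n → ℂ) :
    (fromBlocks (diagonal a) (diagonal b) (diagonal c) (diagonal e)).det =
      ∏ t, (a t * e t - b t * c t) := by
  let φ : Fin 2 × n ≃ n ⊕ n := (finTwoEquiv.prodCongr (Equiv.refl n)).trans (Equiv.boolProdEquivSum n)
  have h : (fromBlocks (diagonal a) (diagonal b) (diagonal c) (diagonal e)).submatrix φ φ =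
      blockDiagonal fun t => !![a t, b t; c t, e t] := by
    ext ⟨x, s⟩ ⟨y, t⟩
    fin_cases x <;> fin_cases y <;>
      simp [φ, blockDiagonal_apply, diagonal_apply, finTwoEquiv, Equiv.boolProdEquivSum]
  rw [← det_submatrix_equiv_self φ, h, det_blockDiagonal]
  simp [det_fin_two]

theorem det_blockDiagonal'_sigma {o : Type*} [Fintype o] [DecidableEq o] {m : o → Type*}
    [∀ i, Fintype (m i)] [∀ i, DecidableEq (m i)] (M : ∀ i, Matrix (m i) (m i) ℂ) :
    (blockDiagonal' M).det = ∏ i, (M i).det := by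
  classical
  -- Any linear order makes a block diagonal matrix block triangular; one is borrowed from an
  -- enumeration.
  let _ : LinearOrder o := LinearOrder.lift' (Fintype.equivFin o) (Fintype.equivFin o).injective
  rw [(blockTriangular_blockDiagonal' M).det_fintype]
  refine Finset.prod_congr rfl fun i _ => ?_
  let g : m i ≃ {x : (Σ i, m i) // x.1 = i} :=
    { toFun := fun x => ⟨⟨i, x⟩, rfl⟩
      invFun := fun x => x.2 ▸ x.1.2
      left_inv := fun x => rfl
      right_inv := by rintro ⟨⟨j, x⟩, rfl⟩; rfl }
  rw [← det_submatrix_equiv_self g]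
  congr 1
  ext x y
  exact blockDiagonal'_apply_eq M i x y

end Bordered

end PLFermion

namespace PLFermion

open Matrix

/-! ## The global operators -/

section Global

variable (X : FinComplex)

/-- A pentachoron with one of its vertices; it stands for the opposite tetrahedron, considered as a
face of this pentachoron. -/
abbrev PentFlag : Type := Σ u : X.simplices 4, (u.1 : Finset ℕ)

variable {X}

/-- The tetrahedron of a flag. -/
def PentFlag.tet (x : PentFlag X) : Finset ℕ := x.1.1.erase x.2.1

theorem PentFlag.tet_mem (x : PentFlag X) : x.tet ∈ X.simplices 3 := by
  refine mem_simplices_of_subset x.1.2 (Finset.erase_subset _ _) ?_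
  unfold PentFlag.tet
  rw [Finset.card_erase_of_mem x.2.2, (mem_simplices.1 x.1.2).2]

/-- The incidence number of a flag. -/
noncomputable def PentFlag.sign (o : Finset ℕ → ℤ) (x : PentFlag X) : ℂ := o x.1.1 * sgn x.1.1 x.2.1

/-- The matrix that copies a function on tetrahedra to all flags. -/
noncomputable def copyMatrix (X : FinComplex) : Matrix (PentFlag X) (X.simplices 3) ℂ :=
  Matrix.of fun x t => if x.tet = t.1 then 1 else 0

/-- The incidence matrix of tetrahedra and flags. -/
noncomputable def incidenceMatrix (X : FinComplex) (o : Finset ℕ → ℤ) :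
    Matrix (X.simplices 3) (PentFlag X) ℂ :=
  (copyMatrix X)ᵀ * diagonal (PentFlag.sign (X := X) o)

/-- The sums and (signed) differences, for every tetrahedron, of a function on flags. -/
noncomputable def splitMatrix (X : FinComplex) (o : Finset ℕ → ℤ) :
    Matrix (X.simplices 3 ⊕ X.simplices 3) (PentFlag X) ℂ :=
  fromRows (incidenceMatrix X o) (copyMatrix X)ᵀ

/-- The inverse of `splitMatrix` for a closed oriented pseudomanifold. -/
noncomputable def joinMatrix (X : FinComplex) (o : Finset ℕ → ℤ) :
    Matrix (PentFlag X) (X.simplices 3 ⊕ X.simplices 3) ℂ :=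
  (1 / 2 : ℂ) • fromCols (incidenceMatrix X o)ᵀ (copyMatrix X)

/-- The direct sum of the matrices of all pentachora. -/
noncomputable def flagMatrix (X : FinComplex) (F : Finset ℕ → Finset ℕ → Finset ℕ → ℂ) :
    Matrix (PentFlag X) (PentFlag X) ℂ :=
  blockDiagonal' fun u : X.simplices 4 => Matrix.of fun v w : (u.1 : Finset ℕ) =>
    F u.1 (u.1.erase v) (u.1.erase w)

/-- The discrepancies of the two components of an operator in neighbouring pentachora. -/
noncomputable def discrepancyMatrix (X : FinComplex) (o : Finset ℕ → ℤ)
    (F : Finset ℕ → Finset ℕ → Finset ℕ → ℂ) :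
    Matrix (X.simplices 3 ⊕ X.simplices 3) (PentFlag X) ℂ :=
  fromRows (incidenceMatrix X o) ((copyMatrix X)ᵀ * (flagMatrix X F)ᵀ)

/-- The direct sum of the matrices `gaugeMatrix` of all pentachora. -/
noncomputable def flagGauge (X : FinComplex) (o : Finset ℕ → ℤ) (a b : Finset ℕ → ℂ)
    (F : Finset ℕ → Finset ℕ → Finset ℕ → ℂ) : Matrix (PentFlag X) (PentFlag X) ℂ :=
  blockDiagonal' fun u : X.simplices 4 => gaugeMatrix a b (o u.1) u.1 (F u.1)

/-- The values of functionals on cocycles. -/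
def evalMatrix {d : Type*} (β : Finset ℕ → cocycles X →ₗ[ℂ] ℂ) (f : d → cocycles X) :
    Matrix (X.simplices 3) d ℂ := Matrix.of fun t i => β t (f i)

theorem copyMatrix_mul_evalMatrix {d : Type*} (β : Finset ℕ → cocycles X →ₗ[ℂ] ℂ)
    (f : d → cocycles X) :
    copyMatrix X * evalMatrix β f = Matrix.of fun x i => β (PentFlag.tet x) (f i) := by
  ext x i
  rw [Matrix.mul_apply, Finset.sum_eq_single ⟨x.tet, x.tet_mem⟩]
  · simp [copyMatrix, evalMatrix]
  · intro t _ ht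
    have : x.tet ≠ t.1 := fun h => ht (Subtype.ext h.symm)
    simp [copyMatrix, this]
  · simp

theorem diagonal_mul_copyMatrix_transpose (a : Finset ℕ → ℂ) :
    diagonal (fun t : X.simplices 3 => a t.1) * (copyMatrix X)ᵀ =
      (copyMatrix X)ᵀ * diagonal (fun x : PentFlag X => a (PentFlag.tet x)) := by
  ext t x
  rw [diagonal_mul, mul_diagonal, transpose_apply, copyMatrix, of_apply]
  split_ifs with h
  · rw [h, mul_comm]
  · rw [mul_zero, zero_mul]

variable {o : Finset ℕ → ℤ}

theorem PentFlag.sign_sq (ho : ∀ u ∈ X.simplices 4, (o u : ℂ) * o u = 1) (x : PentFlag X) :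
    x.sign o * x.sign o = 1 := by
  unfold PentFlag.sign
  linear_combination ho _ x.1.2 * (sgn x.1.1 x.2.1 : ℂ) * (sgn x.1.1 x.2.1 : ℂ)
    + sgn_sq x.1.1 x.2.1

theorem diagonal_sign_mul_self (ho : ∀ u ∈ X.simplices 4, (o u : ℂ) * o u = 1) :
    diagonal (PentFlag.sign (X := X) o) * diagonal (PentFlag.sign (X := X) o) =
      (1 : Matrix (PentFlag X) (PentFlag X) ℂ) := by
  rw [diagonal_mul_diagonal, ← diagonal_one]
  congr 1
  funext x
  exact x.sign_sq ho

theorem flagGauge_eq (a b : Finset ℕ → ℂ) (F : Finset ℕ → Finset ℕ → Finset ℕ → ℂ) :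
    flagGauge X o a b F = diagonal (fun x : PentFlag X => a (PentFlag.tet x)) +
      diagonal (fun x : PentFlag X => b (PentFlag.tet x)) * diagonal (PentFlag.sign (X := X) o) * (flagMatrix X F)ᵀ := by
  have h : flagGauge X o a b F = blockDiagonal' (fun u : X.simplices 4 =>
      diagonal (fun v : (u.1 : Finset ℕ) => a (u.1.erase v)) +
      diagonal (fun v : (u.1 : Finset ℕ) => b (u.1.erase v) * (o u.1 * sgn u.1 v)) *
        (Matrix.of fun v w : (u.1 : Finset ℕ) => F u.1 (u.1.erase v) (u.1.erase w))ᵀ) := by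
    unfold flagGauge
    congr 1
    funext u
    ext v w
    simp [gaugeMatrix, diagonal_apply, diagonal_mul]
  have h2 : blockDiagonal' (fun u : X.simplices 4 => diagonal
      (fun v : (u.1 : Finset ℕ) => a (u.1.erase v))) =
        diagonal (fun x : PentFlag X => a (PentFlag.tet x)) := blockDiagonal'_diagonal _
  have h3 : blockDiagonal' (fun u : X.simplices 4 => diagonal
      (fun v : (u.1 : Finset ℕ) => b (u.1.erase v) * (o u.1 * sgn u.1 v : ℂ))) =
        diagonal (fun x : PentFlag X => b (PentFlag.tet x) * PentFlag.sign o x) :=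
    blockDiagonal'_diagonal _
  rw [h]
  change blockDiagonal' ((fun u : X.simplices 4 => diagonal
      (fun v : (u.1 : Finset ℕ) => a (u.1.erase v))) + fun u : X.simplices 4 => diagonal
      (fun v : (u.1 : Finset ℕ) => b (u.1.erase v) * (o u.1 * sgn u.1 v : ℂ)) *
        (Matrix.of fun v w : (u.1 : Finset ℕ) => F u.1 (u.1.erase v) (u.1.erase w))ᵀ) = _
  rw [blockDiagonal'_add, blockDiagonal'_mul, h2, h3, diagonal_mul_diagonal]
  congr 2
  unfold flagMatrix
  rw [blockDiagonal'_transpose]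

variable {ω : cocycles X} {K q K' q' : Finset ℕ → ℂ}
  {β γ β' γ' : Finset ℕ → cocycles X →ₗ[ℂ] ℂ} {F F' : Finset ℕ → Finset ℕ → Finset ℕ → ℂ}
  {a b c e : Finset ℕ → ℂ}

/-- The annihilation relations of all pentachora at once: on the components of a cocycle, the
transposed flag matrix turns `β` into `γ` with the induced orientation. -/
theorem flagMatrix_transpose_mul {d : Type*} (f : d → cocycles X)
    (hF : ∀ u ∈ X.simplices 4, IsPentachoronMatrix X β γ (o u) u (F u)) :
    (flagMatrix X F)ᵀ * (copyMatrix X * evalMatrix β f) =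
      diagonal (PentFlag.sign (X := X) o) * (copyMatrix X * evalMatrix γ f) := by
  ext ⟨u, v⟩ i
  rw [copyMatrix_mul_evalMatrix, copyMatrix_mul_evalMatrix, diagonal_mul, Matrix.mul_apply,
    Fintype.sum_sigma, Finset.sum_eq_single u]
  · have := (hF u.1 u.2).annihilates (f i) v v.2
    simp only [transpose_apply, flagMatrix, blockDiagonal'_apply_eq, of_apply]
    change _ = (o u.1 * sgn u.1 v : ℂ) * γ (u.1.erase v) (f i)
    rw [← this, ← Finset.sum_coe_sort u.1]
    exact Finset.sum_congr rfl fun w _ => mul_comm _ _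
  · intro u' _ hu'
    refine Finset.sum_eq_zero fun w _ => ?_
    simp only [transpose_apply, flagMatrix, of_apply]
    rw [blockDiagonal'_apply_ne _ _ _ hu', zero_mul]
  · simp

theorem flagMatrix_transpose (hF : ∀ u ∈ X.simplices 4, IsPentachoronMatrix X β γ (o u) u (F u)) :
    (flagMatrix X F)ᵀ = -flagMatrix X F := by
  unfold flagMatrix
  rw [blockDiagonal'_transpose, ← blockDiagonal'_neg]
  congr 1
  funext u
  ext v w
  exact (hF u.1 u.2).skew w w.2 v v.2

theorem flagGauge_mul (ho : ∀ u ∈ X.simplices 4, (o u : ℂ) * o u = 1) {d : Type*}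
    (f : d → cocycles X)
    (hF : ∀ u ∈ X.simplices 4, IsPentachoronMatrix X β γ (o u) u (F u))
    (hg : ∀ t ∈ X.simplices 3, IsGauge K K' β γ β' γ' t (a t) (b t) (c t) (e t)) :
    flagGauge X o a b F * (copyMatrix X * evalMatrix β f) = copyMatrix X * evalMatrix β' f := by
  rw [flagGauge_eq, Matrix.add_mul, Matrix.mul_assoc, flagMatrix_transpose_mul f hF,
    Matrix.mul_assoc, ← Matrix.mul_assoc (diagonal (PentFlag.sign (X := X) o)), diagonal_sign_mul_self ho,
    Matrix.one_mul]
  simp only [copyMatrix_mul_evalMatrix]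
  ext x i
  rw [Matrix.add_apply, diagonal_mul, diagonal_mul]
  exact ((hg _ x.tet_mem).apply_left (f i)).symm

/-- Applied to the `β` of a cocycle, both sides calculate `γ' = c γ + e β` with its induced sign:
the left one from `β'` through `F'`, the right one from `γ` obtained through `F`. Such vectors span
each pentachoron, so the matrices are equal. -/
theorem flagMatrix_transpose_mul_flagGauge (hω : ∀ s ∈ X.simplices 2, ω.1 s ≠ 0)
    (hR : IsRootChoice X ω K q) (hE : IsEdgeOperators X ω K β γ)
    (ho : ∀ u ∈ X.simplices 4, (o u : ℂ) * o u = 1)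
    (hF : ∀ u ∈ X.simplices 4, IsPentachoronMatrix X β γ (o u) u (F u))
    (hF' : ∀ u ∈ X.simplices 4, IsPentachoronMatrix X β' γ' (o u) u (F' u))
    (hg : ∀ t ∈ X.simplices 3, IsGauge K K' β γ β' γ' t (a t) (b t) (c t) (e t)) :
    (flagMatrix X F')ᵀ * flagGauge X o a b F =
      diagonal (fun x : PentFlag X => e (PentFlag.tet x)) * diagonal (PentFlag.sign (X := X) o) +
        diagonal (fun x : PentFlag X => c (PentFlag.tet x)) * (flagMatrix X F)ᵀ := by
  have hloc : ∀ u : X.simplices 4,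
      (Matrix.of fun v w : (u.1 : Finset ℕ) => F' u.1 (u.1.erase v) (u.1.erase w))ᵀ *
        gaugeMatrix a b (o u.1) u.1 (F u.1) =
      diagonal (fun v : (u.1 : Finset ℕ) => e (u.1.erase v) * (o u.1 * sgn u.1 v)) +
      diagonal (fun v : (u.1 : Finset ℕ) => c (u.1.erase v)) *
        (Matrix.of fun v w : (u.1 : Finset ℕ) => F u.1 (u.1.erase v) (u.1.erase w))ᵀ := by
    intro u
    have hg' : ∀ v ∈ u.1, IsGauge K K' β γ β' γ' (u.1.erase v) (a (u.1.erase v))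
        (b (u.1.erase v)) (c (u.1.erase v)) (e (u.1.erase v)) := fun v hv =>
      hg _ (PentFlag.tet_mem ⟨u, ⟨v, hv⟩⟩)
    ext v w
    rw [← sub_eq_zero]
    refine congrFun ((hF u.1 u.2).eq_zero_of_sum hω hR hE u.2 (ho _ u.2) (y := fun w =>
      ((Matrix.of fun v w : (u.1 : Finset ℕ) => F' u.1 (u.1.erase v) (u.1.erase w))ᵀ *
        gaugeMatrix a b (o u.1) u.1 (F u.1)) v w -
      (diagonal (fun v : (u.1 : Finset ℕ) => e (u.1.erase v) * (o u.1 * sgn u.1 v)) +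
      diagonal (fun v : (u.1 : Finset ℕ) => c (u.1.erase v)) *
        (Matrix.of fun v w : (u.1 : Finset ℕ) => F u.1 (u.1.erase v) (u.1.erase w))ᵀ) v w)
      fun x => ?_) w
    have h1 := (hF u.1 u.2).annihilates x v v.2
    have h2 := (hF' u.1 u.2).annihilates x v v.2
    rw [(hg' v v.2).apply_right, ← Finset.sum_coe_sort u.1] at h2
    rw [← Finset.sum_coe_sort u.1] at h1
    simp only [mul_sub, Finset.sum_sub_distrib, Matrix.mul_apply, Matrix.add_apply, mul_add,
      Finset.sum_add_distrib, transpose_apply, of_apply, diagonal_apply, ite_mul, zero_mul, mul_ite,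
      mul_zero, Finset.sum_ite_eq, Finset.mem_univ, if_true]
    have e1 : ∑ w : (u.1 : Finset ℕ), β (u.1.erase w) x * ∑ y : (u.1 : Finset ℕ),
        F' u.1 (u.1.erase y) (u.1.erase v) * gaugeMatrix a b (o u.1) u.1 (F u.1) y w =
        ∑ y : (u.1 : Finset ℕ), β' (u.1.erase y) x * F' u.1 (u.1.erase y) (u.1.erase v) := by
      simp only [Finset.mul_sum]
      rw [Finset.sum_comm]
      refine Finset.sum_congr rfl fun y _ => ?_
      rw [gaugeMatrix_apply_beta (ho _ u.2) (hF u.1 u.2) hg', Finset.sum_mul]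
      exact Finset.sum_congr rfl fun w _ => by ring
    have e2 : ∑ w : (u.1 : Finset ℕ), β (u.1.erase w) x *
        (c (u.1.erase v) * F u.1 (u.1.erase w) (u.1.erase v)) = c (u.1.erase v) *
        ∑ w : (u.1 : Finset ℕ), β (u.1.erase w) x * F u.1 (u.1.erase w) (u.1.erase v) := by
      rw [Finset.mul_sum]
      exact Finset.sum_congr rfl fun w _ => by ring
    rw [e1, e2, h1, h2]
    ring
  have h2 : blockDiagonal' (fun u : X.simplices 4 => diagonal
      (fun v : (u.1 : Finset ℕ) => c (u.1.erase v))) =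
        diagonal (fun x : PentFlag X => c (PentFlag.tet x)) := blockDiagonal'_diagonal _
  have h3 : blockDiagonal' (fun u : X.simplices 4 => diagonal
      (fun v : (u.1 : Finset ℕ) => e (u.1.erase v) * (o u.1 * sgn u.1 v : ℂ))) =
        diagonal (fun x : PentFlag X => e (PentFlag.tet x) * PentFlag.sign o x) :=
    blockDiagonal'_diagonal _
  unfold flagMatrix flagGauge
  rw [blockDiagonal'_transpose, blockDiagonal'_transpose, ← blockDiagonal'_mul,
    diagonal_mul_diagonal, ← h2, ← h3, ← blockDiagonal'_mul, ← blockDiagonal'_add]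
  congr 1
  funext u
  exact hloc u

/-- The action of the change of roots on the components in the tetrahedra. -/
noncomputable def tetGauge (X : FinComplex) (a b c e : Finset ℕ → ℂ) :
    Matrix (X.simplices 3 ⊕ X.simplices 3) (X.simplices 3 ⊕ X.simplices 3) ℂ :=
  fromBlocks (diagonal fun t => a t.1) (diagonal fun t => b t.1) (diagonal fun t => e t.1)
    (diagonal fun t => c t.1)

/-- The change of roots acts by the same transformation on both flags of a tetrahedron, so it
commutes with taking signed sums of `β` and `γ` over the flags of that tetrahedron. -/
theorem tetGauge_mul_discrepancyMatrix (hω : ∀ s ∈ X.simplices 2, ω.1 s ≠ 0)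
    (hR : IsRootChoice X ω K q) (hE : IsEdgeOperators X ω K β γ)
    (ho : ∀ u ∈ X.simplices 4, (o u : ℂ) * o u = 1)
    (hF : ∀ u ∈ X.simplices 4, IsPentachoronMatrix X β γ (o u) u (F u))
    (hF' : ∀ u ∈ X.simplices 4, IsPentachoronMatrix X β' γ' (o u) u (F' u))
    (hg : ∀ t ∈ X.simplices 3, IsGauge K K' β γ β' γ' t (a t) (b t) (c t) (e t)) :
    tetGauge X a b c e * discrepancyMatrix X o F =
      discrepancyMatrix X o F' * flagGauge X o a b F := by
  unfold discrepancyMatrix tetGauge incidenceMatrix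
  rw [fromBlocks_mul_fromRows, fromRows_mul]
  congr 1
  · rw [flagGauge_eq, ← Matrix.mul_assoc, ← Matrix.mul_assoc, diagonal_mul_copyMatrix_transpose,
      diagonal_mul_copyMatrix_transpose, Matrix.mul_add, Matrix.mul_assoc, Matrix.mul_assoc,
      Matrix.mul_assoc, Matrix.mul_assoc]
    congr 1
    · rw [diagonal_mul_diagonal, diagonal_mul_diagonal]
      simp only [mul_comm]
    · rw [← Matrix.mul_assoc (diagonal (PentFlag.sign (X := X) o)),
        ← Matrix.mul_assoc (diagonal (PentFlag.sign (X := X) o)), diagonal_mul_diagonal,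
        diagonal_mul_diagonal]
      congr 3
      funext x
      linear_combination -(b x.tet) * x.sign_sq ho
  · rw [Matrix.mul_assoc (copyMatrix X)ᵀ, flagMatrix_transpose_mul_flagGauge hω hR hE ho hF hF' hg,
      ← Matrix.mul_assoc, ← Matrix.mul_assoc, diagonal_mul_copyMatrix_transpose,
      diagonal_mul_copyMatrix_transpose, Matrix.mul_add, Matrix.mul_assoc, Matrix.mul_assoc]

end Global

end PLFermion

namespace PLFermion

open Matrix

/-! ## The minors of the complex -/

section Minors

variable {X : FinComplex} {o : Finset ℕ → ℤ} {ω : cocycles X} {K q K' q' : Finset ℕ → ℂ}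
  {β γ β' γ' : Finset ℕ → cocycles X →ₗ[ℂ] ℂ} {F F' : Finset ℕ → Finset ℕ → Finset ℕ → ℂ}
  {a b c e : Finset ℕ → ℂ}

/-- A tetrahedron is opposite to at most one vertex of a pentachoron, so the sum has at most one
nonzero term. -/
theorem sum_erase_eq {u t : Finset ℕ} (hu : u.card = 5) (ht : t.card = 4) (g : Finset ℕ → ℂ) :
    (∑ v : u, if u.erase v = t then g (u.erase v) else 0) = if t ⊆ u then g t else 0 := by
  by_cases h : t ⊆ u
  · rw [if_pos h]
    obtain ⟨v, hv⟩ := Finset.card_eq_one.1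
      (show (u \ t).card = 1 by rw [Finset.card_sdiff_of_subset h, hu, ht])
    have hvu : v ∈ u \ t := by rw [hv]; exact Finset.mem_singleton_self v
    have hvt : u.erase v = t := by
      rw [← Finset.sdiff_singleton_eq_erase, ← hv, Finset.sdiff_sdiff_eq_self h]
    rw [Finset.sum_eq_single ⟨v, (Finset.mem_sdiff.1 hvu).1⟩]
    · rw [if_pos hvt, hvt]
    · intro w _ hw
      refine if_neg fun hwt => hw (Subtype.ext ?_)
      have : w.1 ∈ u \ t := Finset.mem_sdiff.2 ⟨w.2, by rw [← hwt]; exact Finset.notMem_erase _ _⟩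
      rw [hv] at this
      exact Finset.mem_singleton.1 this
    · simp
  · rw [if_neg h]
    exact Finset.sum_eq_zero fun v _ =>
      if_neg fun (hv : u.erase v = t) => h (hv ▸ Finset.erase_subset _ _)

theorem flagMatrix_mul_copyMatrix (t : X.simplices 3) (x : PentFlag X) :
    (flagMatrix X F * copyMatrix X) x t = if t.1 ⊆ x.1.1 then F x.1.1 x.tet t.1 else 0 := by
  obtain ⟨u, v⟩ := x
  rw [Matrix.mul_apply, Fintype.sum_sigma, Finset.sum_eq_single u]
  · rw [← sum_erase_eq (mem_simplices.1 u.2).2 (mem_simplices.1 t.2).2]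
    refine Finset.sum_congr rfl fun w _ => ?_
    rw [flagMatrix, blockDiagonal'_apply_eq, of_apply]
    change _ * (if u.1.erase w.1 = t.1 then 1 else 0) = _
    rw [mul_ite, mul_one, mul_zero]
    rfl
  · intro u' _ hu'
    refine Finset.sum_eq_zero fun w _ => ?_
    simp only [flagMatrix]
    rw [blockDiagonal'_apply_ne _ _ _ hu'.symm, zero_mul]
  · simp

/-- A pentachoron contributes exactly when both tetrahedra are its faces; the minus sign in `f₃` is
absorbed by transposing a skew-symmetric matrix. -/
theorem f₃_eq (hF : ∀ u ∈ X.simplices 4, IsPentachoronMatrix X β γ (o u) u (F u)) :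
    f₃ (X := X) F = (1 / 2 : ℂ) • ((copyMatrix X)ᵀ * (flagMatrix X F)ᵀ * copyMatrix X) := by
  ext t t'
  rw [flagMatrix_transpose hF, Matrix.mul_neg, Matrix.neg_mul, Matrix.mul_assoc, smul_neg,
    Matrix.neg_apply, Matrix.smul_apply, Matrix.mul_apply, Fintype.sum_sigma]
  have h : ∀ u : X.simplices 4, ∑ v : (u.1 : Finset ℕ), (copyMatrix X)ᵀ t ⟨u, v⟩ *
      (flagMatrix X F * copyMatrix X) ⟨u, v⟩ t' =
      if t.1 ⊆ u.1 ∧ t'.1 ⊆ u.1 then F u.1 t.1 t'.1 else 0 := by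
    intro u
    rw [ite_and, ← sum_erase_eq (mem_simplices.1 u.2).2 (mem_simplices.1 t.2).2
      (fun y => if t'.1 ⊆ u.1 then F u.1 y t'.1 else 0)]
    refine Finset.sum_congr rfl fun v _ => ?_
    rw [flagMatrix_mul_copyMatrix]
    change (if u.1.erase v.1 = t.1 then 1 else 0) * _ = _
    rw [ite_mul, one_mul, zero_mul]
    rfl
  simp only [h, f₃, of_apply, smul_eq_mul]
  rw [Finset.sum_filter, ← Finset.sum_coe_sort]
  ring

/-- The blocks of the identity express that each tetrahedron has two flags, with opposite signs. -/
theorem incidenceMatrix_mul_copyMatrix (h : splitMatrix X o * joinMatrix X o = 1) :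
    incidenceMatrix X o * copyMatrix X = 0 ∧
    (1 / 2 : ℂ) • (incidenceMatrix X o * (incidenceMatrix X o)ᵀ) = 1 ∧
    (1 / 2 : ℂ) • ((copyMatrix X)ᵀ * copyMatrix X) = 1 := by
  rw [splitMatrix, joinMatrix, Matrix.mul_smul, fromRows_mul_fromCols, fromBlocks_smul,
    ← fromBlocks_one, fromBlocks_inj] at h
  refine ⟨?_, h.1, h.2.2.2⟩
  exact (smul_eq_zero.1 h.2.1).resolve_left (by norm_num)

/-- The operator `f₃` together with the discrepancies of the first components. -/
noncomputable def extendedOperator (X : FinComplex) (o : Finset ℕ → ℤ)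
    (F : Finset ℕ → Finset ℕ → Finset ℕ → ℂ) :
    Matrix (X.simplices 3 ⊕ X.simplices 3) (X.simplices 3 ⊕ X.simplices 3) ℂ :=
  discrepancyMatrix X o F * joinMatrix X o

/-- The first half of the coordinates is itself the discrepancy of `β`. On the second half this
discrepancy is zero, the `β` are the same in both pentachora, and the discrepancy of `γ` is `f₃`. -/
theorem extendedOperator_eq (h : splitMatrix X o * joinMatrix X o = 1)
    (hF : ∀ u ∈ X.simplices 4, IsPentachoronMatrix X β γ (o u) u (F u)) :
    ∃ C, extendedOperator X o F = fromBlocks 1 0 C (f₃ (X := X) F) := by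
  obtain ⟨h1, h2, h3⟩ := incidenceMatrix_mul_copyMatrix h
  refine ⟨(1 / 2 : ℂ) • ((copyMatrix X)ᵀ * (flagMatrix X F)ᵀ * (incidenceMatrix X o)ᵀ), ?_⟩
  rw [extendedOperator, discrepancyMatrix, joinMatrix, Matrix.mul_smul, fromRows_mul_fromCols,
    fromBlocks_smul, h1, h2, smul_zero, f₃_eq hF]

variable {d : Type*}

theorem joinMatrix_mul (o : Finset ℕ → ℤ) (A : Matrix (X.simplices 3) d ℂ) :
    joinMatrix X o * fromRows (0 : Matrix (X.simplices 3) d ℂ) A = (1 / 2 : ℂ) • (copyMatrix X * A) := by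
  rw [joinMatrix, Matrix.smul_mul, fromCols_mul_fromRows, Matrix.mul_zero, zero_add]

/-- The components of one global cocycle agree in neighbouring pentachora, hence have no
discrepancy. -/
theorem extendedOperator_mul (h : splitMatrix X o * joinMatrix X o = 1)
    (hF : ∀ u ∈ X.simplices 4, IsPentachoronMatrix X β γ (o u) u (F u)) (f : d → cocycles X) :
    extendedOperator X o F * fromRows (0 : Matrix (X.simplices 3) d ℂ) (evalMatrix β f) = 0 := by
  obtain ⟨h1, h2, h3⟩ := incidenceMatrix_mul_copyMatrix h
  rw [extendedOperator, Matrix.mul_assoc, joinMatrix_mul, Matrix.mul_smul, discrepancyMatrix,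
    fromRows_mul, Matrix.mul_assoc, flagMatrix_transpose_mul f hF, ← Matrix.mul_assoc,
    ← Matrix.mul_assoc, h1, Matrix.zero_mul]
  rw [incidenceMatrix] at h1
  rw [← Matrix.mul_assoc, h1, Matrix.zero_mul, fromRows_zero, smul_zero]

/-- The transposed annihilation relations: by skew symmetry of `F` the contributions of `γ` and `β`
cancel in every flag. -/
theorem mul_extendedOperator (hF : ∀ u ∈ X.simplices 4, IsPentachoronMatrix X β γ (o u) u (F u))
    (f : d → cocycles X) :
    fromCols (evalMatrix γ f)ᵀ (evalMatrix β f)ᵀ * extendedOperator X o F = 0 := by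
  have h := congrArg Matrix.transpose (flagMatrix_transpose_mul f hF)
  rw [flagMatrix_transpose hF, Matrix.neg_mul, transpose_neg, transpose_mul, transpose_mul,
    transpose_mul, transpose_mul, diagonal_transpose, Matrix.mul_assoc, Matrix.mul_assoc] at h
  rw [extendedOperator, ← Matrix.mul_assoc, discrepancyMatrix, fromCols_mul_fromRows,
    incidenceMatrix, ← h, neg_add_cancel, Matrix.zero_mul]

/-- The row `(γ, β)` is dual to the column `(β, γ)` for the hyperbolic form, which the change of
roots preserves. -/
theorem mul_tetGauge (f : d → cocycles X)
    (hg : ∀ t ∈ X.simplices 3, IsGauge K K' β γ β' γ' t (a t) (b t) (c t) (e t)) :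
    fromCols (evalMatrix γ' f)ᵀ (evalMatrix β' f)ᵀ * tetGauge X a b c e =
      fromCols (evalMatrix γ f)ᵀ (evalMatrix β f)ᵀ := by
  rw [tetGauge, fromCols_mul_fromBlocks]
  congr 1
  · ext i t
    have g := hg t.1 t.2
    simp only [Matrix.add_apply, mul_diagonal, transpose_apply, evalMatrix, of_apply,
      g.apply_left, g.apply_right]
    linear_combination γ t.1 (f i) * g.perm + 2 * β t.1 (f i) * g.left
  · ext i t
    have g := hg t.1 t.2
    simp only [Matrix.add_apply, mul_diagonal, transpose_apply, evalMatrix, of_apply,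
      g.apply_left, g.apply_right]
    linear_combination β t.1 (f i) * g.perm + 2 * γ t.1 (f i) * g.right

variable [Fintype d] [DecidableEq d]

/-- The identity block of the triangular form splits off, because the borders only touch the
coordinates of `f₃`. -/
theorem det_border_extendedOperator (h : splitMatrix X o * joinMatrix X o = 1)
    (hF : ∀ u ∈ X.simplices 4, IsPentachoronMatrix X β γ (o u) u (F u)) (i : d ↪ X.simplices 3)
    [Fintype {t // t ∉ Set.range i}] [DecidableEq {t // t ∉ Set.range i}] :
    (fromBlocks (extendedOperator X o F) (fromRows (0 : Matrix (X.simplices 3) d ℂ) (selection i)) (fromCols (0 : Matrix d (X.simplices 3) ℂ) (selection i)ᵀ)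
      0).det = (fromBlocks 0 1 1 0 : Matrix (d ⊕ d) (d ⊕ d) ℂ).det *
        ((f₃ (X := X) F).submatrix (Subtype.val : {t // t ∉ Set.range i} → X.simplices 3)
          Subtype.val).det := by
  obtain ⟨C, hC⟩ := extendedOperator_eq h hF
  rw [hC, ← det_border_selection, ← det_submatrix_equiv_self (Equiv.sumAssoc _ _ _).symm]
  have : (fromBlocks (fromBlocks (1 : Matrix (X.simplices 3) (X.simplices 3) ℂ) 0 C (f₃ (X := X) F)) (fromRows (0 : Matrix (X.simplices 3) d ℂ) (selection i))
      (fromCols (0 : Matrix d (X.simplices 3) ℂ) (selection i)ᵀ) 0).submatrix (Equiv.sumAssoc _ _ _).symm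
        (Equiv.sumAssoc _ _ _).symm =
      fromBlocks (1 : Matrix (X.simplices 3) (X.simplices 3) ℂ) 0 (fromRows C 0)
        (fromBlocks (f₃ (X := X) F) (selection i) (selection i)ᵀ 0) := by
    ext x y
    rcases x with x | x | x <;> rcases y with y | y | y <;> rfl
  rw [this, det_fromBlocks_zero₁₂, det_one, one_mul]

theorem det_fromBlocks_swap_ne_zero :
    (fromBlocks 0 1 1 0 : Matrix (d ⊕ d) (d ⊕ d) ℂ).det ≠ 0 := by
  have h : (fromBlocks 0 1 1 0 : Matrix (d ⊕ d) (d ⊕ d) ℂ) * fromBlocks 0 1 1 0 = 1 := by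
    rw [fromBlocks_multiply]; simp
  intro h0
  have := congrArg Matrix.det h
  rw [det_mul, h0, zero_mul, det_one] at this
  exact zero_ne_one this

/-- The dependence of the minors of the complex on the choice of roots. -/
theorem minor_gauge (h : splitMatrix X o * joinMatrix X o = 1)
    (h' : joinMatrix X o * splitMatrix X o = 1)
    (hω : ∀ s ∈ X.simplices 2, ω.1 s ≠ 0)
    (hR : IsRootChoice X ω K q) (hE : IsEdgeOperators X ω K β γ)
    (ho : ∀ u ∈ X.simplices 4, (o u : ℂ) * o u = 1)
    (hF : ∀ u ∈ X.simplices 4, IsPentachoronMatrix X β γ (o u) u (F u))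
    (hF' : ∀ u ∈ X.simplices 4, IsPentachoronMatrix X β' γ' (o u) u (F' u))
    (hg : ∀ t ∈ X.simplices 3, IsGauge K K' β γ β' γ' t (a t) (b t) (c t) (e t))
    (f : d → cocycles X) (i i' : d ↪ X.simplices 3)
    [Fintype {t // t ∉ Set.range i}] [DecidableEq {t // t ∉ Set.range i}]
    [Fintype {t // t ∉ Set.range i'}] [DecidableEq {t // t ∉ Set.range i'}] :
    ((f₃ (X := X) F').submatrix (Subtype.val : {t // t ∉ Set.range i'} → X.simplices 3)
      Subtype.val).det * (∏ u ∈ X.simplices 4, (gaugeMatrix a b (o u) u (F u)).det) *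
        ((evalMatrix β f).submatrix i id).det ^ 2 =
    (∏ t ∈ X.simplices 3, (a t * c t - b t * e t)) *
      ((f₃ (X := X) F).submatrix (Subtype.val : {t // t ∉ Set.range i} → X.simplices 3)
        Subtype.val).det * ((evalMatrix β' f).submatrix i' id).det ^ 2 := by
  obtain ⟨h1, h2, h3⟩ := incidenceMatrix_mul_copyMatrix h
  -- The intertwining relation for discrepancies, with `joinMatrix * splitMatrix = 1` inserted to
  -- make all matrices square on the same index set.
  have hconj : tetGauge X a b c e * extendedOperator X o F = extendedOperator X o F' *
      (splitMatrix X o * flagGauge X o a b F * joinMatrix X o) := by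
    rw [extendedOperator, ← Matrix.mul_assoc, tetGauge_mul_discrepancyMatrix hω hR hE ho hF hF' hg,
      extendedOperator, Matrix.mul_assoc (splitMatrix X o), Matrix.mul_assoc,
      Matrix.mul_assoc (discrepancyMatrix X o F'), ← Matrix.mul_assoc (joinMatrix X o), h',
      Matrix.one_mul]
  have hN : splitMatrix X o * flagGauge X o a b F * joinMatrix X o *
      fromRows (0 : Matrix (X.simplices 3) d ℂ) (evalMatrix β f) = fromRows (0 : Matrix (X.simplices 3) d ℂ) (evalMatrix β' f) := by
    have hs : ∀ A : Matrix (X.simplices 3) d ℂ,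
        (1 / 2 : ℂ) • fromRows (0 : Matrix (X.simplices 3) d ℂ) A =
          fromRows (0 : Matrix (X.simplices 3) d ℂ) ((1 / 2 : ℂ) • A) := by
      intro A
      ext (x | x) y <;> simp
    rw [Matrix.mul_assoc, joinMatrix_mul, Matrix.mul_smul, Matrix.mul_assoc,
      flagGauge_mul ho f hF hg, splitMatrix, fromRows_mul, ← Matrix.mul_assoc, ← Matrix.mul_assoc,
      h1, Matrix.zero_mul, hs, ← Matrix.smul_mul, h3, Matrix.one_mul]
  -- Right and left null vectors paired with the borders give the same minor of `f₂`, up to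
  -- transposition; this is why it occurs squared.
  have hQ : ∀ (β : Finset ℕ → cocycles X →ₗ[ℂ] ℂ) (i : d ↪ X.simplices 3),
      fromCols (0 : Matrix d (X.simplices 3) ℂ) (selection i)ᵀ *
        fromRows (0 : Matrix (X.simplices 3) d ℂ) (evalMatrix β f) =
          (evalMatrix β f).submatrix i id := by
    intro β i
    rw [fromCols_mul_fromRows, Matrix.zero_mul, zero_add, selection_transpose_mul]
  have hP : ∀ (β γ : Finset ℕ → cocycles X →ₗ[ℂ] ℂ) (i : d ↪ X.simplices 3),
      fromCols (evalMatrix γ f)ᵀ (evalMatrix β f)ᵀ *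
        fromRows (0 : Matrix (X.simplices 3) d ℂ) (selection i) =
          ((evalMatrix β f).submatrix i id)ᵀ := by
    intro β γ i
    rw [fromCols_mul_fromRows, Matrix.mul_zero, zero_add, mul_selection]
    rfl
  have hS : (tetGauge X a b c e).det = ∏ t ∈ X.simplices 3, (a t * c t - b t * e t) := by
    rw [tetGauge, det_fromBlocks_diagonal,
      ← Finset.prod_coe_sort (X.simplices 3) fun t => a t * c t - b t * e t]
  have hM : (splitMatrix X o * flagGauge X o a b F * joinMatrix X o).det =
      ∏ u ∈ X.simplices 4, (gaugeMatrix a b (o u) u (F u)).det := by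
    rw [det_conj_of_mul_eq_one h h', flagGauge, det_blockDiagonal'_sigma,
      ← Finset.prod_coe_sort (X.simplices 4) fun u => (gaugeMatrix a b (o u) u (F u)).det]
  have key := det_border_conj hconj (extendedOperator_mul h hF f) (mul_extendedOperator hF' f)
    (mul_tetGauge f hg) (fromRows (0 : Matrix (X.simplices 3) d ℂ) (selection i))
    (fromRows (0 : Matrix (X.simplices 3) d ℂ) (selection i'))
    (fromCols (0 : Matrix d (X.simplices 3) ℂ) (selection i)ᵀ)
    (fromCols (0 : Matrix d (X.simplices 3) ℂ) (selection i')ᵀ)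
  rw [det_border_extendedOperator h hF, det_border_extendedOperator h hF', hN, hQ, hQ, hP, hP,
    hS, hM, det_transpose, det_transpose] at key
  refine mul_left_cancel₀ (det_fromBlocks_swap_ne_zero (d := d)) ?_
  linear_combination key

end Minors

end PLFermion

/-! ### Independence of the torsion from the omitted basis cocycle -/

namespace PLFermion

open Matrix

section Torsion

variable {X : FinComplex}

/-- The principal minor of a matrix whose rows and columns are outside a given set. -/
noncomputable def complMinor {n : Type*} [Fintype n] (A : Matrix n n ℂ) (S : Set n) : ℂ := by
  classical
  exact (A.submatrix (Subtype.val : {t // t ∉ S} → n) Subtype.val).det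

/-- Removes the dependence on finiteness and decidability instances, so that minors over equal sets
can be identified. -/
theorem det_submatrix_compl {n : Type*} [Fintype n] (A : Matrix n n ℂ) (S : Set n)
    [Fintype {t // t ∉ S}] [DecidableEq {t // t ∉ S}] :
    (A.submatrix (Subtype.val : {t // t ∉ S} → n) Subtype.val).det = complMinor A S := by
  unfold complMinor
  congr!

variable {ι : Type} (b : Module.Basis ι ℂ (cocycles X)) {ω : cocycles X}
  {β : Finset ℕ → cocycles X →ₗ[ℂ] ℂ} {F : Finset ℕ → Finset ℕ → Finset ℕ → ℂ} {τ : ℂ}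

theorem sum_repr_mul_eq_zero [Fintype ι] {t : Finset ℕ} (h : β t ω = 0) :
    ∑ i, b.repr ω i * β t (b i) = 0 := by
  rw [← h]
  conv_rhs => rw [← b.sum_repr ω]
  rw [map_sum]
  exact Finset.sum_congr rfl fun i _ => by rw [map_smul, smul_eq_mul]

variable [Fintype ι] [DecidableEq ι]

/-- The dependence of a minor of `f₂` on the basis cocycle that is left out. -/
theorem repr_mul_det_swap (hβ : ∀ t ∈ X.simplices 3, β t ω = 0) {r₀ r : ι} (hr : r ≠ r₀)
    (e : {i : ι // i ≠ r₀} → X.simplices 3) :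
    b.repr ω r₀ * (Matrix.of fun j i : {i : ι // i ≠ r₀} =>
        β (e j).1 (b (Equiv.swap r r₀ i.1))).det =
      -b.repr ω r * (Matrix.of fun j i : {i : ι // i ≠ r₀} => β (e j).1 (b i.1)).det := by
  set A : Matrix {i : ι // i ≠ r₀} {i : ι // i ≠ r₀} ℂ :=
    Matrix.of fun j i => β (e j).1 (b i.1) with hA
  have h : (Matrix.of fun j i : {i : ι // i ≠ r₀} => β (e j).1 (b (Equiv.swap r r₀ i.1))) =
      A.updateCol ⟨r, hr⟩ fun j => β (e j).1 (b r₀) := by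
    ext j i
    rw [updateCol_apply, of_apply]
    split_ifs with hi
    · rw [hi, Equiv.swap_apply_left]
    · rw [Equiv.swap_apply_of_ne_of_ne (fun h => hi (Subtype.ext h)) i.2, hA, of_apply]
  -- Since `β_t(ω) = 0`, the column of `b r₀`, multiplied by its coefficient in `ω`, is minus the
  -- combination of the other columns; only the term with `r` survives in the determinant.
  have h2 := Matrix.det_updateCol_sum A ⟨r, hr⟩ fun i => -b.repr ω i.1
  rw [h, ← det_updateCol_smul, ← smul_eq_mul (-_), ← h2]
  congr 2
  funext j
  have h3 := sum_repr_mul_eq_zero b (hβ (e j).1 (e j).2)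
  rw [Fintype.sum_eq_add_sum_subtype_ne _ r₀] at h3
  simp only [Pi.smul_apply, smul_eq_mul, neg_mul, Finset.sum_neg_distrib, hA, of_apply]
  linear_combination h3

/-- The minors of `f₂` and its transpose `f₄` coincide, as do those of `f₁` and `f₅`; clearing
denominators leaves squares. -/
theorem IsTorsion.exists_eq (h : IsTorsion b ω β F τ) :
    ∃ (r : ι) (e : {i : ι // i ≠ r} ↪ X.simplices 3), b.repr ω r ≠ 0 ∧
      ((evalMatrix β fun i : {i : ι // i ≠ r} => b i).submatrix e id).det ≠ 0 ∧
      τ * ((evalMatrix β fun i : {i : ι // i ≠ r} => b i).submatrix e id).det ^ 2 =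
        b.repr ω r ^ 2 * complMinor (f₃ (X := X) F) (Set.range e) := by
  obtain ⟨r, e, h1, h2, -, -, -, hτ⟩ := h
  refine ⟨r, e, h1, h2, ?_⟩
  have h4 : ((f₄ b β).submatrix Subtype.val e).det =
      ((evalMatrix β fun i : {i : ι // i ≠ r} => b i).submatrix e id).det :=
    det_transpose ((evalMatrix β fun i : {i : ι // i ≠ r} => b i).submatrix e id)
  have h2' : ((evalMatrix β fun i : {i : ι // i ≠ r} => b i).submatrix e id).det ≠ 0 := h2
  have h5 : ((f₂ b β).submatrix e Subtype.val).det =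
      ((evalMatrix β fun i : {i : ι // i ≠ r} => b i).submatrix e id).det := rfl
  have h6 : f₁ b ω r () = b.repr ω r := rfl
  have h7 : f₅ b ω () r = b.repr ω r := rfl
  rw [h4, h5, h6, h7, det_submatrix_compl] at hτ
  rw [hτ]
  generalize ((evalMatrix β fun i : {i : ι // i ≠ r} => b i).submatrix e id).det = D at h2' ⊢
  generalize complMinor (f₃ (X := X) F) (Set.range e) = m
  field_simp

/-- Two torsions may omit different basis cocycles, and this brings them to a common one. With the
set of tetrahedra fixed, the minors of `f₂` are proportional, up to sign, to the coordinates of `ω`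
at the omitted indices, which cancels against the minors of `f₁` and `f₅`. -/
theorem IsTorsion.exists_embedding (hβ : ∀ t ∈ X.simplices 3, β t ω = 0)
    (h : IsTorsion b ω β F τ) {r : ι} (hr : b.repr ω r ≠ 0) :
    ∃ e : {i : ι // i ≠ r} ↪ X.simplices 3,
      ((evalMatrix β fun i : {i : ι // i ≠ r} => b i).submatrix e id).det ≠ 0 ∧
      τ * ((evalMatrix β fun i : {i : ι // i ≠ r} => b i).submatrix e id).det ^ 2 =
        b.repr ω r ^ 2 * complMinor (f₃ (X := X) F) (Set.range e) := by
  obtain ⟨r₀, e, h1', h2', hτ'⟩ := h.exists_eq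
  by_cases hrr : r = r₀
  · subst hrr
    exact ⟨e, h2', hτ'⟩
  · let σ : {i : ι // i ≠ r} ≃ {i : ι // i ≠ r₀} :=
      (Equiv.swap r r₀).subtypeEquiv fun i => by
        rw [not_iff_not, Equiv.swap_apply_eq_iff, Equiv.swap_apply_right]
    have hD : b.repr ω r₀ * ((evalMatrix β fun i : {i : ι // i ≠ r} => b i).submatrix
        (σ.toEmbedding.trans e) id).det = -b.repr ω r *
          ((evalMatrix β fun i : {i : ι // i ≠ r₀} => b i).submatrix e id).det := by
      have := repr_mul_det_swap b hβ hrr e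
      rw [← det_submatrix_equiv_self σ.symm]
      convert this using 3
      · ext j i
        simp [evalMatrix, σ]
      · rfl
    have hrange : Set.range (σ.toEmbedding.trans e) = Set.range e :=
      σ.surjective.range_comp e
    refine ⟨σ.toEmbedding.trans e, ?_, ?_⟩
    · intro h0
      rw [h0, mul_zero] at hD
      exact (mul_ne_zero (neg_ne_zero.2 hr) h2') hD.symm
    · rw [hrange]
      refine mul_left_cancel₀ (pow_ne_zero 2 h1') ?_
      calc _ = τ * (b.repr ω r₀ * ((evalMatrix β fun i : {i : ι // i ≠ r} => b i).submatrix
            (σ.toEmbedding.trans e) id).det) ^ 2 := by ring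
        _ = b.repr ω r ^ 2 * (τ *
            ((evalMatrix β fun i : {i : ι // i ≠ r₀} => b i).submatrix e id).det ^ 2) := by
          rw [hD]; ring
        _ = _ := by rw [hτ']; ring

end Torsion

end PLFermion

namespace PLFermion

/-! ## Closed oriented triangulations -/

/-- The faces of the complex are two different vertices. -/
def IsPairOfPoints (X : PreAbstractSimplicialComplex ℕ) : Prop :=
  ∃ x y : ℕ, x ≠ y ∧ ∀ τ, τ ∈ X.faces ↔ τ = {x} ∨ τ = {y}

/-- Starring an isolated vertex merely replaces it by the new one, since `∅` is the only admissible
`ρ`. -/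
theorem IsPairOfPoints.starring {X Y : PreAbstractSimplicialComplex ℕ} {σ : Finset ℕ} {a x y : ℕ}
    (hxy : x ≠ y) (hX : ∀ τ, τ ∈ X.faces ↔ τ = {x} ∨ τ = {y}) (hσ : σ = {x}) (ha : {a} ∉ X.faces)
    (hY : ∀ τ : Finset ℕ, τ ∈ Y.faces ↔ (τ ∈ X.faces ∧ ¬ σ ⊆ τ) ∨
      ∃ ρ : Finset ℕ, ρ ∪ σ ∈ X.faces ∧ ¬ σ ⊆ ρ ∧ τ = insert a ρ) : IsPairOfPoints Y := by
  subst hσ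
  rw [hX, not_or, Finset.singleton_inj, Finset.singleton_inj] at ha
  refine ⟨y, a, fun h => ha.2 h.symm, fun τ => ?_⟩
  simp only [hY, hX, Finset.singleton_subset_iff]
  constructor
  · rintro (⟨rfl | rfl, h⟩ | ⟨ρ, h1 | h1, h2, rfl⟩)
    · simp at h
    · exact Or.inl rfl
    · right
      have : ρ = ∅ := by
        refine Finset.eq_empty_of_forall_notMem fun z hz => ?_
        have hz' : z ∈ ρ ∪ {x} := Finset.mem_union_left _ hz
        rw [h1, Finset.mem_singleton] at hz'
        exact h2 (hz' ▸ hz)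
      rw [this]
      rfl
    · have : x ∈ ρ ∪ {x} := by simp
      rw [h1, Finset.mem_singleton] at this
      exact absurd this hxy
  · rintro (rfl | rfl)
    · exact Or.inl ⟨Or.inr rfl, by simpa using hxy⟩
    · exact Or.inr ⟨∅, Or.inl (by simp), by simp, by simp⟩

theorem IsStarring.isPairOfPoints {X Y : PreAbstractSimplicialComplex ℕ} (h : IsStarring X Y)
    (hX : IsPairOfPoints X) : IsPairOfPoints Y := by
  obtain ⟨σ, hσ, a, ha, hY⟩ := h
  obtain ⟨x, y, hxy, hX⟩ := hX
  rcases (hX σ).1 hσ with h | h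
  · exact IsPairOfPoints.starring hxy hX h ha hY
  · exact IsPairOfPoints.starring hxy.symm (fun τ => by rw [hX, or_comm]) h ha hY

/-- In a complex of two points the new vertex `a` is isolated. If `σ` had more than one vertex, or
were contained in a larger face, starring would produce an edge at `a`; so `σ` was an isolated
vertex, now called `a`. -/
theorem IsStarring.isPairOfPoints_of_starred {X Y : PreAbstractSimplicialComplex ℕ}
    (h : IsStarring X Y) (hY : IsPairOfPoints Y) : IsPairOfPoints X := by
  obtain ⟨σ, hσ, a, ha, hXY⟩ := h
  have hσn : σ.Nonempty := (X.isRelLowerSet_faces hσ).1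
  obtain ⟨q, hq, hY⟩ : ∃ q, a ≠ q ∧ ∀ τ, τ ∈ Y.faces ↔ τ = {a} ∨ τ = {q} := by
    obtain ⟨x, y, hxy, hY⟩ := hY
    have : {a} ∈ Y.faces := (hXY {a}).2 (Or.inr ⟨∅, by simpa using hσ, by
      simpa [Finset.subset_empty] using hσn.ne_empty, by simp⟩)
    rcases (hY _).1 this with h | h
    · rw [Finset.singleton_inj] at h
      exact ⟨y, h ▸ hxy, h ▸ hY⟩
    · rw [Finset.singleton_inj] at h
      exact ⟨x, h ▸ hxy.symm, fun τ => by rw [hY, h, or_comm]⟩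
  have hins : ∀ ρ : Finset ℕ, insert a ρ ∈ Y.faces → ρ ⊆ {a} := by
    intro ρ h
    have h' : insert a ρ = {a} := by
      refine ((hY _).1 h).resolve_right fun h => hq ?_
      have := Finset.mem_insert_self a ρ
      rwa [h, Finset.mem_singleton] at this
    exact h' ▸ Finset.subset_insert _ _
  have hvert : ∀ τ ∈ X.faces, a ∉ τ := fun τ hτ h => ha
    ((X.isRelLowerSet_faces hτ).2 (Finset.singleton_subset_iff.2 h) (Finset.singleton_nonempty a))
  obtain ⟨z, hz⟩ := hσn
  have hσz : σ = {z} := by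
    by_contra hne
    have h1 : ¬ σ ⊆ {z} := fun h => hne (Finset.Subset.antisymm h (by simpa using hz))
    have h2 : insert a {z} ∈ Y.faces := (hXY _).2 (Or.inr ⟨{z}, by
      rwa [Finset.union_eq_right.2 (by simpa using hz)], h1, rfl⟩)
    have h3 := hins _ h2 (Finset.mem_singleton_self z)
    rw [Finset.mem_singleton] at h3
    exact hvert σ hσ (h3 ▸ hz)
  subst hσz
  have hqX : {q} ∈ X.faces ∧ ¬ ({z} : Finset ℕ) ⊆ {q} := by
    refine ((hXY {q}).1 ((hY _).2 (Or.inr rfl))).resolve_right ?_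
    rintro ⟨ρ, -, -, h⟩
    have := Finset.mem_insert_self a ρ
    rw [← h, Finset.mem_singleton] at this
    exact hq this
  refine ⟨z, q, fun h => hqX.2 (by rw [h]), fun τ => ⟨fun hτ => ?_, ?_⟩⟩
  · by_cases hzτ : z ∈ τ
    · left
      have h1 : insert a (τ.erase z) ∈ Y.faces := (hXY _).2 (Or.inr ⟨τ.erase z, by
        rwa [Finset.union_comm, ← Finset.insert_eq, Finset.insert_erase hzτ], by simp, rfl⟩)
      have h2 : τ.erase z = ∅ := Finset.eq_empty_of_forall_notMem fun w hw => by
        have h3 := hins _ h1 hw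
        rw [Finset.mem_singleton] at h3
        exact hvert τ hτ (h3 ▸ Finset.mem_of_mem_erase hw)
      rw [← Finset.insert_erase hzτ, h2]
      rfl
    · right
      refine ((hY τ).1 ((hXY τ).2 (Or.inl ⟨hτ, by simpa using hzτ⟩))).resolve_left ?_
      rintro rfl
      exact ha hτ
  · rintro (rfl | rfl)
    · exact hσ
    · exact hqX.1

theorem isPairOfPoints_simplexBoundary {A : Finset ℕ} (hA : A.card = 2) :
    IsPairOfPoints (simplexBoundary A) := by
  obtain ⟨x, y, hxy, rfl⟩ := Finset.card_eq_two.1 hA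
  refine ⟨x, y, hxy, fun τ => ⟨?_, ?_⟩⟩
  · rintro ⟨h1, h2⟩
    have h3 := Finset.card_lt_card h2
    have h4 := Finset.card_pos.2 h1
    obtain ⟨z, rfl⟩ := Finset.card_eq_one.1 (show τ.card = 1 by omega)
    have h5 := h2.1 (Finset.mem_singleton_self z)
    simpa using h5
  · have hs : ∀ z ∈ ({x, y} : Finset ℕ), {z} ∈ (simplexBoundary {x, y}).faces := fun z hz =>
      ⟨Finset.singleton_nonempty z, Finset.ssubset_iff_subset_ne.2 ⟨by simpa using hz, fun h => by
        have := congrArg Finset.card h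
        rw [hA, Finset.card_singleton] at this
        omega⟩⟩
    rintro (rfl | rfl)
    · exact hs _ (by simp)
    · exact hs _ (by simp)

/-- A zero-dimensional PL sphere consists of two points. -/
theorem IsPLSphere.isPairOfPoints {X : PreAbstractSimplicialComplex ℕ} (h : IsPLSphere 0 X) :
    IsPairOfPoints X := by
  obtain ⟨A, -, hA, h⟩ := h
  have key : ∀ Y Z, Relation.EqvGen IsStarring Y Z → (IsPairOfPoints Y ↔ IsPairOfPoints Z) := by
    intro Y Z h
    induction h with
    | rel _ _ h => exact ⟨h.isPairOfPoints, h.isPairOfPoints_of_starred⟩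
    | refl => exact Iff.rfl
    | symm _ _ _ ih => exact ih.symm
    | trans _ _ _ _ _ ih ih' => exact ih.trans ih'
  exact (key _ _ h).1 (isPairOfPoints_simplexBoundary (by omega))

section Closed

variable (M : Triangulation)

/-- Every tetrahedron lies in exactly two pentachora. -/
theorem Triangulation.card_filter_subset {t : Finset ℕ} (ht : t ∈ M.simplices 3) :
    ((M.simplices 4).filter (t ⊆ ·)).card = 2 := by
  obtain ⟨htf, htc⟩ := mem_simplices.1 ht
  have h := M.link_sphere t htf
  rw [htc] at h
  obtain ⟨x, y, hxy, hl⟩ := IsPLSphere.isPairOfPoints (by simpa using h)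
  have hx : ({x} : Finset ℕ) ∈ (link M.toPreAbstractSimplicialComplex t).faces :=
    (hl _).2 (Or.inl rfl)
  have hy : ({y} : Finset ℕ) ∈ (link M.toPreAbstractSimplicialComplex t).faces :=
    (hl _).2 (Or.inr rfl)
  obtain ⟨-, hx1, hx2⟩ := hx
  obtain ⟨-, hy1, hy2⟩ := hy
  rw [Finset.disjoint_singleton_left] at hx1 hy1
  rw [← Finset.insert_eq] at hx2 hy2
  -- Pentachora containing `t` correspond to vertices of its link, which is a sphere of dimension `4
  -- - 4 = 0`.
  have : (M.simplices 4).filter (t ⊆ ·) = {insert x t, insert y t} := by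
    ext u
    rw [Finset.mem_filter, mem_simplices, Finset.mem_insert, Finset.mem_singleton]
    constructor
    · rintro ⟨⟨hu, huc⟩, htu⟩
      obtain ⟨v, hv⟩ := Finset.card_eq_one.1
        (show (u \ t).card = 1 by rw [Finset.card_sdiff_of_subset htu, huc, htc])
      have huv : u = insert v t := by
        rw [Finset.insert_eq, ← hv, Finset.sdiff_union_of_subset htu]
      have hvt : v ∉ t := (Finset.mem_sdiff.1 (hv ▸ Finset.mem_singleton_self v)).2
      have hvl : ({v} : Finset ℕ) ∈ (link M.toPreAbstractSimplicialComplex t).faces :=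
        ⟨Finset.singleton_nonempty v, Finset.disjoint_singleton_left.2 hvt, by
          rwa [← Finset.insert_eq, ← huv]⟩
      rcases (hl _).1 hvl with h | h <;> rw [Finset.singleton_inj] at h <;> subst h
      · exact Or.inl huv
      · exact Or.inr huv
    · rintro (rfl | rfl)
      · exact ⟨⟨hx2, by rw [Finset.card_insert_of_notMem hx1, htc]⟩, Finset.subset_insert _ _⟩
      · exact ⟨⟨hy2, by rw [Finset.card_insert_of_notMem hy1, htc]⟩, Finset.subset_insert _ _⟩
  rw [this, Finset.card_pair]
  intro h
  have := Finset.mem_insert_self x t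
  rw [h, Finset.mem_insert] at this
  exact this.elim hxy hx1

theorem Triangulation.prod_prod_erase {R : Type*} [CommMonoid R] (g : Finset ℕ → R) :
    ∏ u ∈ M.simplices 4, ∏ v ∈ u, g (u.erase v) = ∏ t ∈ M.simplices 3, g t ^ 2 := by
  have h : ∀ u ∈ M.simplices 4, ∏ v ∈ u, g (u.erase v) =
      ∏ t ∈ (M.simplices 3).filter (· ⊆ u), g t := by
    intro u hu
    have huc := (mem_simplices.1 hu).2
    refine Finset.prod_bij (fun v _ => u.erase v) (fun v hv => ?_) (fun v hv w hw h => ?_)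
      (fun t ht => ?_) fun v _ => rfl
    · exact Finset.mem_filter.2 ⟨mem_simplices_of_subset hu (Finset.erase_subset _ _)
        (by rw [Finset.card_erase_of_mem hv, huc]), Finset.erase_subset _ _⟩
    · by_contra hne
      exact Finset.notMem_erase v u (h ▸ Finset.mem_erase.2 ⟨hne, hv⟩)
    · obtain ⟨ht, htu⟩ := Finset.mem_filter.1 ht
      obtain ⟨v, hv⟩ := Finset.card_eq_one.1
        (show (u \ t).card = 1 by
          rw [Finset.card_sdiff_of_subset htu, huc, (mem_simplices.1 ht).2])
      exact ⟨v, (Finset.mem_sdiff.1 (hv ▸ Finset.mem_singleton_self v)).1, by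
        rw [← Finset.sdiff_singleton_eq_erase, ← hv, Finset.sdiff_sdiff_eq_self htu]⟩
  rw [Finset.prod_congr rfl h, Finset.prod_comm' (t' := M.simplices 3)
    (s' := fun t => (M.simplices 4).filter (t ⊆ ·))
    (by intro x y; simp only [Finset.mem_filter]; tauto)]
  refine Finset.prod_congr rfl fun t ht => ?_
  rw [Finset.prod_const, M.card_filter_subset ht]

/-- A triangle in a pentachoron lies in the tetrahedra opposite to the two vertices outside it. -/
theorem prod_erase_powersetCard {R : Type*} [CommMonoid R] {u : Finset ℕ} (hu : u.card = 5)
    (g : Finset ℕ → R) :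
    ∏ v ∈ u, ∏ s ∈ (u.erase v).powersetCard 3, g s = ∏ s ∈ u.powersetCard 3, g s ^ 2 := by
  rw [Finset.prod_comm' (t' := u.powersetCard 3) (s' := fun s => u \ s)]
  · refine Finset.prod_congr rfl fun s hs => ?_
    obtain ⟨h1, h2⟩ := Finset.mem_powersetCard.1 hs
    rw [Finset.prod_const, Finset.card_sdiff_of_subset h1, hu, h2]
  · intro v s
    rw [Finset.mem_powersetCard, Finset.mem_powersetCard, Finset.subset_erase, Finset.mem_sdiff]
    tauto

/-- Every 2-face lies in as many tetrahedra as pentachora. -/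
theorem Triangulation.prod_prod_powersetCard (ρ : Finset ℕ → ℂ) :
    ∏ u ∈ M.simplices 4, ∏ s ∈ u.powersetCard 3, ρ s =
      ∏ t ∈ M.simplices 3, ∏ s ∈ t.powersetCard 3, ρ s := by
  -- Flags "face, tetrahedron, pentachoron" count every pair "face, pentachoron" twice, and every
  -- pair "face, tetrahedron" twice. Starting from square roots of `ρ` gives the equality itself
  -- rather than that of squares.
  have h : ∀ s, ∃ z : ℂ, z ^ 2 = ρ s := fun s => IsAlgClosed.exists_pow_nat_eq (ρ s) two_pos
  choose σ hσ using h
  have h1 := M.prod_prod_erase fun t => ∏ s ∈ t.powersetCard 3, σ s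
  rw [Finset.prod_congr rfl fun u hu => prod_erase_powersetCard (mem_simplices.1 hu).2 σ] at h1
  simpa only [← Finset.prod_pow, hσ] using h1

open Matrix

/-- For flags of one tetrahedron the entry is half of `1` plus the product of signs: `1` on the
diagonal and, by coherence of orientations, `0` for two different pentachora. -/
theorem Triangulation.joinMatrix_mul_splitMatrix :
    joinMatrix M.toFinComplex M.orient * splitMatrix M.toFinComplex M.orient = 1 := by
  have ho : ∀ u ∈ M.simplices 4, (M.orient u : ℂ) * M.orient u = 1 := fun u hu => by
    rcases M.orient_eq u hu with h | h <;> simp [h]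
  rw [joinMatrix, splitMatrix, Matrix.smul_mul, fromCols_mul_fromRows]
  ext x y
  have h1 : ((incidenceMatrix M.toFinComplex M.orient)ᵀ *
      incidenceMatrix M.toFinComplex M.orient) x y =
      if x.tet = y.tet then x.sign M.orient * y.sign M.orient else 0 := by
    rw [Matrix.mul_apply, Finset.sum_eq_single ⟨x.tet, x.tet_mem⟩]
    · simp [incidenceMatrix, copyMatrix, eq_comm]
    · intro t _ ht
      have : x.tet ≠ t.1 := fun h => ht (Subtype.ext h.symm)
      simp [incidenceMatrix, copyMatrix, this]
    · simp
  have h2 : (copyMatrix M.toFinComplex * (copyMatrix M.toFinComplex)ᵀ) x y =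
      if x.tet = y.tet then 1 else 0 := by
    rw [Matrix.mul_apply, Finset.sum_eq_single ⟨x.tet, x.tet_mem⟩]
    · simp [copyMatrix, eq_comm]
    · intro t _ ht
      have : x.tet ≠ t.1 := fun h => ht (Subtype.ext h.symm)
      simp [copyMatrix, this]
    · simp
  rw [Matrix.smul_apply, Matrix.add_apply, h1, h2, Matrix.one_apply]
  by_cases hxy : x = y
  · subst hxy
    rw [if_pos rfl, if_pos rfl, if_pos rfl, PentFlag.sign_sq ho, smul_eq_mul]
    norm_num
  · rw [if_neg hxy]
    split_ifs with ht
    · have hne : x.1.1 ≠ y.1.1 := by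
        intro h
        obtain ⟨⟨u, hu⟩, v⟩ := x
        obtain ⟨⟨u', hu'⟩, v'⟩ := y
        dsimp only at h
        subst h
        refine hxy ?_
        have ht' : u.erase v.1 = u.erase v'.1 := ht
        have : v = v' := by
          refine Subtype.ext ?_
          by_contra hne
          exact Finset.notMem_erase v.1 u (ht' ▸ Finset.mem_erase.2 ⟨hne, v.2⟩)
        rw [this]
      have hc := M.coherent x.1.1 x.1.2 y.1.1 y.1.2 hne x.2.1 x.2.2 y.2.1 y.2.2 ht
      have hs : x.sign M.orient = -y.sign M.orient := by
        unfold PentFlag.sign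
        exact_mod_cast hc
      rw [hs, neg_mul, PentFlag.sign_sq ho, neg_add_cancel, smul_zero]
    · simp

/-- The double count for the constant `2`, read off from the exponents. Equal cardinalities turn the
one-sided inverse into a two-sided one. -/
theorem Triangulation.card_pentFlag : Fintype.card (PentFlag M.toFinComplex) =
    Fintype.card (M.simplices 3 ⊕ M.simplices 3) := by
  have h := M.prod_prod_erase fun _ => 2
  have h1 : ∏ u ∈ M.simplices 4, ∏ v ∈ u, 2 = 2 ^ Fintype.card (PentFlag M.toFinComplex) := by
    rw [← Finset.prod_coe_sort, ← Finset.card_univ, ← Finset.prod_const, Fintype.prod_sigma]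
    exact Finset.prod_congr rfl fun u _ => (Finset.prod_coe_sort u.1 fun _ => 2).symm
  rw [h1, Finset.prod_const, ← pow_mul] at h
  rw [Nat.pow_right_injective le_rfl h, Fintype.card_sum, Fintype.card_coe, two_mul]

theorem Triangulation.splitMatrix_mul_joinMatrix :
    splitMatrix M.toFinComplex M.orient * joinMatrix M.toFinComplex M.orient = 1 :=
  (Matrix.mul_eq_one_comm_of_card_eq _ _ _ M.card_pentFlag).1 M.joinMatrix_mul_splitMatrix

end Closed

end PLFermion

/-! ### Combination of the local and global factors -/

namespace PLFermion

open Matrix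

section Invariance

variable {M : Triangulation} {ω : cocycles M.toFinComplex} {K q K' q' : Finset ℕ → ℂ}

theorem IsRootChoice.eq_prod_powersetCard {X : FinComplex} {ω : cocycles X}
    (hR : IsRootChoice X ω K q) {t : Finset ℕ} (ht : t ∈ X.simplices 3) :
    K t = ∏ s ∈ t.powersetCard 3, q s := by
  have htc : t.card = 3 + 1 := (mem_simplices.1 ht).2
  rw [hR.agree t ht]
  refine Finset.prod_bij (fun v _ => t.erase v) (fun v hv => ?_) (fun v hv w hw h => ?_)
    (fun s hs => ?_) fun v _ => rfl
  · exact Finset.mem_powersetCard.2 ⟨Finset.erase_subset _ _, by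
      rw [Finset.card_erase_of_mem hv, htc]⟩
  · by_contra hne
    exact Finset.notMem_erase v t (h ▸ Finset.mem_erase.2 ⟨hne, hv⟩)
  · obtain ⟨hst, hsc⟩ := Finset.mem_powersetCard.1 hs
    obtain ⟨v, hv⟩ := Finset.card_eq_one.1
      (show (t \ s).card = 1 by rw [Finset.card_sdiff_of_subset hst, htc, hsc])
    exact ⟨v, (Finset.mem_sdiff.1 (hv ▸ Finset.mem_singleton_self v)).1, by
      rw [← Finset.sdiff_singleton_eq_erase, ← hv, Finset.sdiff_sdiff_eq_self hst]⟩

/-- The square of the product of all factors in `I` except for the roots `q_s` does not depend on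
the choice of roots. -/
theorem prod_factor_mul_torsion_eq (hω : ∀ s ∈ M.simplices 2, ω.1 s ≠ 0) {ι : Type} [Fintype ι]
    [DecidableEq ι] (b : Module.Basis ι ℂ (cocycles M.toFinComplex))
    {β γ β' γ' : Finset ℕ → cocycles M.toFinComplex →ₗ[ℂ] ℂ}
    {F F' : Finset ℕ → Finset ℕ → Finset ℕ → ℂ} {η η' : Finset ℕ → ℂ} {τ τ' : ℂ}
    (hR : IsRootChoice M.toFinComplex ω K q) (hR' : IsRootChoice M.toFinComplex ω K' q')
    (hL : IsLocalData M.toFinComplex ω K q M.orient β γ F η)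
    (hL' : IsLocalData M.toFinComplex ω K' q' M.orient β' γ' F' η')
    (hτ : IsTorsion b ω β F τ) (hτ' : IsTorsion b ω β' F' τ') :
    (∏ u ∈ M.simplices 4, η' u ^ 2) * τ' = (∏ u ∈ M.simplices 4, η u ^ 2) * τ := by
  have ho : ∀ u ∈ M.simplices 4, (M.orient u : ℂ) * M.orient u = 1 := fun u hu => by
    rcases M.orient_eq u hu with h | h <;> simp [h]
  have hE := hL.edge_operators
  have hE' := hL'.edge_operators
  -- The four coefficients are packed into one vector, arbitrary (zero) outside the complex, to
  -- allow a simultaneous choice.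
  have hgauge : ∀ t, ∃ x : Fin 4 → ℂ, t ∈ M.simplices 3 →
      IsGauge K K' β γ β' γ' t (x 0) (x 1) (x 2) (x 3) := fun t => by
    by_cases ht : t ∈ M.simplices 3
    · obtain ⟨a, b, c, d, h⟩ := hE.exists_gauge hω hR hR' hE' ht
      exact ⟨![a, b, c, d], fun _ => h⟩
    · exact ⟨0, fun h => absurd h ht⟩
  choose x hx using hgauge
  obtain ⟨r, e', hr, hD', hm'⟩ := hτ'.exists_eq b
  obtain ⟨e, hD, hm⟩ := hτ.exists_embedding b (fun t ht => (hE.apply_omega hR hω ht).1) hr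
  have key := minor_gauge M.splitMatrix_mul_joinMatrix M.joinMatrix_mul_splitMatrix hω hR hE ho
    hL.matrix hL'.matrix hx (fun i : {i : ι // i ≠ r} => b i) e e'
  rw [det_submatrix_compl, det_submatrix_compl] at key
  set N := ∏ u ∈ M.simplices 4,
    (gaugeMatrix (fun t => x t 0) (fun t => x t 1) (M.orient u) u (F u)).det with hN
  set S := ∏ t ∈ M.simplices 3, (x t 0 * x t 2 - x t 1 * x t 3) with hS
  -- The roots over the faces of all pentachora are regrouped over tetrahedra, where they form the
  -- `K_t`.
  have hP : (∏ u ∈ M.simplices 4, η' u ^ 2) * ∏ t ∈ M.simplices 3, K t =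
      N * (∏ t ∈ M.simplices 3, K' t) * ∏ u ∈ M.simplices 4, η u ^ 2 := by
    rw [Finset.prod_congr rfl fun t ht => hR.eq_prod_powersetCard ht,
      Finset.prod_congr rfl fun t ht => hR'.eq_prod_powersetCard ht,
      ← M.prod_prod_powersetCard, ← M.prod_prod_powersetCard, hN, ← Finset.prod_mul_distrib,
      ← Finset.prod_mul_distrib, ← Finset.prod_mul_distrib]
    refine Finset.prod_congr rfl fun u hu => ?_
    exact IsPentachoronFactor.gauge hω hR hE hR' hE' hu (ho u hu) (hL.matrix u hu)
      (hL'.matrix u hu) (c := fun t => x t 2) (d := fun t => x t 3) (fun v hv => hx _ (mem_simplices_of_subset hu (Finset.erase_subset _ _)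
        (by rw [Finset.card_erase_of_mem hv, (mem_simplices.1 hu).2])))
      (hL.factor u hu) (hL'.factor u hu)
  have hSK : S * ∏ t ∈ M.simplices 3, K t = ∏ t ∈ M.simplices 3, K' t := by
    rw [hS, ← Finset.prod_mul_distrib]
    exact Finset.prod_congr rfl fun t ht => (hx t ht).det
  have hK0 : ∏ t ∈ M.simplices 3, K t ≠ 0 := Finset.prod_ne_zero_iff.2 fun t ht => by
    rw [hR.eq_prod_powersetCard ht]
    exact Finset.prod_ne_zero_iff.2 fun s hs => hR.root_ne_zero hω
      (mem_simplices_of_subset ht (Finset.mem_powersetCard.1 hs).1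
        (Finset.mem_powersetCard.1 hs).2)
  have hKK : (∏ t ∈ M.simplices 3, K' t) ^ 2 = (∏ t ∈ M.simplices 3, K t) ^ 2 := by
    rw [← Finset.prod_pow, ← Finset.prod_pow]
    refine Finset.prod_congr rfl fun t ht => ?_
    rw [hR.eq_prod_powersetCard ht, hR'.eq_prod_powersetCard ht, ← Finset.prod_pow,
      ← Finset.prod_pow]
    refine Finset.prod_congr rfl fun s hs => ?_
    have hs' := mem_simplices_of_subset (d' := 2) ht (Finset.mem_powersetCard.1 hs).1
      (Finset.mem_powersetCard.1 hs).2
    rw [hR.sq s hs', hR'.sq s hs']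
  -- The squares of `K_t` and `K'_t` are the same products of values of `ω`.
  have hSS : S ^ 2 = 1 := by
    refine mul_right_cancel₀ (pow_ne_zero 2 hK0) ?_
    rw [← mul_pow, hSK, hKK, one_mul]
  have hPN : (∏ u ∈ M.simplices 4, η' u ^ 2) = N * S * ∏ u ∈ M.simplices 4, η u ^ 2 := by
    refine mul_right_cancel₀ hK0 ?_
    rw [hP, ← hSK]
    ring
  -- The squares of the minors of `f₂` from the two torsions are those in the comparison of minors
  -- of `f₃`, and they cancel.
  have hN0 : N * τ' = S * τ := by
    refine mul_right_cancel₀ (mul_ne_zero (pow_ne_zero 2 hD) (pow_ne_zero 2 hD')) ?_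
    linear_combination N * ((evalMatrix β fun i : {i : ι // i ≠ r} => b i).submatrix e id).det ^ 2
      * hm' + b.repr ω r ^ 2 * key -
      S * ((evalMatrix β' fun i : {i : ι // i ≠ r} => b i).submatrix e' id).det ^ 2 * hm
  rw [hPN]
  linear_combination S * (∏ u ∈ M.simplices 4, η u ^ 2) * hN0 +
    τ * (∏ u ∈ M.simplices 4, η u ^ 2) * hSS

end Invariance

end PLFermion

/-- The quantity `I` does not depend, up to a sign, on the choice of the roots `K_t`. The relation
for the move 3–3 is not needed: the triangulation is left unchanged, and the change of the torsion
is compensated exactly by the change of the pentachoron factors. -/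
theorem lemma7p1 (hConj : PLFermion.Conjecture33)
    (M : PLFermion.Triangulation) {ι : Type} [Fintype ι] [DecidableEq ι]
    (b : Module.Basis ι ℂ (PLFermion.cocycles M.toFinComplex))
    (ω : PLFermion.cocycles M.toFinComplex) (hω : ∀ s ∈ M.simplices 2, ω.1 s ≠ 0)
    (K K' : Finset ℕ → ℂ) (I I' : ℂ)
    (hI : PLFermion.IsValueOfI M b ω K I) (hI' : PLFermion.IsValueOfI M b ω K' I') :
    I' = I ∨ I' = -I := by
  obtain ⟨q, β, γ, F, η, ρ, hR, hL, -, hτ, rfl⟩ := hI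
  obtain ⟨q', β', γ', F', η', ρ', hR', hL', -, hτ', rfl⟩ := hI'
  have h := PLFermion.prod_factor_mul_torsion_eq hω b hR hR' hL hL' hτ hτ'
  have hq : (∏ s ∈ M.simplices 2, (q' s)⁻¹) ^ 2 = (∏ s ∈ M.simplices 2, (q s)⁻¹) ^ 2 := by
    rw [← Finset.prod_pow, ← Finset.prod_pow]
    refine Finset.prod_congr rfl fun s hs => ?_
    rw [inv_pow, inv_pow, hR.sq s hs, hR'.sq s hs]
  rw [Finset.prod_pow, Finset.prod_pow] at h
  -- All the square roots in `I` disappear in its square.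
  rw [← sq_eq_sq_iff_eq_or_eq_neg]
  linear_combination (∏ u ∈ M.simplices 4, η' u) ^ 2 * ρ' ^ 2 * hq +
    (∏ s ∈ M.simplices 2, (q s)⁻¹) ^ 2 * h
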